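/- Let $\alpha>0$, $\varepsilon>0$, $w(R)=R^{1-\varepsilon}(1+R)^{1+2\varepsilon}$, and let $X$ be the Hilbert space of (classes of) functions $v:(0,\infty)\to\mathbb C$ with $\int_0^\infty w(R)e^{2\alpha R}|v(R)|^2\,dR<\infty$. Let $V(\mathbf R,\mathbf R')=V(R,R';\cos\eta)$ (with $R=|\mathbf R|$, $R'=|\mathbf R'|$, $\eta$ the angle between $\mathbf R,\mathbf R'\in\mathbb R^3$) be a real, measurable, symmetric ($V(\mathbf R,\mathbf R')=V(\mathbf R',\mathbf R)$), rotationally invariant potential such that $$\int_{\mathbb R^3}w(R)e^{2\alpha R}\,d\mathbf R\int_{\mathbb R^3}w(R')e^{2\alpha R'}\,V(\mathbf R,\mathbf R')^2\,d\mathbf R'<\infty .$$ For $\ell=0,1,2,\dots$ and $k>0$ put $V_\ell(R,R')=2\pi RR'\int_{-1}^1V(R,R';t)P_\ell(t)\,dt$ ($P_\ell$ the Legendre polynomials), and, with the spherical Bessel and Hankel functions $j_\ell$, $h^{(1)}_\ell$, $$G_\ell(k;R,R')=-\mathrm i kRR'\,j_\ell(k\min(R,R'))\,h^{(1)}_\ell(k\max(R,R')),$$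 $$v_{\ell,0}(k;R)=\int_0^\infty V_\ell(R,R')\,kR'j_\ell(kR')\,dR',\qquad L_\ell(k;R,R')=\int_0^\infty V_\ell(R,R'')\,G_\ell(k;R'',R')\,dR''.$$ For $g\in\mathbb C$ consider the integral equation, for $v\in X$, $$v(R)=v_{\ell,0}(k;R)+g\int_0^\infty L_\ell(k;R,R')\,v(R')\,dR'\qquad\text{for a.e. }R>0.\tag{1}$$ The partial scattering amplitude $T_\ell(k;g)=-g\int_0^\infty Rj_\ell(kR)\,v(R)\,dR$ is called well defined if (1) has a solution in $X$ and all solutions $v\in X$ of (1) give the same value. Finally let $\beta(k)>0$ be given by $\cosh\beta(k)=1+2\alpha^2/k^2$, let $\mathcal E_{\beta(k)}$ be the open region bounded by the ellipse with foci $\pm1$ and half major axis $\cosh\beta(k)$, and let $a_\ell(k;g)=T_\ell(k;g)/k$. Then, for every $g\in\mathbb C$: 1. There is $\ell_0$ (depending on $g$, but not on $k$) such that for all $k>0$ and all $\ell\ge\ell_0$, equation (1) has exactly one solution in $X$, so that $T_\ell(k;g)$ is well defined. If $g$ is real, $T_\ell(k;g)$ is well defined for all $k>0$ and all $\ell\ge0$.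 2. For every $k>0$ there is a constant $\widehat C(k,g)\ge0$ such that, for all $\ell\ge0$ for which $T_\ell(k;g)$ is well defined, $$|T_\ell(k;g)|\le\frac{\widehat C(k,g)}{(2\ell+1)^{1/2}}\,\frac{\Gamma(\ell+1)}{\Gamma(\ell+\frac32)}\,e^{-\beta(k)\ell}.$$ The right-hand side, and hence $T_\ell(k;g)$, is $O(\ell^{-1}e^{-\beta(k)\ell})$ as $\ell\to\infty$. 3. For every $k>0$ such that all $T_\ell(k;g)$, $\ell\ge0$, are well defined (in particular for every $k>0$ if $g$ is real), the partial-wave expansion $$F(k,\cos\theta;g)=\sum_{\ell=0}^\infty(2\ell+1)\,a_\ell(k;g)\,P_\ell(\cos\theta)$$ of the total scattering amplitude converges for $\cos\theta\in\mathcal E_{\beta(k)}$, and it defines there a holomorphic function of $\cos\theta$. -/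

import Mathlib

open MeasureTheory Set Filter
open scoped ENNReal Topology

noncomputable section

namespace NonlocalScattering

/-! ### Special functions -/

/-- The Legendre polynomial `P_n`, by Rodrigues' formula. -/
def legendre (n : ℕ) : Polynomial ℝ :=
  Polynomial.C (1 / (2 ^ n * (n.factorial : ℝ))) *
    (Polynomial.derivative^[n] ((Polynomial.X ^ 2 - 1) ^ n))

/-- The spherical Bessel function `j_l(x) = √(π/(2x)) J_{l+1/2}(x)`, by its power series
`∑ₘ (-1)ᵐ x^(2m+l) / (2ᵐ m! (2m+2l+1)‼)`. -/
def sphBesselJ (l : ℕ) (x : ℝ) : ℝ :=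
  ∑' m : ℕ, (-1 : ℝ) ^ m * x ^ (2 * m + l) /
    (2 ^ m * (m.factorial : ℝ) * (Nat.doubleFactorial (2 * m + 2 * l + 1) : ℝ))

/-- The spherical Hankel function `h_l^{(1)}(x) = √(π/(2x)) H^{(1)}_{l+1/2}(x)`, for which Hankel's
asymptotic series is a finite sum and exact:
`h_l^{(1)}(x) = (-i)^(l+1) (e^{ix}/x) ∑_{m ≤ l} ((l+m)!/(m! (l-m)!)) (i/(2x))^m`. -/
def sphHankel1 (l : ℕ) (x : ℝ) : ℂ :=
  (-Complex.I) ^ (l + 1) * (Complex.exp (Complex.I * x) / x) *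
    ∑ m ∈ Finset.range (l + 1),
      (((l + m).factorial : ℂ) / ((m.factorial : ℂ) * ((l - m).factorial : ℂ))) *
        (Complex.I / (2 * x)) ^ m

/-! ### The class of potentials and the weighted Hilbert space -/

/-- Three-dimensional Euclidean space. -/
abbrev E3 : Type := EuclideanSpace ℝ (Fin 3)

/-- The weight-function `w^{(ε)}(R) = R^{1-ε} (1+R)^{1+2ε}`. -/
def weight (ε : ℝ) (R : ℝ) : ℝ := R ^ (1 - ε) * (1 + R) ^ (1 + 2 * ε)

/-- The rotationally invariant kernel on `ℝ³ × ℝ³` with profile `V(R, R'; cos η)`. -/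
def potentialKernel (V : ℝ → ℝ → ℝ → ℝ) (x y : E3) : ℝ :=
  V ‖x‖ ‖y‖ (inner ℝ x y / (‖x‖ * ‖y‖))

/-- The number `C(V) ∈ [0, ∞]`, with
`C(V)² = ∫ w(R) e^{2αR} dx ∫ w(R') e^{2αR'} V(x, y)² dy` over `ℝ³ × ℝ³`, `R = |x|`, `R' = |y|`. -/
def potentialNorm (w : ℝ → ℝ) (α : ℝ) (V : ℝ → ℝ → ℝ → ℝ) : ℝ≥0∞ :=
  (∫⁻ x : E3, ENNReal.ofReal (w ‖x‖ * Real.exp (2 * α * ‖x‖)) *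
    ∫⁻ y : E3, ENNReal.ofReal (w ‖y‖ * Real.exp (2 * α * ‖y‖)) *
      ENNReal.ofReal (potentialKernel V x y ^ 2)) ^ (1 / 2 : ℝ)

/-- The class `N_{w,α}` of real, symmetric, rotationally invariant nonlocal potentials with
`C(V) < ∞`; a potential is given by its profile `V(R, R'; cos η)`. -/
structure IsNonlocalPotential (w : ℝ → ℝ) (α : ℝ) (V : ℝ → ℝ → ℝ → ℝ) : Prop where
  measurable : Measurable fun p : ℝ × ℝ × ℝ => V p.1 p.2.1 p.2.2
  symm : ∀ R R' t : ℝ, 0 < R → 0 < R' → t ∈ Icc (-1 : ℝ) 1 → V R R' t = V R' R t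
  norm_lt_top : potentialNorm w α V < ∞

/-- The measure `w(R) e^{2αR} dR` on `(0, ∞)`. -/
def weightedMeasure (w : ℝ → ℝ) (α : ℝ) : Measure ℝ :=
  (volume.restrict (Ioi (0 : ℝ))).withDensity fun R => ENNReal.ofReal (w R * Real.exp (2 * α * R))

/-- Membership in the Hilbert space `X_{w,α}` of (classes of) functions on `(0, ∞)` that are square
integrable with respect to `w(R) e^{2αR} dR`. -/
def MemX (w : ℝ → ℝ) (α : ℝ) (v : ℝ → ℂ) : Prop :=
  MemLp v 2 (weightedMeasure w α)

/-! ### The Lippmann-Schwinger equation at angular momentum `l` -/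

/-- The Fourier-Legendre coefficient `V_l(R,R') = 2π R R' ∫_{-1}^{1} V(R,R';t) P_l(t) dt`. -/
def partialPotential (V : ℝ → ℝ → ℝ → ℝ) (l : ℕ) (R R' : ℝ) : ℝ :=
  2 * Real.pi * R * R' * ∫ t in (-1 : ℝ)..1, V R R' t * (legendre l).eval t

/-- The Green function
`G_l(k;R,R') = -i k R R' j_l(k min(R,R')) h_l^{(1)}(k max(R,R'))`. -/
def green (l : ℕ) (k R R' : ℝ) : ℂ :=
  -Complex.I * k * R * R' * (sphBesselJ l (k * min R R') : ℂ) * sphHankel1 l (k * max R R')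

/-- The inhomogeneous term `v_{l,0}(k;R) = ∫₀^∞ V_l(R,R') k R' j_l(kR') dR'`. -/
def freeTerm (V : ℝ → ℝ → ℝ → ℝ) (l : ℕ) (k R : ℝ) : ℝ :=
  ∫ R' in Ioi (0 : ℝ), partialPotential V l R R' * (k * R' * sphBesselJ l (k * R'))

/-- The kernel `L_l(k;R,R') = ∫₀^∞ V_l(R,R'') G_l(k;R'',R') dR''`. -/
def kernelL (V : ℝ → ℝ → ℝ → ℝ) (l : ℕ) (k R R' : ℝ) : ℂ :=
  ∫ R'' in Ioi (0 : ℝ), (partialPotential V l R R'' : ℂ) * green l k R'' R'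

/-- `v` is a solution in `X_{w,α}` of the integral equation
`v(R) = v_{l,0}(k;R) + g ∫₀^∞ L_l(k;R,R') v(R') dR'` (for a.e. `R > 0`). -/
def IsLSSolution (w : ℝ → ℝ) (α : ℝ) (V : ℝ → ℝ → ℝ → ℝ) (l : ℕ) (k : ℝ) (g : ℂ)
    (v : ℝ → ℂ) : Prop :=
  MemX w α v ∧
    ∀ᵐ R ∂(volume.restrict (Ioi (0 : ℝ))),
      v R = (freeTerm V l k R : ℂ) + g * ∫ R' in Ioi (0 : ℝ), kernelL V l k R R' * v R'

/-- The integral equation has one and only one solution in `X_{w,α}` (up to a.e. equality). -/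
def UniquelySolvable (w : ℝ → ℝ) (α : ℝ) (V : ℝ → ℝ → ℝ → ℝ) (l : ℕ) (k : ℝ) (g : ℂ) : Prop :=
  ∃ v, IsLSSolution w α V l k g v ∧
    ∀ v', IsLSSolution w α V l k g v' → v' =ᵐ[volume.restrict (Ioi (0 : ℝ))] v

/-! ### Partial and total scattering amplitudes -/

/-- `T = -g ∫₀^∞ R j_l(kR) v(R) dR` for some solution `v` in `X_{w,α}` of the integral equation. -/
def IsPartialAmplitude (w : ℝ → ℝ) (α : ℝ) (V : ℝ → ℝ → ℝ → ℝ) (l : ℕ) (k : ℝ) (g T : ℂ) : Prop :=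
  ∃ v, IsLSSolution w α V l k g v ∧
    T = -g * ∫ R in Ioi (0 : ℝ), ((R * sphBesselJ l (k * R) : ℝ) : ℂ) * v R

/-- The integral equation has a solution, and all its solutions give the same amplitude. -/
def AmplitudeDefined (w : ℝ → ℝ) (α : ℝ) (V : ℝ → ℝ → ℝ → ℝ) (l : ℕ) (k : ℝ) (g : ℂ) : Prop :=
  ∃! T, IsPartialAmplitude w α V l k g T

/-- The partial scattering amplitude `T_l(k;g) = -g ∫₀^∞ R j_l(kR) v_l(k,g;R) dR`
(meaningful if `AmplitudeDefined w α V l k g`). -/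
def partialAmplitude (w : ℝ → ℝ) (α : ℝ) (V : ℝ → ℝ → ℝ → ℝ) (l : ℕ) (k : ℝ) (g : ℂ) : ℂ :=
  Classical.epsilon fun T => IsPartialAmplitude w α V l k g T

/-- The term `(2l+1) a_l(k;g) P_l(z)` of the partial-wave expansion, with `a_l = T_l / k`. -/
def partialWaveTerm (w : ℝ → ℝ) (α : ℝ) (V : ℝ → ℝ → ℝ → ℝ) (k : ℝ) (g : ℂ) (z : ℂ)
    (l : ℕ) : ℂ :=
  (2 * l + 1) * (partialAmplitude w α V l k g / k) * Polynomial.aeval z (legendre l)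

/-- The total scattering amplitude `F(k, z; g) = ∑_l (2l+1) a_l(k;g) P_l(z)`, `z = cos θ`. -/
def totalAmplitude (w : ℝ → ℝ) (α : ℝ) (V : ℝ → ℝ → ℝ → ℝ) (k : ℝ) (g : ℂ) (z : ℂ) : ℂ :=
  ∑' l : ℕ, partialWaveTerm w α V k g z l

/-- The number `β(k) > 0` with `cosh β(k) = 1 + 2α²/k²`. -/
def beta (α k : ℝ) : ℝ := Real.arcosh (1 + 2 * α ^ 2 / k ^ 2)

/-- The open region bounded by the ellipse with foci `±1` and half major axis `cosh β`. -/
def ellipse (β : ℝ) : Set ℂ := {z | ‖z - 1‖ + ‖z + 1‖ < 2 * Real.cosh β}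

/-- The majorant `(2l+1)^{-1/2} (Γ(l+1)/Γ(l+3/2)) e^{-βl}`. -/
def majorant (β : ℝ) (l : ℕ) : ℝ :=
  (2 * (l : ℝ) + 1) ^ (-(1 / 2) : ℝ) *
    (Real.Gamma ((l : ℝ) + 1) / Real.Gamma ((l : ℝ) + 3 / 2)) * Real.exp (-β * l)

end NonlocalScattering

end

/-! Put ρ = w(R)e^{2αR}. The substitution F = √ρ·v turns (1) into F − g𝒱𝒢F = 𝒱φ in L²(0,∞), where 𝒱
has kernel √ρ V_l √ρ, 𝒢 has kernel G_l/(√ρ√ρ), and φ = kR j_l(kR)/√ρ. The amplitude becomes T_l =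
−(g/k)⟨φ, F⟩ (`isLSSolution_iff`, `isPartialAmplitude_iff`).

Both operators are Hilbert-Schmidt. Cauchy-Schwarz against P_l, with ∫P_l² = 2/(2l+1), gives ‖𝒱‖ ≤
C(V)/√(2l+1) (`norm_potentialOp_le`). The bound |G_l(k;R,R')| ≤ min(R,R') and R ≤ w(R) give ‖𝒢‖ ≤
1/(2α), uniformly in l and k (`norm_green_le`, `norm_greenOp_le`). Hence ‖g𝒱𝒢‖ ≤ 1/2 for l ≥ l₀(g),
whatever k is: the equation is uniquely solvable, ‖F‖ ≤ 2‖𝒱φ‖, and |T_l| is at most a constant times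
‖φ‖²/√(2l+1).

The exponential decay sits in ‖φ‖² ≤ k²∫e^{−2αR} R j_l(kR)² dR. Gegenbauer's formula
(`sphBesselJ_sq_eq`) and a Laplace transform turn the right-hand side into Neumann's integral
(1/4)∫P_l(t)/(cosh β − t) dt, which is O(e^{−βl}/√l) by Rodrigues' formula and Laplace's method
(`integral_inv_sub_mul_legendre_le`).

For real g and arbitrary l, 𝒢 − 𝒢† = −(2i/k)|φ⟩⟨φ| has rank one (`inner_greenOp_sub`). Solutions of
the homogeneous equation are therefore orthogonal to φ, so T_l does not depend on the chosen
solution; the same argument for 𝒢† gives the orthogonality under which the Fredholm alternative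
provides a solution (`exists_sub_smul_eq_of_real`).

Finally |P_l(z)| ≤ M^l on the ellipse with semi-axis sum M (`norm_aeval_legendre_le`), so for M <
e^β the partial-wave series is dominated by a geometric one, and Weierstrass' theorem gives
holomorphy. -/

noncomputable section

namespace NonlocalScattering

/-! ### Legendre polynomials -/

/-- The normalising constant of Rodrigues' formula. -/
def rodriguesConst (l : ℕ) : ℝ := 1 / (2 ^ l * (l.factorial : ℝ))

lemma rodriguesConst_pos (l : ℕ) : 0 < rodriguesConst l := by
  unfold rodriguesConst; positivity

/-- The polynomial `(X² - 1)^l` of Rodrigues' formula. -/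
def rodriguesPoly (l : ℕ) : Polynomial ℝ := (Polynomial.X ^ 2 - 1) ^ l

lemma legendre_eval (l : ℕ) (t : ℝ) :
    (legendre l).eval t
      = rodriguesConst l * (Polynomial.derivative^[l] (rodriguesPoly l)).eval t := by
  simp [legendre, rodriguesConst, rodriguesPoly]

lemma rodriguesPoly_eval (l : ℕ) (t : ℝ) : (rodriguesPoly l).eval t = (t ^ 2 - 1) ^ l := by
  simp [rodriguesPoly]

/-- After j < l derivatives a factor `X ^ 2 - 1` still divides; this removes the boundary terms in
the integrations by parts. -/
lemma eval_iterate_derivative_rodriguesPoly (l j : ℕ) (hj : j < l) (t : ℝ) (ht : t ^ 2 = 1) :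
    (Polynomial.derivative^[j] (rodriguesPoly l)).eval t = 0 := by
  obtain ⟨q, hq⟩ := Polynomial.pow_sub_dvd_iterate_derivative_pow
    ((Polynomial.X : Polynomial ℝ) ^ 2 - 1) l j
  rw [rodriguesPoly, hq]
  simp [ht, Nat.sub_ne_zero_of_lt hj]

/-- Repeated integration by parts against a Legendre polynomial. -/
lemma integral_mul_legendre (l : ℕ) (F : ℕ → ℝ → ℝ)
    (hF : ∀ i, ∀ t ∈ Icc (-1 : ℝ) 1, HasDerivAt (F i) (F (i + 1) t) t) :
    ∫ t in (-1 : ℝ)..1, F 0 t * (legendre l).eval t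
      = rodriguesConst l * (-1) ^ l * ∫ t in (-1 : ℝ)..1, F l t * (t ^ 2 - 1) ^ l := by
  have hI : uIcc (-1 : ℝ) 1 = Icc (-1) 1 := uIcc_of_le (by norm_num)
  have hint : ∀ i, IntervalIntegrable (F i) volume (-1) 1 := fun i =>
    ContinuousOn.intervalIntegrable fun t ht =>
      (hF i t (hI ▸ ht)).continuousAt.continuousWithinAt
  have key : ∀ j, j ≤ l → ∫ t in (-1 : ℝ)..1, F 0 t
      * (Polynomial.derivative^[l] (rodriguesPoly l)).eval t
      = (-1) ^ j * ∫ t in (-1 : ℝ)..1,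
          F j t * (Polynomial.derivative^[l - j] (rodriguesPoly l)).eval t := by
    intro j
    induction j with
    | zero => intro _; simp
    | succ j ih =>
      intro hj
      rw [ih (by omega)]
      obtain ⟨m, hm⟩ : ∃ m, l - j = m + 1 := ⟨l - j - 1, by omega⟩
      have hm' : l - (j + 1) = m := by omega
      rw [hm, hm', intervalIntegral.integral_mul_deriv_eq_deriv_mul
        (u := F j) (u' := F (j + 1))
        (v := fun t => (Polynomial.derivative^[m] (rodriguesPoly l)).eval t)
        (fun t ht => hF j t (hI ▸ ht))
        (fun t _ => by
          rw [Function.iterate_succ_apply']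
          exact Polynomial.hasDerivAt _ t)
        (hint _) ((Polynomial.continuous _).intervalIntegrable _ _)]
      rw [eval_iterate_derivative_rodriguesPoly l m (by omega) 1 (by norm_num),
        eval_iterate_derivative_rodriguesPoly l m (by omega) (-1) (by norm_num)]
      ring
  have := key l le_rfl
  simp only [Nat.sub_self, Function.iterate_zero, id, rodriguesPoly_eval] at this
  simp_rw [legendre_eval, mul_left_comm _ (rodriguesConst l)]
  rw [intervalIntegral.integral_const_mul, this]
  ring

/-- A beta integral: integrating by parts lowers n and raises m, hence the induction with m free. -/
lemma integral_one_sub_pow_mul_one_add_pow (n m : ℕ) :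
    ∫ t in (-1 : ℝ)..1, (1 - t) ^ n * (1 + t) ^ m
      = 2 ^ (n + m + 1) * n.factorial * m.factorial / (n + m + 1).factorial := by
  induction n generalizing m with
  | zero =>
    simp only [pow_zero, one_mul]
    rw [intervalIntegral.integral_comp_add_left (fun t => t ^ m) 1, integral_pow]
    have := Nat.factorial_pos m
    norm_num [Nat.factorial_succ]
    field_simp
  | succ n ih =>
    have h := intervalIntegral.integral_mul_deriv_eq_deriv_mul (a := (-1 : ℝ)) (b := 1)
      (u := fun t => (1 - t) ^ (n + 1)) (u' := fun t => -((n + 1 : ℝ) * (1 - t) ^ n))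
      (v := fun t => (1 + t) ^ (m + 1) / (m + 1)) (v' := fun t => (1 + t) ^ m)
      (fun t _ => by
        refine (((hasDerivAt_id t).const_sub 1).pow (n + 1)).congr_deriv ?_
        simp)
      (fun t _ => by
        refine ((((hasDerivAt_id t).const_add 1).pow (m + 1)).div_const (m + 1 : ℝ)).congr_deriv ?_
        have : (m + 1 : ℝ) ≠ 0 := by positivity
        simp; field_simp)
      (Continuous.intervalIntegrable (by fun_prop) _ _)
      (Continuous.intervalIntegrable (by fun_prop) _ _)
    rw [h]
    have : ∀ t : ℝ, -((n + 1 : ℝ) * (1 - t) ^ n) * ((1 + t) ^ (m + 1) / (m + 1))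
        = (-((n + 1 : ℝ) / (m + 1))) * ((1 - t) ^ n * (1 + t) ^ (m + 1)) := by
      intro t; ring
    simp_rw [this]
    rw [intervalIntegral.integral_const_mul, ih]
    have e : n + (m + 1) + 1 = n + 1 + m + 1 := by ring
    have h3 : (m + 1 : ℝ) ≠ 0 := by positivity
    rw [e]
    simp only [Nat.factorial_succ n, Nat.factorial_succ m]
    push_cast
    have h2 : ((n + 1 + m + 1).factorial : ℝ) ≠ 0 := by positivity
    field_simp
    norm_num

/-- The falling factorial vanishes for n < l, which is the orthogonality of P_l to lower degrees.
These moments serve to integrate the sinc series termwise. -/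
lemma integral_one_sub_pow_mul_legendre (l n : ℕ) :
    ∫ t in (-1 : ℝ)..1, (1 - t) ^ n * (legendre l).eval t
      = (-1) ^ l * 2 ^ (n + 1) * n.descFactorial l * n.factorial / (n + l + 1).factorial := by
  have h := integral_mul_legendre l
    -- The i-th derivative of (1 − t)^n. The truncated exponent `n - i` is harmless because
    -- `n.descFactorial i` is zero for i > n.
    (fun i t => (-1) ^ i * (n.descFactorial i : ℝ) * (1 - t) ^ (n - i))
    (fun i t _ => by
      have := (((hasDerivAt_id t).const_sub 1).pow (n - i)).const_mul
        ((-1) ^ i * (n.descFactorial i : ℝ))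
      refine this.congr_deriv ?_
      rw [Nat.descFactorial_succ, Nat.sub_sub]
      push_cast
      simp
      ring)
  simp only [pow_zero, Nat.descFactorial_zero, Nat.cast_one, one_mul, Nat.sub_zero] at h
  rw [h]
  rcases lt_or_ge n l with hn | hn
  · simp [Nat.descFactorial_of_lt hn]
  · have : ∀ t : ℝ, (-1) ^ l * (n.descFactorial l : ℝ) * (1 - t) ^ (n - l) * (t ^ 2 - 1) ^ l
        = (n.descFactorial l : ℝ) * ((1 - t) ^ n * (1 + t) ^ l) := by
      intro t
      rw [show t ^ 2 - 1 = (-1) * ((1 - t) * (1 + t)) by ring, mul_pow, mul_pow]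
      have e : (1 - t) ^ n = (1 - t) ^ (n - l) * (1 - t) ^ l := by
        rw [← pow_add, Nat.sub_add_cancel hn]
      rw [e]
      have e2 : ((-1 : ℝ) ^ l) * (-1) ^ l = 1 := by rw [← mul_pow]; simp
      linear_combination (n.descFactorial l : ℝ) * (1 - t) ^ (n - l) * (1 - t) ^ l * (1 + t) ^ l
          * e2
    simp_rw [this]
    rw [intervalIntegral.integral_const_mul, integral_one_sub_pow_mul_one_add_pow, rodriguesConst]
    have h2 : ((n + l + 1).factorial : ℝ) ≠ 0 := by positivity
    have h3 : (l.factorial : ℝ) ≠ 0 := by positivity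
    field_simp
    ring

lemma iterate_derivative_rodriguesPoly_eval (l : ℕ) (t : ℝ) :
    (Polynomial.derivative^[2 * l] (rodriguesPoly l)).eval t = (2 * l).factorial := by
  have hm : (rodriguesPoly l).Monic := by
    rw [rodriguesPoly, show (1 : Polynomial ℝ) = Polynomial.C 1 by simp]
    exact (Polynomial.monic_X_pow_sub_C 1 (by norm_num)).pow l
  have hd : (rodriguesPoly l).natDegree = 2 * l := by
    rw [rodriguesPoly, Polynomial.natDegree_pow, show (1 : Polynomial ℝ) = Polynomial.C 1 by simp,
      Polynomial.natDegree_X_pow_sub_C, mul_comm]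
  have h0 : (Polynomial.derivative^[2 * l] (rodriguesPoly l)).natDegree ≤ 0 := by
    simpa [hd] using Polynomial.natDegree_iterate_derivative (rodriguesPoly l) (2 * l)
  rw [Polynomial.eq_C_of_natDegree_le_zero h0, Polynomial.eval_C,
      Polynomial.coeff_iterate_derivative]
  have : (rodriguesPoly l).coeff (2 * l) = 1 := by rw [← hd]; exact hm
  simp [this, Nat.descFactorial_self]

/-- Integrating by parts against P_l itself leaves the constant (2l)! times a beta integral. This
value is the source of the factor 1/√(2l+1) in the bound on the potential. -/
lemma integral_legendre_sq (l : ℕ) :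
    ∫ t in (-1 : ℝ)..1, (legendre l).eval t ^ 2 = 2 / (2 * l + 1) := by
  have h := integral_mul_legendre l
    (fun i t => rodriguesConst l * (Polynomial.derivative^[l + i] (rodriguesPoly l)).eval t)
    (fun i t _ => by
      have := (Polynomial.hasDerivAt (Polynomial.derivative^[l + i] (rodriguesPoly l)) t).const_mul
        (rodriguesConst l)
      rwa [← Function.iterate_succ_apply' Polynomial.derivative] at this)
  simp only [add_zero, ← legendre_eval, ← two_mul, iterate_derivative_rodriguesPoly_eval] at h
  simp_rw [sq (Polynomial.eval _ _)]
  rw [h, intervalIntegral.integral_const_mul]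
  have : ∀ t : ℝ, (t ^ 2 - 1) ^ l = (-1) ^ l * ((1 - t) ^ l * (1 + t) ^ l) := by
    intro t; rw [← mul_pow, ← mul_pow]; ring
  simp_rw [this]
  rw [intervalIntegral.integral_const_mul, integral_one_sub_pow_mul_one_add_pow, rodriguesConst]
  have e2 : ((-1 : ℝ) ^ l) * (-1) ^ l = 1 := by rw [← mul_pow]; simp
  rw [show l + l + 1 = 2 * l + 1 by ring, Nat.factorial_succ (2 * l)]
  have h2 : ((2 * l).factorial : ℝ) ≠ 0 := by positivity
  have h3 : (l.factorial : ℝ) ≠ 0 := by positivity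
  push_cast
  field_simp
  rw [show ((-1 : ℝ) ^ l) ^ 2 = 1 by rw [sq, e2]]
  rw [← pow_mul, mul_comm l 2]
  ring

lemma iteratedDeriv_polynomial_eval (q : Polynomial ℂ) (n : ℕ) :
    iteratedDeriv n (fun z => q.eval z) = fun z => (Polynomial.derivative^[n] q).eval z := by
  induction n with
  | zero => simp
  | succ n ih =>
    rw [iteratedDeriv_succ, ih, Function.iterate_succ_apply']
    ext z
    simp

lemma aeval_legendre (l : ℕ) (z : ℂ) :
    Polynomial.aeval z (legendre l)
      = rodriguesConst l * iteratedDeriv l (fun ζ : ℂ => (ζ ^ 2 - 1) ^ l) z := by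
  have : (fun ζ : ℂ => (ζ ^ 2 - 1) ^ l)
      = fun ζ => (((Polynomial.X : Polynomial ℂ) ^ 2 - 1) ^ l).eval ζ := by
    ext; simp
  rw [this, iteratedDeriv_polynomial_eval, legendre, map_mul, Polynomial.aeval_C,
    Polynomial.aeval_def, Polynomial.eval₂_eq_eval_map, ← Polynomial.iterate_derivative_map]
  simp [rodriguesConst]

/-- The Laplace-type bound `|P_l(z)| ≤ max(|z + s|, |z - s|)^l`, `s² = z² - 1 ≠ 0`. -/
lemma norm_aeval_legendre_le_of_ne {z s : ℂ} (hs : s ^ 2 = z ^ 2 - 1) (hs0 : s ≠ 0) (l : ℕ)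
    {M : ℝ} (h1 : ‖z + s‖ ≤ M) (h2 : ‖z - s‖ ≤ M) :
    ‖Polynomial.aeval z (legendre l)‖ ≤ M ^ l := by
  have hr : 0 < ‖s‖ := norm_pos_iff.mpr hs0
  have hM : 0 ≤ M := (norm_nonneg _).trans h1
  -- Cauchy's estimate for the l-th derivative on the circle of radius |s| about z: the factor
  -- l!/|s|^l it costs cancels the 2^l l! of Rodrigues' formula and the (2|s|)^l found here.
  have hbound : ∀ ζ ∈ Metric.sphere z ‖s‖, ‖(ζ ^ 2 - 1) ^ l‖ ≤ (2 * ‖s‖ * M) ^ l := by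
    intro ζ hζ
    rw [norm_pow]
    refine pow_le_pow_left₀ (norm_nonneg _) ?_ l
    set d := ζ - z with hd
    have hdn : ‖d‖ = ‖s‖ := by simpa [dist_eq_norm] using hζ
    -- with `d = s e`, `|e| = 1`
    set e := d / s with he
    have hde : d = s * e := by rw [he]; field_simp
    have hen : ‖e‖ = 1 := by rw [he, norm_div, hdn, div_self hr.ne']
    have hee : e * (starRingEnd ℂ) e = 1 := by
      rw [Complex.mul_conj, Complex.normSq_eq_norm_sq, hen]; simp
    have hc : e + (starRingEnd ℂ) e = ((2 * e.re : ℝ) : ℂ) := by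
      rw [Complex.add_conj]
    have hre : |e.re| ≤ 1 := hen ▸ Complex.abs_re_le_norm e
    -- With ζ = z + se and e·ē = 1, one has ζ² − 1 = 2d(z + s Re e), and z + s Re e is a convex
    -- combination of z + s and z − s.
    have hfac : ζ ^ 2 - 1
        = 2 * d * (((1 + e.re) / 2 : ℝ) * (z + s) + ((1 - e.re) / 2 : ℝ) * (z - s)) := by
      have : ζ = z + s * e := by rw [← hde, hd]; ring
      rw [this, hde]
      push_cast at hc ⊢
      linear_combination (-1) * hs + (s ^ 2 * e) * hc - s ^ 2 * hee
    rw [hfac, norm_mul, norm_mul, hdn]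
    simp only [Complex.norm_ofNat]
    refine mul_le_mul_of_nonneg_left ?_ (by positivity)
    have := abs_le.mp hre
    calc _ ≤ ‖((1 + e.re) / 2 : ℝ) * (z + s)‖ + ‖((1 - e.re) / 2 : ℝ) * (z - s)‖ := norm_add_le _ _
      _ = (1 + e.re) / 2 * ‖z + s‖ + (1 - e.re) / 2 * ‖z - s‖ := by
        rw [norm_mul, norm_mul, Complex.norm_real, Complex.norm_real,
            Real.norm_of_nonneg (by linarith),
          Real.norm_of_nonneg (by linarith)]
      _ ≤ (1 + e.re) / 2 * M + (1 - e.re) / 2 * M := by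
        gcongr <;> linarith
      _ = M := by ring
  have hdiff : DiffContOnCl ℂ (fun ζ : ℂ => (ζ ^ 2 - 1) ^ l) (Metric.ball z ‖s‖) :=
    Differentiable.diffContOnCl (by fun_prop)
  have := Complex.norm_iteratedDeriv_le_of_forall_mem_sphere_norm_le l hr hdiff hbound
  rw [aeval_legendre, norm_mul, Complex.norm_real, Real.norm_of_nonneg (rodriguesConst_pos l).le]
  refine (mul_le_mul_of_nonneg_left this (rodriguesConst_pos l).le).trans (le_of_eq ?_)
  rw [rodriguesConst, mul_pow, mul_pow]
  have h3 : (l.factorial : ℝ) ≠ 0 := by positivity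
  field_simp

/-- The elliptic radius of `z`: the `M ≥ 1` with `M + 1/M = |z - 1| + |z + 1|`. -/
lemma norm_aeval_legendre_le {z : ℂ} {M : ℝ} (hM : 1 < M) (hz : ‖z - 1‖ + ‖z + 1‖ ≤ M + M⁻¹)
    (l : ℕ) : ‖Polynomial.aeval z (legendre l)‖ ≤ M ^ l := by
  have hne : ∀ z : ℂ, z ^ 2 - 1 ≠ 0 → ‖z - 1‖ + ‖z + 1‖ ≤ M + M⁻¹ →
      ‖Polynomial.aeval z (legendre l)‖ ≤ M ^ l := by
    intro z hz1 hz
    obtain ⟨s, hs⟩ := IsAlgClosed.exists_pow_nat_eq (z ^ 2 - 1) (n := 2) (by norm_num)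
    have hs0 : s ≠ 0 := by rintro rfl; exact hz1 (by simpa using hs.symm)
    have hprod : ‖z + s‖ * ‖z - s‖ = 1 := by
      rw [← norm_mul, show (z + s) * (z - s) = 1 by linear_combination -hs, norm_one]
    -- |z + s| and |z − s| are reciprocal, and two parallelogram laws show that their sum is the sum
    -- of the distances of z to the foci.
    have hsq : (‖z - 1‖ + ‖z + 1‖) ^ 2 = (‖z + s‖ + ‖z - s‖) ^ 2 := by
      have p1 : ‖z - 1‖ * ‖z + 1‖ = ‖s‖ ^ 2 := by
        rw [← norm_mul, ← norm_pow, hs]; congr 1; ring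
      have q1 := parallelogram_law_with_norm ℝ z 1
      have q2 := parallelogram_law_with_norm ℝ z s
      simp only [norm_one] at q1
      nlinarith
    have hsum : ‖z - 1‖ + ‖z + 1‖ = ‖z + s‖ + ‖z - s‖ :=
      (pow_left_inj₀ (by positivity) (by positivity) two_ne_zero).mp hsq
    have hM0 : 0 < M := by linarith
    -- Monotonicity of r + 1/r for r ≥ 1, applied to each of the two reciprocal moduli.
    have key : ∀ a b : ℝ, 0 ≤ a → 0 ≤ b → a * b = 1 → a + b ≤ M + M⁻¹ → a ≤ M := by
      intro a b ha hb hab hs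
      by_contra hcon
      push Not at hcon
      have hbM : b < M⁻¹ := by
        rw [lt_inv_comm₀ (by nlinarith) hM0, ← eq_inv_of_mul_eq_one_left hab]
        exact hcon
      have hMi : M * M⁻¹ = 1 := mul_inv_cancel₀ hM0.ne'
      have hMi1 : M⁻¹ < 1 := inv_lt_one_of_one_lt₀ hM
      nlinarith
    exact norm_aeval_legendre_le_of_ne hs hs0 l
      (key _ _ (norm_nonneg _) (norm_nonneg _) hprod (hsum ▸ hz))
      (key _ _ (norm_nonneg _) (norm_nonneg _) (by rw [mul_comm]; exact hprod)
        (by rw [add_comm]; exact hsum ▸ hz))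
  by_cases hz1 : z ^ 2 - 1 = 0
  · -- `z = ±1` is a limit of points of the segment `(-1, 1)`
    have hlim : Tendsto (fun t : ℝ => ‖Polynomial.aeval ((t : ℂ) * z) (legendre l)‖) (𝓝[<] 1)
        (𝓝 ‖Polynomial.aeval z (legendre l)‖) := by
      have : Continuous fun t : ℝ => ‖Polynomial.aeval ((t : ℂ) * z) (legendre l)‖ :=
        ((legendre l).continuous_aeval.comp (by fun_prop)).norm
      have h := this.tendsto 1
      simp only [Complex.ofReal_one, one_mul] at h
      exact h.mono_left nhdsWithin_le_nhds
    refine le_of_tendsto hlim ?_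
    filter_upwards [Ioo_mem_nhdsLT (show (0 : ℝ) < 1 by norm_num)] with t ht
    have hzz : z = 1 ∨ z = -1 := by
      have : (z - 1) * (z + 1) = 0 := by linear_combination hz1
      rcases mul_eq_zero.mp this with h | h
      · exact Or.inl (by linear_combination h)
      · exact Or.inr (by linear_combination h)
    have hMM : 2 ≤ M + M⁻¹ := by
      have hM0 : 0 < M := by linarith
      have hMi : M * M⁻¹ = 1 := mul_inv_cancel₀ hM0.ne'
      have : 0 < M⁻¹ := by positivity
      nlinarith [sq_nonneg (M - M⁻¹)]
    have n1 : ‖(t : ℂ) - 1‖ = 1 - t := by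
      rw [← Complex.ofReal_one, ← Complex.ofReal_sub, Complex.norm_real, Real.norm_of_nonpos]
      · ring
      · linarith [ht.2]
    have n2 : ‖(t : ℂ) + 1‖ = 1 + t := by
      rw [← Complex.ofReal_one, ← Complex.ofReal_add, Complex.norm_real, Real.norm_of_nonneg]
      · ring
      · linarith [ht.1]
    have hsq1 : ((t : ℂ) * z) ^ 2 - 1 ≠ 0 := by
      rw [mul_pow, show z ^ 2 = 1 by linear_combination hz1, mul_one]
      intro h
      have : t ^ 2 - 1 = 0 := by exact_mod_cast h
      nlinarith [ht.1, ht.2]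
    refine hne _ hsq1 ?_
    rcases hzz with rfl | rfl
    · rw [mul_one, n1, n2]; linarith
    · rw [show (t : ℂ) * -1 - 1 = -(t + 1) by ring, show (t : ℂ) * -1 + 1 = -(t - 1) by ring,
        norm_neg, norm_neg, n1, n2]; linarith
  · exact hne z hz1 hz

/-! ### Spherical Bessel and Hankel functions -/

/-- Pascal's rule twice, then the ratio of neighbouring binomials. Both coefficient recurrences,
`hankelCoeff_succ` and `modulusCoeff_succ_succ`, come from it. -/
lemma choose_add_two_identity (l j : ℕ) :
    (2 * j + 1 : ℝ) * ((l + j + 3).choose (2 * j + 2) - (l + j + 1).choose (2 * j + 2))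
      = (2 * l + 3) * (l + j + 1).choose (2 * j) := by
  have h1 : (l + j + 3).choose (2 * j + 2) = (l + j + 1).choose (2 * j)
      + 2 * (l + j + 1).choose (2 * j + 1) + (l + j + 1).choose (2 * j + 2) := by
    rw [Nat.choose_succ_succ' (l + j + 2), Nat.choose_succ_succ' (l + j + 1) (2 * j),
      Nat.choose_succ_succ' (l + j + 1) (2 * j + 1)]
    ring
  have h2 : ((l + j + 1).choose (2 * j + 1) : ℝ) * (2 * j + 1)
      = (l + j + 1).choose (2 * j) * ((l + j + 1) - 2 * j) := by
    have := Nat.choose_succ_right_eq (l + j + 1) (2 * j)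
    rcases le_or_gt (2 * j) (l + j + 1) with h | h
    · have h' : (((l + j + 1 - 2 * j : ℕ)) : ℝ) = (l + j + 1) - 2 * j := by
        rw [Nat.cast_sub h]; push_cast; ring
      rw [← h']
      exact_mod_cast this
    · simp [Nat.choose_eq_zero_of_lt h, Nat.choose_eq_zero_of_lt (h.trans (Nat.lt_succ_self _))]
  rw [h1]
  push_cast
  linear_combination 2 * h2

/-- The coefficients of Hankel's finite series. -/
def hankelCoeff (l m : ℕ) : ℝ := (2 * m).factorial / m.factorial * (l + m).choose (2 * m)

/-- The gain of the binomial form: with truncated subtraction the quotient of factorials would not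
vanish beyond l, and sums of different lengths could not be compared. -/
lemma hankelCoeff_eq_zero {l m : ℕ} (h : l < m) : hankelCoeff l m = 0 := by
  rw [hankelCoeff, Nat.choose_eq_zero_of_lt (by omega)]; simp

lemma hankelCoeff_eq {l m : ℕ} (h : m ≤ l) :
    hankelCoeff l m = (l + m).factorial / (m.factorial * (l - m).factorial) := by
  have := Nat.choose_mul_factorial_mul_factorial (n := l + m) (k := 2 * m) (by omega)
  rw [show l + m - 2 * m = l - m by omega] at this
  rw [hankelCoeff, ← this]
  have h1 : (m.factorial : ℝ) ≠ 0 := by positivity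
  have h2 : ((l - m).factorial : ℝ) ≠ 0 := by positivity
  push_cast
  field_simp

lemma hankelCoeff_zero (l : ℕ) : hankelCoeff l 0 = 1 := by simp [hankelCoeff]

lemma hankelCoeff_succ (l j : ℕ) :
    hankelCoeff (l + 2) (j + 1)
        = hankelCoeff l (j + 1) + 2 * (2 * l + 3) * hankelCoeff (l + 1) j := by
  have h := choose_add_two_identity l j
  simp only [hankelCoeff]
  have e1 : l + 2 + (j + 1) = l + j + 3 := by ring
  have e2 : l + (j + 1) = l + j + 1 := by ring
  have e3 : l + 1 + j = l + j + 1 := by ring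
  have e4 : ((2 * (j + 1)).factorial : ℝ) / (j + 1).factorial
      = 2 * (2 * j + 1) * ((2 * j).factorial / j.factorial) := by
    rw [show 2 * (j + 1) = 2 * j + 1 + 1 by ring, Nat.factorial_succ, Nat.factorial_succ,
      Nat.factorial_succ j]
    have : (j.factorial : ℝ) ≠ 0 := by positivity
    have : (j + 1 : ℝ) ≠ 0 := by positivity
    push_cast
    field_simp
    ring
  rw [e1, e2, e3, e4, show 2 * (j + 1) = 2 * j + 2 by ring]
  linear_combination 2 * ((2 * j).factorial / j.factorial : ℝ) * h

/-- `A_l(t) = ∑_m (l+m)! / (m! (l-m)!) t^m`. -/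
def hankelSum (l : ℕ) (t : ℂ) : ℂ := ∑ m ∈ Finset.range (l + 1), (hankelCoeff l m : ℂ) * t ^ m

lemma sum_range_eq_of_le {M : Type*} [AddCommMonoid M] {f : ℕ → M} {a b : ℕ} (hab : a ≤ b)
    (hf : ∀ m, a ≤ m → f m = 0) : ∑ m ∈ Finset.range a, f m = ∑ m ∈ Finset.range b, f m :=
  Finset.sum_subset (Finset.range_mono hab) fun m _ hm => hf m (by simpa using hm)

lemma hankelSum_eq (l N : ℕ) (h : l + 1 ≤ N) (t : ℂ) :
    hankelSum l t = ∑ m ∈ Finset.range N, (hankelCoeff l m : ℂ) * t ^ m :=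
  sum_range_eq_of_le h fun m hm => by rw [hankelCoeff_eq_zero (by omega)]; simp

/-- The Bessel recurrence f_{l+2} = (2l+3)/y · f_{l+1} − f_l, stripped of exponentials and powers of
−i. -/
lemma hankelSum_succ_succ (l : ℕ) (t : ℂ) :
    hankelSum (l + 2) t = hankelSum l t + 2 * (2 * l + 3) * t * hankelSum (l + 1) t := by
  rw [hankelSum_eq l (l + 3) (by omega), hankelSum_eq (l + 1) (l + 2) (by omega),
    hankelSum_eq (l + 2) (l + 3) (by omega), Finset.sum_range_succ',
        Finset.sum_range_succ' _ (l + 2)]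
  rw [Finset.mul_sum]
  rw [add_right_comm, ← Finset.sum_add_distrib]
  congr 1
  · refine Finset.sum_congr rfl fun m _ => ?_
    rw [hankelCoeff_succ]
    push_cast
    ring
  · rw [hankelCoeff_zero, hankelCoeff_zero]

/-- The Riccati-Hankel function `y h_l^{(1)}(y)`. -/
def riccatiH (l : ℕ) (y : ℝ) : ℂ := y * sphHankel1 l y

lemma riccatiH_eq (l : ℕ) {y : ℝ} (hy : y ≠ 0) :
    riccatiH l y = (-Complex.I) ^ (l + 1) * Complex.exp (Complex.I * y)
      * hankelSum l (Complex.I / (2 * y)) := by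
  have hy' : (y : ℂ) ≠ 0 := by exact_mod_cast hy
  rw [riccatiH, sphHankel1, hankelSum]
  rw [Finset.sum_congr rfl (g := fun m => (hankelCoeff l m : ℂ) * (Complex.I / (2 * y)) ^ m)]
  · field_simp
  · intro m hm
    rw [hankelCoeff_eq (by simpa [Nat.lt_succ_iff] using hm)]
    push_cast
    rfl

lemma riccatiH_zero {y : ℝ} (hy : y ≠ 0) :
    riccatiH 0 y = -Complex.I * Complex.exp (Complex.I * y) := by
  rw [riccatiH_eq 0 hy]
  simp [hankelSum, hankelCoeff]

lemma riccatiH_one {y : ℝ} (hy : y ≠ 0) :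
    riccatiH 1 y = -Complex.exp (Complex.I * y) * (1 + Complex.I / y) := by
  have hy' : (y : ℂ) ≠ 0 := by exact_mod_cast hy
  rw [riccatiH_eq 1 hy]
  simp [hankelSum, hankelCoeff, Finset.sum_range_succ]
  field_simp

lemma riccatiH_succ_succ (l : ℕ) {y : ℝ} (hy : y ≠ 0) :
    riccatiH (l + 2) y = (2 * l + 3) / y * riccatiH (l + 1) y - riccatiH l y := by
  have hy' : (y : ℂ) ≠ 0 := by exact_mod_cast hy
  rw [riccatiH_eq _ hy, riccatiH_eq _ hy, riccatiH_eq _ hy, hankelSum_succ_succ]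
  have hI : Complex.I ^ 2 = -1 := Complex.I_sq
  have e : (-Complex.I) ^ (l + 2 + 1) = (-Complex.I) ^ (l + 1) * (-1) := by
    rw [show l + 2 + 1 = l + 1 + 2 by ring, pow_add, neg_sq, hI]
  have e' : (-Complex.I) ^ (l + 1 + 1) = (-Complex.I) ^ (l + 1) * (-Complex.I) := pow_succ _ _
  rw [e, e']
  field_simp
  ring

/-! ### The modulus of the Riccati-Hankel function -/

/-- The coefficients of `|y h_l(y)|²` as a polynomial in `y⁻²`. -/
def modulusCoeff (l s : ℕ) : ℝ :=
  ((2 * s).factorial / (2 ^ s * s.factorial)) ^ 2 * (l + s).choose (2 * s)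

lemma modulusCoeff_nonneg (l s : ℕ) : 0 ≤ modulusCoeff l s := by unfold modulusCoeff; positivity

lemma modulusCoeff_zero (l : ℕ) : modulusCoeff l 0 = 1 := by simp [modulusCoeff]

lemma modulusCoeff_eq_zero {l s : ℕ} (h : l < s) : modulusCoeff l s = 0 := by
  rw [modulusCoeff, Nat.choose_eq_zero_of_lt (by omega)]; simp

lemma modulusCoeff_succ_left (l s : ℕ) :
    (l + 1 + s) * modulusCoeff l s = (l + 1 - s) * modulusCoeff (l + 1) s := by
  have h : ((l + s).choose (2 * s) : ℝ) * (l + s + 1)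
      = (l + s + 1).choose (2 * s) * (l + 1 - s) := by
    have := Nat.choose_mul_succ_eq (l + s) (2 * s)
    rcases le_or_gt (2 * s) (l + s + 1) with h | h
    · have h' : (((l + s + 1 - 2 * s : ℕ)) : ℝ) = l + 1 - s := by
        rw [Nat.cast_sub h]; push_cast; ring
      rw [← h']
      exact_mod_cast this
    · simp [Nat.choose_eq_zero_of_lt h, Nat.choose_eq_zero_of_lt (show l + s < 2 * s by omega)]
  rw [modulusCoeff, modulusCoeff, show l + 1 + s = l + s + 1 by ring]
  linear_combination ((2 * s).factorial / (2 ^ s * s.factorial) : ℝ) ^ 2 * h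

lemma modulusCoeff_succ_succ (l s : ℕ) :
    modulusCoeff (l + 2) (s + 1)
      = modulusCoeff l (s + 1) + (2 * l + 3) * (2 * s + 1) * modulusCoeff (l + 1) s := by
  have h := choose_add_two_identity l s
  simp only [modulusCoeff]
  have e4 : ((2 * (s + 1)).factorial : ℝ) / (2 ^ (s + 1) * (s + 1).factorial)
      = (2 * s + 1) * ((2 * s).factorial / (2 ^ s * s.factorial)) := by
    rw [show 2 * (s + 1) = 2 * s + 1 + 1 by ring, Nat.factorial_succ, Nat.factorial_succ,
      Nat.factorial_succ s]
    have : (s.factorial : ℝ) ≠ 0 := by positivity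
    have : (s + 1 : ℝ) ≠ 0 := by positivity
    push_cast
    field_simp
    ring
  rw [e4, show l + 2 + (s + 1) = l + s + 3 by ring, show l + (s + 1) = l + s + 1 by ring,
    show l + 1 + s = l + s + 1 by ring, show 2 * (s + 1) = 2 * s + 2 by ring]
  linear_combination (2 * s + 1) * ((2 * s).factorial / (2 ^ s * s.factorial) : ℝ) ^ 2 * h

/-- `∑_s c_{l,s} y^{-2s}`. -/
def modulusSum (l : ℕ) (y : ℝ) : ℝ := ∑ s ∈ Finset.range (l + 1), modulusCoeff l s * (y⁻¹ ^ 2) ^ s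

/-- `∑_s (l+1+s) c_{l,s} y^{-2s-1}`. -/
def crossSum (l : ℕ) (y : ℝ) : ℝ :=
  ∑ s ∈ Finset.range (l + 1), (l + 1 + s) * modulusCoeff l s * (y⁻¹ ^ 2) ^ s * y⁻¹

lemma modulusSum_eq (l N : ℕ) (h : l + 1 ≤ N) (y : ℝ) :
    modulusSum l y = ∑ s ∈ Finset.range N, modulusCoeff l s * (y⁻¹ ^ 2) ^ s :=
  sum_range_eq_of_le h fun m hm => by rw [modulusCoeff_eq_zero (by omega)]; simp

lemma crossSum_eq (l N : ℕ) (h : l + 1 ≤ N) (y : ℝ) :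
    crossSum l y = ∑ s ∈ Finset.range N, (l + 1 + s) * modulusCoeff l s * (y⁻¹ ^ 2) ^ s * y⁻¹ :=
  sum_range_eq_of_le h fun m hm => by rw [modulusCoeff_eq_zero (by omega)]; simp

lemma crossSum_succ (l : ℕ) (y : ℝ) :
    crossSum (l + 1) y = (2 * l + 3) * y⁻¹ * modulusSum (l + 1) y - crossSum l y := by
  rw [crossSum_eq (l + 1) (l + 2) (by omega), crossSum_eq l (l + 2) (by omega),
    modulusSum_eq (l + 1) (l + 2) (by omega), Finset.mul_sum, ← Finset.sum_sub_distrib]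
  refine Finset.sum_congr rfl fun s _ => ?_
  have := modulusCoeff_succ_left l s
  push_cast
  linear_combination ((y⁻¹ ^ 2) ^ s * y⁻¹) * this

lemma modulusSum_succ_succ (l : ℕ) (y : ℝ) :
    modulusSum (l + 2) y = ((2 * l + 3) * y⁻¹) ^ 2 * modulusSum (l + 1) y
      - 2 * ((2 * l + 3) * y⁻¹) * crossSum l y + modulusSum l y := by
  rw [crossSum_eq l (l + 2) (by omega), modulusSum_eq (l + 1) (l + 2) (by omega),
    modulusSum_eq (l + 2) (l + 3) (by omega), modulusSum_eq l (l + 3) (by omega),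
    Finset.sum_range_succ', Finset.sum_range_succ' _ (l + 2), Finset.mul_sum, Finset.mul_sum,
    ← Finset.sum_sub_distrib, ← add_assoc, ← Finset.sum_add_distrib]
  congr 1
  · refine Finset.sum_congr rfl fun s _ => ?_
    have h1 := modulusCoeff_succ_left l s
    have h2 := modulusCoeff_succ_succ l s
    linear_combination ((y⁻¹ ^ 2) ^ (s + 1)) * h2 + 2 * (2 * l + 3) * ((y⁻¹ ^ 2) ^ (s + 1)) * h1
  · rw [modulusCoeff_zero, modulusCoeff_zero]

/-- The recurrence expresses |H_{l+2}|² through |H_{l+1}|², |H_l|² and the real part of the cross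
term, so the three formulas must go through one induction. -/
lemma normSq_riccatiH_aux (l : ℕ) {y : ℝ} (hy : y ≠ 0) :
    Complex.normSq (riccatiH l y) = modulusSum l y ∧
    Complex.normSq (riccatiH (l + 1) y) = modulusSum (l + 1) y ∧
    ((starRingEnd ℂ) (riccatiH l y) * riccatiH (l + 1) y).re = crossSum l y := by
  have hE : Complex.normSq (Complex.exp (Complex.I * y)) = 1 := by
    rw [mul_comm, Complex.normSq_eq_norm_sq, Complex.norm_exp_ofReal_mul_I]; simp
  induction l with
  | zero =>
    refine ⟨?_, ?_, ?_⟩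
    · rw [riccatiH_zero hy, map_mul, hE]
      simp [modulusSum, modulusCoeff]
    · rw [zero_add, riccatiH_one hy, map_mul, Complex.normSq_neg, hE, one_mul]
      simp [modulusSum, modulusCoeff, Finset.sum_range_succ, Complex.normSq_apply]
      ring
    · rw [zero_add, riccatiH_one hy, riccatiH_zero hy]
      have : (starRingEnd ℂ) (-Complex.I * Complex.exp (Complex.I * y))
          * (-Complex.exp (Complex.I * y) * (1 + Complex.I / y))
          = -Complex.I * (1 + Complex.I / y)
              * (Complex.normSq (Complex.exp (Complex.I * y)) : ℂ) := by
        rw [Complex.normSq_eq_conj_mul_self, map_mul, map_neg, Complex.conj_I]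
        ring
      rw [this, hE]
      simp [crossSum, modulusCoeff]
  | succ l ih =>
    obtain ⟨h1, h2, h3⟩ := ih
    have e : riccatiH (l + 1 + 1) y
        = ((((2 * l + 3) * y⁻¹ : ℝ)) : ℂ) * riccatiH (l + 1) y - riccatiH l y := by
      rw [riccatiH_succ_succ l hy]; push_cast; ring
    refine ⟨h2, ?_, ?_⟩
    · rw [e, Complex.normSq_sub, map_mul, Complex.normSq_ofReal, h1, h2, modulusSum_succ_succ, ← h3,
        mul_assoc (((2 * l + 3) * y⁻¹ : ℝ) : ℂ), Complex.re_ofReal_mul,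
        mul_comm (riccatiH (l + 1) y)]
      ring
    · rw [e, crossSum_succ, ← h2, ← h3, mul_sub, Complex.sub_re, mul_left_comm,
        Complex.re_ofReal_mul, ← Complex.normSq_eq_conj_mul_self, Complex.ofReal_re]
      congr 1
      simp only [Complex.mul_re, Complex.conj_re, Complex.conj_im]
      ring

lemma normSq_riccatiH (l : ℕ) {y : ℝ} (hy : y ≠ 0) :
    Complex.normSq (riccatiH l y) = modulusSum l y := (normSq_riccatiH_aux l hy).1

/-- `y |h_l(y)|` is decreasing on the half line. -/
lemma norm_riccatiH_antitone (l : ℕ) {x y : ℝ} (hx : 0 < x) (hxy : x ≤ y) :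
    ‖riccatiH l y‖ ≤ ‖riccatiH l x‖ := by
  have hy : 0 < y := hx.trans_le hxy
  -- |H_l|² is a polynomial in y⁻² with nonnegative coefficients, so it decreases term by term.
  rw [← abs_norm, ← abs_norm (riccatiH l x), ← sq_le_sq, ← Complex.normSq_eq_norm_sq,
    ← Complex.normSq_eq_norm_sq, normSq_riccatiH l hx.ne', normSq_riccatiH l hy.ne']
  refine Finset.sum_le_sum fun s _ => mul_le_mul_of_nonneg_left ?_ (modulusCoeff_nonneg l s)
  gcongr

lemma one_le_norm_riccatiH (l : ℕ) {y : ℝ} (hy : 0 < y) : 1 ≤ ‖riccatiH l y‖ := by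
  have : 1 ≤ ‖riccatiH l y‖ ^ 2 := by
    rw [← Complex.normSq_eq_norm_sq, normSq_riccatiH l hy.ne', modulusSum]
    refine le_trans (le_of_eq ?_) (Finset.single_le_sum
      (f := fun s => modulusCoeff l s * (y⁻¹ ^ 2) ^ s)
      (fun s _ => mul_nonneg (modulusCoeff_nonneg l s) (by positivity))
      (Finset.mem_range.mpr (Nat.succ_pos l)))
    simp [modulusCoeff_zero]
  exact (one_le_sq_iff₀ (norm_nonneg _)).mp this

/-- Two consecutive orders are carried along because the step to l + 2 differentiates the three-term
recurrence. -/
lemma hasDerivAt_riccatiH_aux (l : ℕ) : ∀ {y : ℝ}, y ≠ 0 →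
    HasDerivAt (riccatiH l) ((l + 1) / y * riccatiH l y - riccatiH (l + 1) y) y ∧
    HasDerivAt (riccatiH (l + 1)) ((l + 2) / y * riccatiH (l + 1) y - riccatiH (l + 2) y) y := by
  induction l with
  | zero =>
    intro y hy
    have hy' : (y : ℂ) ≠ 0 := by exact_mod_cast hy
    have hev : ∀ᶠ x : ℝ in 𝓝 y, x ≠ 0 := isOpen_ne.mem_nhds hy
    have hE : HasDerivAt (fun x : ℝ => Complex.exp (Complex.I * x))
        (Complex.exp (Complex.I * y) * (Complex.I * 1)) y :=
      (((hasDerivAt_id y).ofReal_comp).const_mul Complex.I).cexp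
    have hI : Complex.I ^ 2 = -1 := Complex.I_sq
    constructor
    · have h : HasDerivAt (riccatiH 0) (-Complex.I
        * (Complex.exp (Complex.I * y) * (Complex.I * 1))) y :=
        (hE.const_mul (-Complex.I)).congr_of_eventuallyEq (by
          filter_upwards [hev] with x hx using riccatiH_zero hx)
      refine h.congr_deriv ?_
      rw [riccatiH_zero hy, zero_add, riccatiH_one hy]
      push_cast
      field_simp
      linear_combination (-(y : ℂ)) * hI
    · have hinv : HasDerivAt (fun x : ℝ => 1 + Complex.I / (x : ℂ)) (-Complex.I / (y : ℂ) ^ 2) y := by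
        have h1 : HasDerivAt (fun x : ℝ => (x : ℂ)) 1 y := (hasDerivAt_id y).ofReal_comp
        refine ((((hasDerivAt_const y Complex.I).div h1 hy')).const_add 1).congr_deriv ?_
        simp
      have h : HasDerivAt (riccatiH 1) _ y :=
        (hE.neg.mul hinv).congr_of_eventuallyEq (by
          filter_upwards [hev] with x hx
          rw [riccatiH_one hx]; rfl)
      refine h.congr_deriv ?_
      rw [riccatiH_succ_succ 0 hy, zero_add, riccatiH_one hy, riccatiH_zero hy]
      simp only [Pi.neg_apply]
      push_cast
      field_simp
      linear_combination (-(y : ℂ)) * hI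
  | succ l ih =>
    intro y hy
    refine ⟨?_, ?_⟩
    · refine ((ih hy).2).congr_deriv ?_
      push_cast; ring
    · have hy' : (y : ℂ) ≠ 0 := by exact_mod_cast hy
      have hev : ∀ᶠ x : ℝ in 𝓝 y, x ≠ 0 := isOpen_ne.mem_nhds hy
      obtain ⟨h0, h1⟩ := ih hy
      have hq : HasDerivAt (fun x : ℝ => (2 * l + 3 : ℂ) / (x : ℂ)) (-(2
          * l + 3) / (y : ℂ) ^ 2) y := by
        have h1 : HasDerivAt (fun x : ℝ => (x : ℂ)) 1 y := (hasDerivAt_id y).ofReal_comp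
        refine ((hasDerivAt_const y (2 * l + 3 : ℂ)).div h1 hy').congr_deriv ?_
        simp
      have h : HasDerivAt (riccatiH (l + 1 + 1)) _ y :=
        ((hq.mul h1).sub h0).congr_of_eventuallyEq (by
          filter_upwards [hev] with x hx
          exact riccatiH_succ_succ l hx)
      refine h.congr_deriv ?_
      rw [riccatiH_succ_succ (l + 1) hy, riccatiH_succ_succ l hy]
      push_cast
      field_simp
      ring

lemma hasDerivAt_riccatiH (l : ℕ) {y : ℝ} (hy : y ≠ 0) :
    HasDerivAt (riccatiH l) ((l + 1) / y * riccatiH l y - riccatiH (l + 1) y) y :=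
  (hasDerivAt_riccatiH_aux l hy).1

/-! #### The power series of `j_l` -/

/-- The terms of the power series of `j_l`. -/
def besselTerm (l : ℕ) (x : ℝ) (m : ℕ) : ℝ :=
  (-1 : ℝ) ^ m * x ^ (2 * m + l) /
    (2 ^ m * (m.factorial : ℝ) * (Nat.doubleFactorial (2 * m + 2 * l + 1) : ℝ))

lemma norm_besselTerm_le (l : ℕ) (x : ℝ) (m : ℕ) :
    ‖besselTerm l x m‖ ≤ |x| ^ l * ((x ^ 2) ^ m / m.factorial) := by
  have h1 : (1 : ℝ) ≤ 2 ^ m := one_le_pow₀ (by norm_num)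
  have h2 : (1 : ℝ) ≤ (Nat.doubleFactorial (2 * m + 2 * l + 1) : ℝ) := by
    exact_mod_cast Nat.doubleFactorial_pos _
  have h3 : (0 : ℝ) < m.factorial := by positivity
  rw [besselTerm, norm_div, norm_mul, norm_pow, norm_neg, norm_one, one_pow, one_mul, norm_pow,
    Real.norm_eq_abs x, Real.norm_of_nonneg (by positivity), pow_add, pow_mul, sq_abs, mul_comm,
    mul_div_assoc]
  refine mul_le_mul_of_nonneg_left ?_ (by positivity)
  refine div_le_div_of_nonneg_left (by positivity) h3 ?_
  calc (m.factorial : ℝ) = 1 * m.factorial * 1 := by ring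
    _ ≤ _ := by gcongr

lemma summable_besselTerm_norm (l : ℕ) (x : ℝ) : Summable fun m => ‖besselTerm l x m‖ :=
  Summable.of_nonneg_of_le (fun _ => norm_nonneg _) (norm_besselTerm_le l x)
    ((Real.summable_pow_div_factorial (x ^ 2)).mul_left _)

lemma summable_besselTerm (l : ℕ) (x : ℝ) : Summable (besselTerm l x) :=
  (summable_besselTerm_norm l x).of_norm

lemma hasSum_besselTerm (l : ℕ) (x : ℝ) : HasSum (besselTerm l x) (sphBesselJ l x) :=
  (summable_besselTerm l x).hasSum

lemma abs_sphBesselJ_le_exp (l : ℕ) (x : ℝ) : |sphBesselJ l x| ≤ |x| ^ l * Real.exp (x ^ 2) := by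
  refine tsum_of_norm_bounded (f := besselTerm l x) ?_ (norm_besselTerm_le l x)
  have := (NormedSpace.expSeries_div_hasSum_exp (x ^ 2)).mul_left (|x| ^ l)
  rwa [← Real.exp_eq_exp_ℝ] at this

/-- The recurrence holds coefficientwise with a shift of the index by one; the unmatched lowest term
cancels by `besselTerm_rec_zero`. -/
lemma besselTerm_rec (l : ℕ) {x : ℝ} (hx : x ≠ 0) (m : ℕ) :
    (2 * l + 3) / x * besselTerm (l + 1) x (m + 1) - besselTerm l x (m + 1)
      = besselTerm (l + 2) x m := by
  simp only [besselTerm]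
  rw [show 2 * (m + 1) + 2 * (l + 1) + 1 = 2 * m + 2 * (l + 2) + 1 by ring,
    show 2 * (m + 1) + 2 * l + 1 = 2 * m + 2 * l + 3 by ring]
  have hd : (Nat.doubleFactorial (2 * m + 2 * (l + 2) + 1) : ℝ)
      = (2 * m + 2 * l + 5) * Nat.doubleFactorial (2 * m + 2 * l + 3) := by
    rw [show 2 * m + 2 * (l + 2) + 1 = 2 * m + 2 * l + 3 + 2 by ring, Nat.doubleFactorial_add_two]
    push_cast; ring
  rw [hd, Nat.factorial_succ]
  have h2 : (Nat.doubleFactorial (2 * m + 2 * l + 3) : ℝ) ≠ 0 := by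
    exact_mod_cast (Nat.doubleFactorial_pos _).ne'
  have h3 : (m.factorial : ℝ) ≠ 0 := by positivity
  have h4 : (2 * m + 2 * l + 5 : ℝ) ≠ 0 := by positivity
  have h5 : (m + 1 : ℝ) ≠ 0 := by positivity
  push_cast
  field_simp
  ring

lemma besselTerm_rec_zero (l : ℕ) {x : ℝ} (hx : x ≠ 0) :
    (2 * l + 3) / x * besselTerm (l + 1) x 0 - besselTerm l x 0 = 0 := by
  simp only [besselTerm]
  have hd : (Nat.doubleFactorial (2 * 0 + 2 * (l + 1) + 1) : ℝ)
      = (2 * l + 3) * Nat.doubleFactorial (2 * 0 + 2 * l + 1) := by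
    rw [show 2 * 0 + 2 * (l + 1) + 1 = 2 * 0 + 2 * l + 1 + 2 by ring, Nat.doubleFactorial_add_two]
    push_cast; ring
  rw [hd]
  have h2 : (Nat.doubleFactorial (2 * 0 + 2 * l + 1) : ℝ) ≠ 0 := by
    exact_mod_cast (Nat.doubleFactorial_pos _).ne'
  have h4 : (2 * l + 3 : ℝ) ≠ 0 := by positivity
  field_simp
  ring

lemma sphBesselJ_succ_succ (l : ℕ) {x : ℝ} (hx : x ≠ 0) :
    sphBesselJ (l + 2) x = (2 * l + 3) / x * sphBesselJ (l + 1) x - sphBesselJ l x := by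
  have h := ((hasSum_besselTerm (l + 1) x).mul_left ((2 * l + 3) / x)).sub (hasSum_besselTerm l x)
  have h' := (hasSum_nat_add_iff' 1).mpr h
  simp only [Finset.sum_range_one, besselTerm_rec_zero l hx, sub_zero, besselTerm_rec l hx] at h'
  exact (hasSum_besselTerm (l + 2) x).unique h'

lemma doubleFactorial_two_mul_add_one (m : ℕ) :
    ((2 * m + 1).factorial : ℝ) = 2 ^ m * m.factorial * Nat.doubleFactorial (2 * m + 1) := by
  have := Nat.factorial_eq_mul_doubleFactorial (2 * m)
  rw [Nat.doubleFactorial_two_mul] at this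
  rw [this]; push_cast; ring

lemma sphBesselJ_zero {x : ℝ} : x * sphBesselJ 0 x = Real.sin x := by
  refine ((hasSum_besselTerm 0 x).mul_left x).unique ?_
  have e : (fun m => x * besselTerm 0 x m)
      = fun m => (-1) ^ m * x ^ (2 * m + 1) / ((2 * m + 1).factorial : ℝ) := by
    funext m
    simp only [besselTerm, doubleFactorial_two_mul_add_one, mul_zero, add_zero]
    ring
  rw [e]
  exact Real.hasSum_sin x

lemma sphBesselJ_one {x : ℝ} (hx : x ≠ 0) :
    sphBesselJ 1 x = (sphBesselJ 0 x - Real.cos x) / x := by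
  have h := ((hasSum_besselTerm 0 x).sub (Real.hasSum_cos x)).div_const x
  have h' := (hasSum_nat_add_iff' 1).mpr h
  have e : besselTerm 1 x = fun m => (besselTerm 0 x (m + 1)
      - (-1) ^ (m + 1) * x ^ (2 * (m + 1)) / ((2 * (m + 1)).factorial : ℝ)) / x := by
    funext m
    have e : ((2 * (m + 1)).factorial : ℝ)
        = 2 * (m + 1) * (2 ^ m * m.factorial * Nat.doubleFactorial (2 * m + 1)) := by
      rw [show 2 * (m + 1) = 2 * m + 1 + 1 by ring, Nat.factorial_succ]
      push_cast
      rw [doubleFactorial_two_mul_add_one]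
      ring
    rw [e]
    simp only [besselTerm]
    rw [show 2 * m + 2 * 1 + 1 = 2 * m + 1 + 2 by ring,
      show 2 * (m + 1) + 2 * 0 + 1 = 2 * m + 1 + 2 by ring, Nat.doubleFactorial_add_two,
      Nat.factorial_succ]
    have h2 : (Nat.doubleFactorial (2 * m + 1) : ℝ) ≠ 0 := by
      exact_mod_cast (Nat.doubleFactorial_pos _).ne'
    have h3 : (m.factorial : ℝ) ≠ 0 := by positivity
    have h4 : (2 * m + 1 + 2 : ℝ) ≠ 0 := by positivity
    have h5 : (m + 1 : ℝ) ≠ 0 := by positivity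
    push_cast
    field_simp
    ring
  rw [← e] at h'
  simpa [besselTerm] using (hasSum_besselTerm 1 x).unique h'

/-- The Riccati-Bessel function `x j_l(x)`. -/
def riccatiJ (l : ℕ) (x : ℝ) : ℝ := x * sphBesselJ l x

lemma riccatiJ_succ_succ (l : ℕ) {x : ℝ} (hx : x ≠ 0) :
    riccatiJ (l + 2) x = (2 * l + 3) / x * riccatiJ (l + 1) x - riccatiJ l x := by
  rw [riccatiJ, sphBesselJ_succ_succ l hx, riccatiJ, riccatiJ]; ring

lemma riccatiJ_one {x : ℝ} (hx : x ≠ 0) :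
    riccatiJ 1 x = Real.sin x / x - Real.cos x := by
  rw [riccatiJ, sphBesselJ_one hx, ← sphBesselJ_zero]; field_simp

lemma exp_I_mul_ofReal (y : ℝ) :
    Complex.exp (Complex.I * y) = Real.cos y + Real.sin y * Complex.I := by
  rw [mul_comm, Complex.exp_mul_I]; simp

/-- `Re h_l = j_l`. -/
lemma riccatiH_re (l : ℕ) {x : ℝ} (hx : x ≠ 0) : (riccatiH l x).re = riccatiJ l x := by
  -- Both sides obey the same three-term recurrence with real coefficients, so agreement at l = 0
  -- and l = 1 is enough.
  have aux : (riccatiH l x).re = riccatiJ l x ∧ (riccatiH (l + 1) x).re = riccatiJ (l + 1) x := by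
    induction l with
    | zero =>
      constructor
      · rw [riccatiH_zero hx, riccatiJ, sphBesselJ_zero, exp_I_mul_ofReal]
        simp [-Complex.ofReal_cos, -Complex.ofReal_sin]
      · rw [zero_add, riccatiH_one hx, riccatiJ_one hx, exp_I_mul_ofReal]
        simp [-Complex.ofReal_cos, -Complex.ofReal_sin]
        ring
    | succ l ih =>
      refine ⟨ih.2, ?_⟩
      have e : riccatiH (l + 1 + 1) x
          = ((((2 * l + 3) / x : ℝ)) : ℂ) * riccatiH (l + 1) x - riccatiH l x := by
        rw [riccatiH_succ_succ l hx]; push_cast; ring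
      rw [e, Complex.sub_re, Complex.re_ofReal_mul, ih.1, ih.2, riccatiJ_succ_succ l hx]
  exact aux.1

/-- The recurrence preserves this cross product, and at l = 0 it is sin² + cos² = 1. -/
lemma wronskian_riccati (l : ℕ) {x : ℝ} (hx : x ≠ 0) :
    (riccatiJ l x : ℂ) * riccatiH (l + 1) x - riccatiJ (l + 1) x * riccatiH l x = -Complex.I := by
  induction l with
  | zero =>
    have hx' : (x : ℂ) ≠ 0 := by exact_mod_cast hx
    rw [zero_add, riccatiH_one hx, riccatiH_zero hx, riccatiJ_one hx, riccatiJ, sphBesselJ_zero,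
      exp_I_mul_ofReal]
    have h1 : (Real.sin x : ℂ) ^ 2 + (Real.cos x : ℂ) ^ 2 = 1 := by
      exact_mod_cast Real.sin_sq_add_cos_sq x
    have hI : Complex.I ^ 2 = -1 := Complex.I_sq
    simp only [Complex.ofReal_sub, Complex.ofReal_div]
    field_simp
    linear_combination (-(x : ℂ) * Complex.I) * h1 - x * Real.cos x * Real.sin x * hI
  | succ l ih =>
    rw [riccatiH_succ_succ l hx, riccatiJ_succ_succ l hx, ← ih]
    push_cast
    ring

lemma riccatiH_ne_zero (l : ℕ) {y : ℝ} (hy : 0 < y) : riccatiH l y ≠ 0 := by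
  have := one_le_norm_riccatiH l hy
  intro h
  rw [h, norm_zero] at this
  linarith

lemma hasDerivAt_riccatiJ (l : ℕ) {y : ℝ} (hy : y ≠ 0) :
    HasDerivAt (riccatiJ l) ((l + 1) / y * riccatiJ l y - riccatiJ (l + 1) y) y := by
  have h := Complex.reCLM.hasFDerivAt.comp_hasDerivAt y (hasDerivAt_riccatiH l hy)
  refine (h.congr_of_eventuallyEq ?_).congr_deriv ?_
  · filter_upwards [isOpen_ne.mem_nhds hy] with x hx using (riccatiH_re l hx).symm
  · have : ((l : ℂ) + 1) / y = (((l + 1) / y : ℝ) : ℂ) := by push_cast; ring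
    rw [this]
    simp only [Complex.reCLM_apply, Complex.sub_re, Complex.re_ofReal_mul, riccatiH_re _ hy]

/-- The numerator is the constant Wronskian, so the size of the derivative is 1/|H_l|², an
increasing function. -/
lemma hasDerivAt_riccatiJ_div_riccatiH (l : ℕ) {y : ℝ} (hy : 0 < y) :
    HasDerivAt (fun x => (riccatiJ l x : ℂ) / riccatiH l x) (-Complex.I / riccatiH l y ^ 2) y := by
  have hH := riccatiH_ne_zero l hy
  refine ((hasDerivAt_riccatiJ l hy.ne').ofReal_comp.div (hasDerivAt_riccatiH l hy.ne') hH).congr_deriv ?_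
  rw [← wronskian_riccati l hy.ne']
  push_cast
  ring

lemma tendsto_riccatiJ_zero (l : ℕ) : Tendsto (riccatiJ l) (𝓝[>] 0) (𝓝 0) := by
  have h : Tendsto (fun x : ℝ => |x| * (|x| ^ l * Real.exp (x ^ 2))) (𝓝[>] 0) (𝓝 0) := by
    have : Continuous fun x : ℝ => |x| * (|x| ^ l * Real.exp (x ^ 2)) := by fun_prop
    have h := this.tendsto 0
    simp only [abs_zero, zero_mul] at h
    exact h.mono_left nhdsWithin_le_nhds
  refine squeeze_zero_norm (fun x => ?_) h
  rw [riccatiJ, norm_mul, Real.norm_eq_abs, Real.norm_eq_abs]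
  exact mul_le_mul_of_nonneg_left (abs_sphBesselJ_le_exp l x) (abs_nonneg _)

/-- `|x j_l(x)| |x h_l(x)| ≤ x`. -/
lemma abs_riccatiJ_mul_norm_riccatiH_le (l : ℕ) {x : ℝ} (hx : 0 < x) :
    |riccatiJ l x| * ‖riccatiH l x‖ ≤ x := by
  set f : ℝ → ℂ := fun x => (riccatiJ l x : ℂ) / riccatiH l x with hf
  have hHx : 0 < ‖riccatiH l x‖ := norm_pos_iff.mpr (riccatiH_ne_zero l hx)
  -- On [a, x] the derivative of J/H is at most 1/|H(x)|². As a → 0 the quotient J/H tends to 0,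
  -- which leaves |J/H|(x) ≤ x/|H(x)|²; multiplying by |H(x)|² gives the claim.
  have hstep : ∀ a ∈ Ioo 0 x, ‖f x - f a‖ ≤ (1 / ‖riccatiH l x‖ ^ 2) * x := by
    intro a ha
    have := Convex.norm_image_sub_le_of_norm_hasDerivWithin_le (f := f)
      (f' := fun y => -Complex.I / riccatiH l y ^ 2) (s := Icc a x) (x := a) (y := x)
      (C := 1 / ‖riccatiH l x‖ ^ 2)
      (fun y hy => (hasDerivAt_riccatiJ_div_riccatiH l (ha.1.trans_le hy.1)).hasDerivWithinAt)
      (fun y hy => by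
        rw [norm_div, norm_neg, Complex.norm_I, norm_pow]
        have := norm_riccatiH_antitone l (ha.1.trans_le hy.1) hy.2
        gcongr)
      (convex_Icc a x) (left_mem_Icc.mpr ha.2.le) (right_mem_Icc.mpr ha.2.le)
    refine this.trans (mul_le_mul_of_nonneg_left ?_ (by positivity))
    rw [Real.norm_of_nonneg (by linarith [ha.2])]
    linarith [ha.1]
  have hlim : Tendsto (fun a => ‖f x - f a‖) (𝓝[>] 0) (𝓝 ‖f x - 0‖) := by
    refine (tendsto_const_nhds.sub ?_).norm
    have h1 := (tendsto_riccatiJ_zero l).abs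
    rw [abs_zero] at h1
    refine squeeze_zero_norm' ?_ h1
    filter_upwards [self_mem_nhdsWithin] with a ha
    rw [hf, norm_div, Complex.norm_real, Real.norm_eq_abs]
    exact div_le_self (abs_nonneg _) (one_le_norm_riccatiH l ha)
  have h := le_of_tendsto hlim (by
    filter_upwards [Ioo_mem_nhdsGT hx] with a ha using hstep a ha)
  rw [sub_zero, hf, norm_div, Complex.norm_real, Real.norm_eq_abs, div_le_iff₀ hHx] at h
  calc |riccatiJ l x| * ‖riccatiH l x‖
      ≤ (1 / ‖riccatiH l x‖ ^ 2 * x * ‖riccatiH l x‖) * ‖riccatiH l x‖ := by gcongr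
    _ = x := by field_simp

lemma abs_riccatiJ_mul_norm_riccatiH_le' (l : ℕ) {x y : ℝ} (hx : 0 < x) (hxy : x ≤ y) :
    |riccatiJ l x| * ‖riccatiH l y‖ ≤ x :=
  (mul_le_mul_of_nonneg_left (norm_riccatiH_antitone l hx hxy) (abs_nonneg _)).trans
    (abs_riccatiJ_mul_norm_riccatiH_le l hx)

lemma abs_riccatiJ_le (l : ℕ) {x : ℝ} (hx : 0 < x) : |riccatiJ l x| ≤ x :=
  (le_mul_of_one_le_right (abs_nonneg _) (one_le_norm_riccatiH l hx)).trans
    (abs_riccatiJ_mul_norm_riccatiH_le l hx)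

lemma abs_sphBesselJ_le_one (l : ℕ) {x : ℝ} (hx : 0 < x) : |sphBesselJ l x| ≤ 1 := by
  have := abs_riccatiJ_le l hx
  rw [riccatiJ, abs_mul, abs_of_pos hx] at this
  nlinarith

/-! ### The Green function: uniform bound and imaginary part -/

lemma green_eq (l : ℕ) {k R R' : ℝ} (hk : 0 < k) :
    green l k R R'
      = -Complex.I / k * riccatiJ l (k * min R R') * riccatiH l (k * max R R') := by
  have hk' : (k : ℂ) ≠ 0 := by exact_mod_cast hk.ne'
  have hmm : (R : ℂ) * R' = (min R R' : ℝ) * (max R R' : ℝ) := by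
    rw [← Complex.ofReal_mul, ← Complex.ofReal_mul, min_mul_max]
  rw [green, riccatiJ, riccatiH]
  push_cast
  field_simp
  linear_combination -(sphBesselJ l (k * min R R') : ℂ) * sphHankel1 l (k * max R R') * hmm

/-- The Green functions are bounded uniformly in `l` and `k`. -/
lemma norm_green_le (l : ℕ) {k R R' : ℝ} (hk : 0 < k) (hR : 0 < R) (hR' : 0 < R') :
    ‖green l k R R'‖ ≤ min R R' := by
  have hm : 0 < min R R' := lt_min hR hR'
  have h := abs_riccatiJ_mul_norm_riccatiH_le' l (mul_pos hk hm)
    (mul_le_mul_of_nonneg_left (min_le_max (a := R) (b := R')) hk.le)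
  rw [green_eq l hk, norm_mul, norm_mul, norm_div, norm_neg, Complex.norm_I, Complex.norm_real,
    Complex.norm_real, Real.norm_of_nonneg hk.le, Real.norm_eq_abs, mul_assoc]
  calc 1 / k * _ ≤ 1 / k * (k * min R R') := by gcongr
    _ = _ := by field_simp

lemma green_comm (l : ℕ) (k R R' : ℝ) : green l k R R' = green l k R' R := by
  simp only [green, min_comm R, max_comm R]; ring

/-- Since Re h_l = j_l, the imaginary part separates into a product; this makes the
anti-self-adjoint part of the Green operator a rank-one operator. -/
lemma green_im (l : ℕ) {k R R' : ℝ} (hk : 0 < k) (hR : 0 < R) :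
    (green l k R R').im = -(1 / k) * (riccatiJ l (k * R) * riccatiJ l (k * R')) := by
  have hM : k * max R R' ≠ 0 := (mul_pos hk (hR.trans_le (le_max_left _ _))).ne'
  have : green l k R R' = ((1 / k * riccatiJ l (k * min R R') : ℝ) : ℂ)
      * (-Complex.I * riccatiH l (k * max R R')) := by
    rw [green_eq l hk]; push_cast; ring
  rw [this, Complex.im_ofReal_mul, Complex.mul_im]
  simp only [Complex.neg_re, Complex.I_re, Complex.neg_im, Complex.I_im, riccatiH_re l hM]
  rcases le_total R R' with h | h
  · rw [min_eq_left h, max_eq_right h]; ring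
  · rw [min_eq_right h, max_eq_left h]; ring

lemma measurable_sphBesselJ (l : ℕ) : Measurable (sphBesselJ l) := by
  have : ∀ m, Measurable fun x => besselTerm l x m := fun m => by unfold besselTerm; fun_prop
  exact measurable_of_tendsto_metrizable (f := fun N x => ∑ m ∈ Finset.range N, besselTerm l x m)
    (fun N => by fun_prop) (tendsto_pi_nhds.mpr fun x => (hasSum_besselTerm l x).tendsto_sum_nat)

lemma measurable_riccatiJ (l : ℕ) : Measurable (riccatiJ l) :=
  measurable_id.mul (measurable_sphBesselJ l)

lemma measurable_sphHankel1 (l : ℕ) : Measurable (sphHankel1 l) := by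
  unfold sphHankel1; fun_prop

lemma measurable_green (l : ℕ) (k : ℝ) : Measurable fun p : ℝ × ℝ => green l k p.1 p.2 := by
  have h1 := measurable_sphBesselJ l
  have h2 := measurable_sphHankel1 l
  unfold green
  fun_prop

/-! ### The square of a spherical Bessel function -/

lemma descPochhammer_smeval_half (M a : ℕ) (ha : a ≤ M) :
    (descPochhammer ℤ a).smeval (M + 1 / 2 : ℝ) * 2 ^ a
      * Nat.doubleFactorial (2 * (M - a) + 1) = Nat.doubleFactorial (2 * M + 1) := by
  induction a with
  | zero => simp
  | succ a ih =>
    rw [← ih (by omega), descPochhammer_succ_right, Polynomial.smeval_mul, Polynomial.smeval_sub,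
      Polynomial.smeval_X, Polynomial.smeval_natCast, pow_one, pow_zero,
      show 2 * (M - a) + 1 = 2 * (M - (a + 1)) + 1 + 2 by omega, Nat.doubleFactorial_add_two]
    have : ((2 * (M - (a + 1)) + 1 + 2 : ℕ) : ℝ) = 2 * M + 1 - 2 * a := by
      rw [show 2 * (M - (a + 1)) + 1 + 2 = 2 * M + 1 - 2 * a by omega, Nat.cast_sub (by omega)]
      push_cast; ring
    rw [Nat.cast_mul, this]
    simp only [nsmul_eq_mul]
    ring

/-- Half-integer binomials encode quotients of odd double factorials, so the Cauchy square of the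
Bessel series becomes a Vandermonde convolution. -/
lemma ringChoose_half (M a : ℕ) (ha : a ≤ M) :
    Ring.choose (M + 1 / 2 : ℝ) a = Nat.doubleFactorial (2 * M + 1)
      / (2 ^ a * a.factorial * Nat.doubleFactorial (2 * (M - a) + 1)) := by
  have h := descPochhammer_smeval_half M a ha
  have h1 : (Nat.doubleFactorial (2 * (M - a) + 1) : ℝ) ≠ 0 := by
    exact_mod_cast (Nat.doubleFactorial_pos _).ne'
  have h2 : (a.factorial : ℝ) ≠ 0 := by positivity
  rw [Ring.choose_eq_smul, ← h, smul_eq_mul]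
  field_simp

/-- Chu-Vandermonde with both upper arguments equal to N + l + 1/2, whose sum is the integer 2(N +
l) + 1. -/
lemma sum_antidiagonal_doubleFactorial (l N : ℕ) :
    ∑ p ∈ Finset.HasAntidiagonal.antidiagonal N, (1 : ℝ) / (p.1.factorial * p.2.factorial
        * Nat.doubleFactorial (2 * p.1 + 2 * l + 1) * Nat.doubleFactorial (2 * p.2 + 2 * l + 1))
      = 2 ^ N * (2 * (N + l) + 1).choose N / (Nat.doubleFactorial (2 * (N + l) + 1) : ℝ) ^ 2 := by
  have hD : (Nat.doubleFactorial (2 * (N + l) + 1) : ℝ) ≠ 0 := by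
    exact_mod_cast (Nat.doubleFactorial_pos _).ne'
  have hv := Ring.add_choose_eq N (Commute.all ((N + l : ℕ) + 1 / 2 : ℝ) ((N + l : ℕ) + 1 / 2))
  rw [show ((N + l : ℕ) + 1 / 2 + ((N + l : ℕ) + 1 / 2) : ℝ) = ((2 * (N + l) + 1 : ℕ) : ℝ) by
    push_cast; ring, Ring.choose_natCast] at hv
  rw [hv, Finset.mul_sum, Finset.sum_div]
  refine Finset.sum_congr rfl fun p hp => ?_
  have hp' : p.1 + p.2 = N := Finset.HasAntidiagonal.mem_antidiagonal.mp hp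
  rw [ringChoose_half _ _ (by omega), ringChoose_half _ _ (by omega),
    show 2 * (N + l - p.1) + 1 = 2 * p.2 + 2 * l + 1 by omega,
    show 2 * (N + l - p.2) + 1 = 2 * p.1 + 2 * l + 1 by omega]
  have h1 : (Nat.doubleFactorial (2 * p.1 + 2 * l + 1) : ℝ) ≠ 0 := by
    exact_mod_cast (Nat.doubleFactorial_pos _).ne'
  have h2 : (Nat.doubleFactorial (2 * p.2 + 2 * l + 1) : ℝ) ≠ 0 := by
    exact_mod_cast (Nat.doubleFactorial_pos _).ne'
  have h3 : (p.1.factorial : ℝ) ≠ 0 := by positivity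
  have h4 : (p.2.factorial : ℝ) ≠ 0 := by positivity
  rw [← hp', pow_add]
  rw [hp']
  field_simp

lemma HasSum.of_forall_eq {f g : ℕ → ℝ} {a : ℝ} (h : HasSum f a) (e : ∀ n, g n = f n) :
    HasSum g a := (funext e : g = f) ▸ h

lemma hasSum_sphBesselJ_sq (l : ℕ) (x : ℝ) :
    HasSum (fun N : ℕ => (-1 : ℝ) ^ N * x ^ (2 * (N + l)) * (2 * (N + l) + 1).choose N
      / (Nat.doubleFactorial (2 * (N + l) + 1) : ℝ) ^ 2) (sphBesselJ l x ^ 2) := by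
  have hs := summable_besselTerm_norm l x
  have h1 := (summable_norm_sum_mul_antidiagonal_of_summable_norm hs hs).of_norm.hasSum
  rw [← tsum_mul_tsum_eq_tsum_sum_antidiagonal_of_summable_norm hs hs,
    (hasSum_besselTerm l x).tsum_eq, ← sq] at h1
  refine HasSum.of_forall_eq h1 fun N => ?_
  have h2 : ∀ p ∈ Finset.HasAntidiagonal.antidiagonal N, besselTerm l x p.1 * besselTerm l x p.2
      = ((-1 : ℝ) ^ N * x ^ (2 * (N + l)) / 2 ^ N) * (1 / (p.1.factorial * p.2.factorial
        * Nat.doubleFactorial (2 * p.1 + 2 * l + 1)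
        * Nat.doubleFactorial (2 * p.2 + 2 * l + 1))) := by
    intro p hp
    have hp' : p.1 + p.2 = N := Finset.HasAntidiagonal.mem_antidiagonal.mp hp
    simp only [besselTerm]
    rw [← hp', show 2 * (p.1 + p.2 + l) = (2 * p.1 + l) + (2 * p.2 + l) by ring, pow_add, pow_add,
      pow_add]
    field_simp
    ring
  rw [Finset.sum_congr rfl h2, ← Finset.mul_sum, sum_antidiagonal_doubleFactorial]
  field_simp

lemma hasSum_sinc (y : ℝ) :
    HasSum (fun n : ℕ => (-1 : ℝ) ^ n
        * (y ^ 2) ^ n / ((2 * n + 1).factorial : ℝ)) (Real.sinc y) := by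
  rcases eq_or_ne y 0 with rfl | hy
  · rw [Real.sinc_zero]
    refine HasSum.of_forall_eq (hasSum_ite_eq (0 : ℕ) (1 : ℝ)) fun n => ?_
    rcases eq_or_ne n 0 with rfl | hn
    · simp
    · simp [hn]
  · rw [Real.sinc_of_ne_zero hy]
    refine HasSum.of_forall_eq ((Real.hasSum_sin y).div_const y) fun n => ?_
    rw [← pow_mul, pow_succ y (2 * n)]
    field_simp

/-- Gegenbauer's addition theorem for `j_l`, on the diagonal. -/
lemma sphBesselJ_sq_eq (l : ℕ) (x : ℝ) :
    sphBesselJ l x ^ 2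
      = 1 / 2 * ∫ t in (-1 : ℝ)..1, Real.sinc (x * √(2 - 2 * t)) * (legendre l).eval t := by
  set f : ℕ → ℝ → ℝ := fun n t =>
    (-1 : ℝ) ^ n * (x ^ 2 * (2 - 2 * t)) ^ n / ((2 * n + 1).factorial : ℝ)
        * (legendre l).eval t with hf
  have hfc : ∀ n, Continuous (f n) := fun n => by
    have := (legendre l).continuous
    simp only [hf]; fun_prop
  obtain ⟨B, hB⟩ := (isCompact_Icc (a := (-1 : ℝ)) (b := 1)).exists_bound_of_continuousOn
    (legendre l).continuous.continuousOn
  -- The sinc series is integrated termwise; on [−1, 1] one has 0 ≤ 2 − 2t ≤ 4 and (2n+1)! ≥ n!, so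
  -- an exponential series dominates.
  have hsum := intervalIntegral.hasSum_integral_of_dominated_convergence
    (μ := volume) (a := (-1 : ℝ)) (b := 1) (F := f)
    (f := fun t => Real.sinc (x * √(2 - 2 * t)) * (legendre l).eval t)
    (fun n _ => (x ^ 2 * 4) ^ n / (n.factorial : ℝ) * B)
    (fun n => (hfc n).aestronglyMeasurable)
    (fun n => Eventually.of_forall fun t ht => by
      rw [uIoc_of_le (by norm_num)] at ht
      have htI : t ∈ Icc (-1 : ℝ) 1 := ⟨ht.1.le, ht.2⟩
      simp only [hf]
      rw [norm_mul, norm_div, norm_mul, norm_pow, norm_neg, norm_one, one_pow, one_mul, norm_pow,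
        Real.norm_of_nonneg (show 0 ≤ x ^ 2 * (2 - 2 * t) by
          have : 0 ≤ 2 - 2 * t := by linarith [ht.2]
          positivity),
        Real.norm_of_nonneg (show (0 : ℝ) ≤ ((2 * n + 1).factorial : ℝ) by positivity)]
      have h0 : 0 ≤ 2 - 2 * t := by linarith [ht.2]
      refine mul_le_mul ?_ (hB t htI) (norm_nonneg _) (by positivity)
      refine div_le_div₀ (by positivity) ?_ (by positivity) ?_
      · refine pow_le_pow_left₀ (by positivity) ?_ n
        refine mul_le_mul_of_nonneg_left ?_ (sq_nonneg x)
        linarith [ht.1]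
      · exact_mod_cast Nat.factorial_le (by omega))
    (Eventually.of_forall fun t _ => (Real.summable_pow_div_factorial _).mul_right _)
    (by simp)
    (Eventually.of_forall fun t ht => by
      rw [uIoc_of_le (by norm_num)] at ht
      have h := (hasSum_sinc (x * √(2 - 2 * t))).mul_right ((legendre l).eval t)
      rw [mul_pow, Real.sq_sqrt (by linarith [ht.2])] at h
      exact h)
  have hI : ∀ n, ∫ t in (-1 : ℝ)..1, f n t = (-1) ^ (n + l) * x ^ (2 * n) * 2 * 4 ^ n
      * n.descFactorial l * n.factorial / ((n + l + 1).factorial * (2 * n + 1).factorial) := by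
    intro n
    have : ∀ t, f n t = ((-1) ^ n * x ^ (2 * n) * 2 ^ n / ((2 * n + 1).factorial : ℝ))
        * ((1 - t) ^ n * (legendre l).eval t) := by
      intro t
      simp only [hf]
      rw [show x ^ 2 * (2 - 2 * t) = x ^ 2 * 2 * (1 - t) by ring, mul_pow, mul_pow, pow_mul]
      ring
    simp_rw [this]
    rw [intervalIntegral.integral_const_mul, integral_one_sub_pow_mul_legendre,
      show (4 : ℝ) = 2 * 2 by norm_num, mul_pow, pow_add, pow_succ (2 : ℝ)]
    field_simp
    ring
  simp_rw [hI] at hsum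
  -- The terms n < l vanish by orthogonality; after dropping them, the series matches that of j_l²
  -- term by term.
  have h2 := (hasSum_nat_add_iff' l).mpr hsum
  have h0 : ∑ n ∈ Finset.range l, (-1 : ℝ) ^ (n + l) * x ^ (2 * n) * 2 * 4 ^ n
      * n.descFactorial l * n.factorial / ((n + l + 1).factorial * (2 * n + 1).factorial) = 0 :=
    Finset.sum_eq_zero fun n hn => by
      rw [Nat.descFactorial_of_lt (Finset.mem_range.mp hn)]; simp
  rw [h0, sub_zero] at h2
  refine (hasSum_sphBesselJ_sq l x).unique ?_
  refine HasSum.of_forall_eq (h2.mul_left (1 / 2)) fun N => ?_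
  have e1 : ((N + l).descFactorial l : ℝ) = (N + l).factorial / N.factorial := by
    have := Nat.factorial_mul_descFactorial (n := N + l) (k := l) (by omega)
    rw [Nat.add_sub_cancel] at this
    rw [← this]; push_cast; field_simp
  have e2 : ((2 * (N + l) + 1).choose N : ℝ)
      = (2 * (N + l) + 1).factorial / (N.factorial * (N + l + l + 1).factorial) := by
    have := Nat.choose_mul_factorial_mul_factorial (n := 2 * (N + l) + 1) (k := N) (by omega)
    rw [show 2 * (N + l) + 1 - N = N + l + l + 1 by omega] at this
    rw [← this]; push_cast; field_simp
  have e3 : (-1 : ℝ) ^ (N + l + l) = (-1) ^ N := by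
    rw [add_assoc, pow_add, ← two_mul, pow_mul]; simp
  rw [e1, e2, e3, doubleFactorial_two_mul_add_one]
  have h1 : (Nat.doubleFactorial (2 * (N + l) + 1) : ℝ) ≠ 0 := by
    exact_mod_cast (Nat.doubleFactorial_pos _).ne'
  have h4 : (4 : ℝ) ^ (N + l) = 2 ^ (N + l) * 2 ^ (N + l) := by rw [← mul_pow]; norm_num
  rw [h4]
  field_simp

/-! ### The exponentially weighted integral of `j_l²` -/

lemma integral_exp_neg_mul_sin {a b : ℝ} (ha : 0 < a) :
    ∫ R in Ioi (0 : ℝ), Real.exp (-a * R) * Real.sin (b * R) = b / (a ^ 2 + b ^ 2) := by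
  set c : ℂ := -a + b * Complex.I with hc
  have hre : c.re < 0 := by simp [hc, ha]
  have hint : IntegrableOn (fun x : ℝ => Complex.exp (c * x)) (Ioi 0) :=
    integrableOn_exp_mul_complex_Ioi hre 0
  have h := congrArg Complex.im (integral_exp_mul_complex_Ioi hre 0)
  rw [← RCLike.im_to_complex, ← integral_im hint] at h
  have e : ∀ x : ℝ, RCLike.im (Complex.exp (c * x)) = Real.exp (-a * x) * Real.sin (b * x) := by
    intro x
    rw [RCLike.im_to_complex, Complex.exp_im]
    simp [hc]
  simp_rw [e] at h
  rw [h]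
  simp [hc, Complex.div_im, Complex.normSq_apply]
  ring

lemma integrableOn_exp_neg_mul_self {a : ℝ} (ha : 0 < a) :
    IntegrableOn (fun R : ℝ => Real.exp (-a * R) * R) (Ioi 0) := by
  have := integrableOn_rpow_mul_exp_neg_mul_rpow (s := 1) (p := 1) (b := a) (by norm_num) one_pos ha
  refine this.congr_fun (fun x _ => ?_) measurableSet_Ioi
  simp [mul_comm]

lemma integral_exp_mul_sinc {a k s : ℝ} (ha : 0 < a) (hk : 0 < k) (hs : 0 < s) :
    ∫ R in Ioi (0 : ℝ), Real.exp (-a * R) * R * Real.sinc (k * R * s)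
        = 1 / (a ^ 2 + (k * s) ^ 2) := by
  have e : ∀ R ∈ Ioi (0 : ℝ), Real.exp (-a * R) * R * Real.sinc (k * R * s)
      = (1 / (k * s)) * (Real.exp (-a * R) * Real.sin (k * s * R)) := by
    intro R hR
    have hR : (0 : ℝ) < R := hR
    rw [Real.sinc_of_ne_zero (by positivity), mul_right_comm k R s]
    field_simp
  rw [setIntegral_congr_fun measurableSet_Ioi e, integral_const_mul, integral_exp_neg_mul_sin ha]
  have : 0 < a ^ 2 + (k * s) ^ 2 := by positivity
  field_simp

/-- Insert Gegenbauer's formula and exchange the integrals: the R-integral is then the Laplace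
transform of a sine, with frequency squared k²(2 − 2t). -/
lemma integral_exp_mul_sphBesselJ_sq (l : ℕ) {a k : ℝ} (ha : 0 < a) (hk : 0 < k) :
    ∫ R in Ioi (0 : ℝ), Real.exp (-a * R) * R * sphBesselJ l (k * R) ^ 2
      = 1 / (4 * k ^ 2) * ∫ t in (-1 : ℝ)..1, (1 + a ^ 2 / (2 * k ^ 2) - t)⁻¹
          * (legendre l).eval t := by
  simp_rw [sphBesselJ_sq_eq, intervalIntegral.integral_of_le (show (-1 : ℝ) ≤ 1 by norm_num)]
  have e1 : ∀ R : ℝ, Real.exp (-a * R) * R * (1 / 2 * ∫ t in Ioc (-1 : ℝ) 1,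
      Real.sinc (k * R * √(2 - 2 * t)) * (legendre l).eval t)
      = ∫ t in Ioc (-1 : ℝ) 1, 1 / 2 * (legendre l).eval t
        * (Real.exp (-a * R) * R * Real.sinc (k * R * √(2 - 2 * t))) := by
    intro R
    rw [← mul_assoc, ← integral_const_mul]
    congr 1; ext t; ring
  simp_rw [e1]
  -- Passing to the open interval removes t = 1, where √(2 − 2t) = 0 and the sine transform does not
  -- apply.
  rw [integral_integral_swap, ← integral_const_mul, integral_Ioc_eq_integral_Ioo,
    integral_Ioc_eq_integral_Ioo]
  · refine setIntegral_congr_fun measurableSet_Ioo fun t ht => ?_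
    have h0 : 0 < 2 - 2 * t := by linarith [ht.2]
    rw [integral_const_mul, integral_exp_mul_sinc ha hk (Real.sqrt_pos.mpr h0), mul_pow,
      Real.sq_sqrt h0.le]
    have h1 : 0 < a ^ 2 + k ^ 2 * (2 - 2 * t) := by positivity
    have h2 : 0 < 1 + a ^ 2 / (2 * k ^ 2) - t := by
      have : 0 < a ^ 2 / (2 * k ^ 2) := by positivity
      linarith
    have h3 : 1 + a ^ 2 / (2 * k ^ 2) - t = (a ^ 2 + k ^ 2 * (2 - 2 * t)) / (2 * k ^ 2) := by
      field_simp; ring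
    rw [h3]
    field_simp
    ring
  · have hprod : Integrable (fun p : ℝ × ℝ => (Real.exp (-a * p.1) * p.1)
      * (1 / 2 * (legendre l).eval p.2))
        ((volume.restrict (Ioi 0)).prod (volume.restrict (Ioc (-1) 1))) :=
      Integrable.mul_prod (integrableOn_exp_neg_mul_self ha)
        ((continuous_const.mul (legendre l).continuous).integrableOn_Ioc)
    refine hprod.mono (Continuous.aestronglyMeasurable ?_) (Eventually.of_forall fun p => ?_)
    · have := (legendre l).continuous
      have := Real.continuous_sinc
      simp only [Function.uncurry_def]
      fun_prop
    · simp only [Function.uncurry_def]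
      rw [show 1 / 2 * (legendre l).eval p.2 * (Real.exp (-a * p.1) * p.1 *
          Real.sinc (k * p.1 * √(2 - 2 * p.2))) = (Real.exp (-a * p.1) * p.1) *
          (1 / 2 * (legendre l).eval p.2) * Real.sinc (k * p.1 * √(2 - 2 * p.2)) by ring, norm_mul]
      exact mul_le_of_le_one_right (norm_nonneg _) (Real.abs_sinc_le_one _)

/-- Up to a factor 2 this is Neumann's formula for Q_l(z). Moving the l derivatives of Rodrigues'
formula onto 1/(z − t) produces an l-th power, ready for Laplace's method. -/
lemma integral_inv_sub_mul_legendre (l : ℕ) {z : ℝ} (hz : 1 < z) :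
    ∫ t in (-1 : ℝ)..1, (z - t)⁻¹ * (legendre l).eval t
      = ∫ t in (-1 : ℝ)..1, ((1 - t ^ 2) / (2 * (z - t))) ^ l * (z - t)⁻¹ := by
  have h := integral_mul_legendre l (fun i t => (i.factorial : ℝ) / (z - t) ^ (i + 1))
    (fun i t ht => by
      have h0 : z - t ≠ 0 := by have := ht.2; intro h; linarith
      have := (hasDerivAt_const t (i.factorial : ℝ)).div
        (((hasDerivAt_id t).const_sub z).pow (i + 1)) (pow_ne_zero _ h0)
      refine this.congr_deriv ?_
      rw [Nat.factorial_succ]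
      simp
      field_simp
      ring)
  simp only [Nat.factorial_zero, Nat.cast_one, zero_add, pow_one, one_div] at h
  rw [h, ← intervalIntegral.integral_const_mul]
  refine intervalIntegral.integral_congr fun t ht => ?_
  rw [uIcc_of_le (by norm_num)] at ht
  have h0 : z - t ≠ 0 := by have := ht.2; intro h; linarith
  have h1 : (l.factorial : ℝ) ≠ 0 := by positivity
  simp only [rodriguesConst]
  rw [show t ^ 2 - 1 = (-1) * (1 - t ^ 2) by ring, mul_pow, div_pow, mul_pow]
  have e2 : ((-1 : ℝ) ^ l) * (-1) ^ l = 1 := by rw [← mul_pow]; simp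
  field_simp
  linear_combination (1 - t ^ 2) ^ l * (z - t) ^ (l + 1) * e2

lemma one_lt_cosh_beta_arg {α k : ℝ} (hα : 0 < α) (hk : 0 < k) : 1 < 1 + 2 * α ^ 2 / k ^ 2 := by
  have : 0 < 2 * α ^ 2 / k ^ 2 := by positivity
  linarith

lemma cosh_beta {α k : ℝ} (hα : 0 < α) (hk : 0 < k) :
    Real.cosh (beta α k) = 1 + 2 * α ^ 2 / k ^ 2 :=
  Real.cosh_arcosh (one_lt_cosh_beta_arg hα hk).le

lemma beta_pos {α k : ℝ} (hα : 0 < α) (hk : 0 < k) : 0 < beta α k :=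
  Real.arcosh_pos (one_lt_cosh_beta_arg hα hk)

/-- Laplace's method for Neumann's integral of the Legendre function of the second kind. -/
lemma integral_inv_sub_mul_legendre_le {b : ℝ} (hb : 0 < b) :
    ∃ C : ℝ, 0 ≤ C ∧ ∀ l : ℕ, 1 ≤ l →
      ∫ t in (-1 : ℝ)..1, (Real.cosh b - t)⁻¹ * (legendre l).eval t
        ≤ C * (Real.exp (-b * l) / √l) := by
  set z := Real.cosh b with hz
  have hz1 : 1 < z := Real.one_lt_cosh.mpr hb.ne'
  -- e^{−b} is both the maximiser on [−1, 1] and the maximum of (1 − t²)/(2(z − t)).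
  set q := Real.exp (-b) with hq
  have hq0 : 0 < q := Real.exp_pos _
  have hzq : 2 * z * q = 1 + q ^ 2 := by
    have : Real.exp b * q = 1 := by rw [hq, ← Real.exp_add]; simp
    rw [hz, Real.cosh_eq, ← hq]
    linear_combination this
  -- Chosen so that qc(t − q)² bounds the deficit (t − q)²/(2(z − t)) from below, using z − t ≤ z +
  -- 1.
  set c := 1 / (2 * (z + 1) * q) with hc
  have hc0 : 0 < c := by rw [hc]; have : 0 < z := by linarith
                         positivity
  refine ⟨(z - 1)⁻¹ * √(Real.pi / c), by
    have : 0 < z - 1 := by linarith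
    positivity, fun l hl => ?_⟩
  have hl0 : (0 : ℝ) < l := by exact_mod_cast hl
  rw [integral_inv_sub_mul_legendre l hz1]
  have hgauss : Integrable fun t : ℝ => Real.exp (-(c * l) * (t - q) ^ 2) :=
    (integrable_exp_neg_mul_sq (mul_pos hc0 hl0)).comp_sub_right q
  have hpt : ∀ t ∈ Icc (-1 : ℝ) 1, ((1 - t ^ 2) / (2 * (z - t))) ^ l * (z - t)⁻¹
      ≤ (z - 1)⁻¹ * q ^ l * Real.exp (-(c * l) * (t - q) ^ 2) := by
    intro t ht
    have h0 : 0 < z - t := by linarith [ht.2]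
    have h1 : 0 ≤ (1 - t ^ 2) / (2 * (z - t)) := by
      have : 0 ≤ 1 - t ^ 2 := by nlinarith [ht.1, ht.2]
      positivity
    have h2 : (1 - t ^ 2) / (2 * (z - t)) ≤ q * Real.exp (-c * (t - q) ^ 2) := by
      have e : (1 - t ^ 2) / (2 * (z - t)) = q - (t - q) ^ 2 / (2 * (z - t)) := by
        field_simp
        linear_combination -hzq
      have h3 : q * (c * (t - q) ^ 2) ≤ (t - q) ^ 2 / (2 * (z - t)) := by
        have : q * (c * (t - q) ^ 2) = (t - q) ^ 2 / (2 * (z + 1)) := by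
          rw [hc]; have : z + 1 ≠ 0 := by linarith
          field_simp
        rw [this]
        refine div_le_div_of_nonneg_left (sq_nonneg _) (by positivity) ?_
        linarith [ht.1]
      -- 1 − x ≤ e^{−x} makes the base a Gaussian; its l-th power integrates to √(π/(cl)), whence
      -- the factor 1/√l.
      have h4 := Real.add_one_le_exp (-c * (t - q) ^ 2)
      rw [e]
      nlinarith
    have h5 : (z - t)⁻¹ ≤ (z - 1)⁻¹ := inv_anti₀ (by linarith) (by linarith [ht.2])
    calc _ ≤ (q * Real.exp (-c * (t - q) ^ 2)) ^ l * (z - 1)⁻¹ := by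
          gcongr
      _ = _ := by
          rw [mul_pow, ← Real.exp_nat_mul (-c * (t - q) ^ 2) l]
          ring_nf
  calc ∫ t in (-1 : ℝ)..1, ((1 - t ^ 2) / (2 * (z - t))) ^ l * (z - t)⁻¹
      ≤ ∫ t in (-1 : ℝ)..1, (z - 1)⁻¹ * q ^ l * Real.exp (-(c * l) * (t - q) ^ 2) := by
        refine intervalIntegral.integral_mono_on (by norm_num) ?_ ?_ hpt
        · refine ContinuousOn.intervalIntegrable fun t ht => ContinuousAt.continuousWithinAt ?_
          rw [uIcc_of_le (by norm_num)] at ht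
          have h0 : z - t ≠ 0 := by have := ht.2; intro h; linarith
          have h1 : 2 * (z - t) ≠ 0 := by simpa using h0
          fun_prop (disch := assumption)
        · exact Continuous.intervalIntegrable (by fun_prop) _ _
    _ = (z - 1)⁻¹ * q ^ l * ∫ t in (-1 : ℝ)..1, Real.exp (-(c * l) * (t - q) ^ 2) :=
        intervalIntegral.integral_const_mul _ _
    _ ≤ (z - 1)⁻¹ * q ^ l * ∫ t : ℝ, Real.exp (-(c * l) * (t - q) ^ 2) := by
        have : 0 < z - 1 := by linarith
        refine mul_le_mul_of_nonneg_left ?_ (by positivity)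
        rw [intervalIntegral.integral_of_le (by norm_num)]
        exact setIntegral_le_integral hgauss (Eventually.of_forall fun t => (Real.exp_pos _).le)
    _ = _ := by
        rw [integral_sub_right_eq_self (fun t : ℝ => Real.exp (-(c * l) * t ^ 2)) q,
          integral_gaussian, ← div_div, Real.sqrt_div (by positivity), hq, ← Real.exp_nat_mul,
          mul_comm (l : ℝ)]
        ring

lemma exists_integral_sphBesselJ_sq_le {α k : ℝ} (hα : 0 < α) (hk : 0 < k) :
    ∃ C : ℝ, 0 ≤ C ∧ ∀ l : ℕ, 1 ≤ l →
      ∫ R in Ioi (0 : ℝ), Real.exp (-(2 * α) * R) * R * sphBesselJ l (k * R) ^ 2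
        ≤ C * (Real.exp (-beta α k * l) / √l) := by
  obtain ⟨C, hC, h⟩ := integral_inv_sub_mul_legendre_le (beta_pos hα hk)
  refine ⟨1 / (4 * k ^ 2) * C, by positivity, fun l hl => ?_⟩
  rw [integral_exp_mul_sphBesselJ_sq l (by positivity) hk,
    show 1 + (2 * α) ^ 2 / (2 * k ^ 2) = Real.cosh (beta α k) by
      rw [cosh_beta hα hk]; ring, mul_assoc]
  exact mul_le_mul_of_nonneg_left (h l hl) (by positivity)

/-! ### Compact operators on Hilbert spaces -/

section Hilbert

variable {H : Type*} [NormedAddCommGroup H] [InnerProductSpace ℂ H]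

open ContinuousLinearMap (adjoint)

/-- If `V` is self-adjoint and `G - G† = -2ic |φ⟩⟨φ|`, solutions of the homogeneous equation
`f = gVGf`, `g` real, are orthogonal to `φ`. -/
lemma inner_eq_zero_of_homogeneous {V G : H →L[ℂ] H} (hV : ∀ a b, inner ℂ (V a) b = inner ℂ a (V b))
    {c : ℝ} (hc : c ≠ 0) {φ : H}
    (hG : ∀ f, inner ℂ f (G f) - inner ℂ (G f) f = -2 * Complex.I * c * ‖(inner ℂ φ f : ℂ)‖ ^ 2)
    {g : ℂ} (hg : g.im = 0) {f : H} (hf : f = g • V (G f)) : inner ℂ φ f = (0 : ℂ) := by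
  have hgc : (starRingEnd ℂ) g = g := Complex.conj_eq_iff_im.mpr hg
  -- On a homogeneous solution ⟨f, Gf⟩ = g⟨VGf, Gf⟩, which is real because V is self-adjoint and g
  -- is real.
  have h1 : inner ℂ f (G f) - inner ℂ (G f) f = (0 : ℂ) := by
    have e1 : inner ℂ f (G f) = g * inner ℂ (V (G f)) (G f) := by
      conv_lhs => rw [hf]
      rw [inner_smul_left, hgc, ← hf]
    have e2 : inner ℂ (G f) f = g * inner ℂ (G f) (V (G f)) := by
      conv_lhs => rw [hf]
      rw [inner_smul_right, ← hf]
    rw [e1, e2, hV, sub_self]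
  have h2 := hG f
  rw [h1] at h2
  have hc' : (c : ℂ) ≠ 0 := by exact_mod_cast hc
  simpa [hc'] using h2.symm

lemma isCompactOperator_rankOne (a b : H) :
    IsCompactOperator ((innerSL ℂ a).smulRight b : H →L[ℂ] H) := by
  have h0 : IsCompactOperator (id : ℂ → ℂ) :=
    isCompactOperator_id_iff_locallyCompactSpace.mpr inferInstance
  have h1 : IsCompactOperator (id ∘ (innerSL ℂ a : H →L[ℂ] ℂ)) := h0.comp_clm (innerSL ℂ a)
  exact h1.clm_comp (ContinuousLinearMap.toSpanSingleton ℂ b)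

variable [CompleteSpace H]

/-- A Hilbert-Schmidt operator is compact. -/
lemma isCompactOperator_of_summable_norm_sq {ι : Type*} (b : HilbertBasis ι ℂ H) (T : H →L[ℂ] H)
    (hT : Summable fun i => ‖T (b i)‖ ^ 2) : IsCompactOperator T := by
  classical
  set F : Finset ι → H →L[ℂ] H := fun s => ∑ i ∈ s, (innerSL ℂ (b i)).smulRight (T (b i)) with hF
  have hFc : ∀ s, IsCompactOperator (F s) := by
    intro s
    simp only [hF]
    induction s using Finset.induction_on with
    | empty => simpa using! isCompactOperator_zero (M₁ := H) (M₂ := H)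
    | insert i s hi ih =>
      rw [Finset.sum_insert hi]
      exact (isCompactOperator_rankOne _ _).add ih
  refine isCompactOperator_of_tendsto (l := atTop) (F := F) ?_ (Eventually.of_forall hFc)
  have htail := tendsto_tsum_compl_atTop_zero fun i => ‖T (b i)‖ ^ 2
  -- The tail of the expansion is estimated by Cauchy-Schwarz and Bessel's inequality, so the
  -- finite-rank truncations converge in operator norm.
  have hbound : ∀ s, ‖F s - T‖ ≤ √(∑' i : { x // x ∉ s }, ‖T (b i)‖ ^ 2) := by
    intro s
    refine ContinuousLinearMap.opNorm_le_bound _ (Real.sqrt_nonneg _) fun f => ?_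
    have hsum : HasSum (fun i => inner ℂ (b i) f • T (b i)) (T f) := by
      have := (b.hasSum_repr f).mapL T
      simpa [HilbertBasis.repr_apply_apply] using this
    have hlim : Tendsto (fun t : Finset ι => ‖F s f - ∑ i ∈ t, inner ℂ (b i) f • T (b i)‖) atTop
        (𝓝 ‖F s f - T f‖) := (tendsto_const_nhds.sub hsum).norm
    refine le_of_tendsto hlim ?_
    filter_upwards [eventually_ge_atTop s] with t hst
    have e : F s f - ∑ i ∈ t, inner ℂ (b i) f • T (b i)
        = -∑ i ∈ t \ s, inner ℂ (b i) f • T (b i) := by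
      rw [← Finset.sum_sdiff hst, hF]
      simp
    rw [e, norm_neg]
    have h1 : ∑ i ∈ t \ s, ‖T (b i)‖ ^ 2 ≤ ∑' i : { x // x ∉ s }, ‖T (b i)‖ ^ 2 := by
      have hs' : Summable fun i : { x // x ∉ s } => ‖T (b i)‖ ^ 2 := hT.subtype _
      have := hs'.sum_le_tsum ((t \ s).subtype (· ∉ s)) (fun i _ => by positivity)
      rw [Finset.sum_subtype_of_mem (fun i => ‖T (b i)‖ ^ 2)
        (fun x hx => (Finset.mem_sdiff.mp hx).2)] at this
      exact this
    calc ‖∑ i ∈ t \ s, inner ℂ (b i) f • T (b i)‖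
        ≤ ∑ i ∈ t \ s, ‖T (b i)‖ * ‖inner ℂ (b i) f‖ := by
          refine (norm_sum_le _ _).trans (le_of_eq (Finset.sum_congr rfl fun i _ => ?_))
          rw [norm_smul, mul_comm]
      _ ≤ √(∑ i ∈ t \ s, ‖T (b i)‖ ^ 2) * √(∑ i ∈ t \ s, ‖inner ℂ (b i) f‖ ^ 2) :=
          Real.sum_mul_le_sqrt_mul_sqrt _ _ _
      _ ≤ √(∑' i : { x // x ∉ s }, ‖T (b i)‖ ^ 2) * √(‖f‖ ^ 2) := by
          gcongr
          exact b.orthonormal.sum_inner_products_le f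
      _ = _ := by rw [Real.sqrt_sq (norm_nonneg _)]
  rw [tendsto_iff_norm_sub_tendsto_zero]
  refine squeeze_zero (fun s => norm_nonneg _) hbound ?_
  simpa using htail.sqrt

/-- The Fredholm alternative: if `K` and its adjoint are compact, the range of `1 - K` contains
the orthogonal complement of the kernel of `(1 - K)†`. -/
lemma exists_sub_eq_of_forall_adjoint {K : H →L[ℂ] H} (hK : IsCompactOperator K)
    (hK' : IsCompactOperator (adjoint K)) {y : H}
    (hy : ∀ ψ, adjoint K ψ = ψ → inner ℂ ψ y = 0) : ∃ x, x - K x = y := by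
  set A : H →L[ℂ] H := 1 - K with hA
  have hAapp : ∀ x, A x = x - K x := fun x => rfl
  have hAadj : ∀ x, adjoint A x = x - adjoint K x := by
    intro x
    simp [hA, map_sub, ContinuousLinearMap.one_def, ContinuousLinearMap.adjoint_id]
  set N : Submodule ℂ H := LinearMap.ker (A : H →ₗ[ℂ] H) with hN
  have hNc : IsClosed (N : Set H) := ContinuousLinearMap.isClosed_ker A
  have : CompleteSpace N := hNc.completeSpace_coe
  set P : H →L[ℂ] H := N.starProjection with hP
  have hPN : ∀ x, P x ∈ N := fun x => Submodule.starProjection_apply_mem N x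
  have hKP : K ∘L P = P := by
    ext x
    have : A (P x) = 0 := hPN x
    rw [hAapp, sub_eq_zero] at this
    exact this.symm
  have hPc : IsCompactOperator P := by
    rw [← hKP]; exact hK.comp_clm P
  -- Arranged so that 1 − T = A†A + P with P the projection onto ker A. This is injective, and T is
  -- compact, so the alternative "eigenvalue or resolvent point" at 1 makes it bijective.
  set T : H →L[ℂ] H := K + adjoint K - adjoint K ∘L K - P with hT
  have hTc : IsCompactOperator T :=
    ((hK.add hK').sub (hK'.comp_clm K)).sub hPc
  have hTS : ∀ x, x - T x = adjoint A (A x) + P x := by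
    intro x
    rw [hAadj, hAapp]
    simp only [hT, sub_apply, add_apply,
      ContinuousLinearMap.comp_apply, map_sub]
    abel
  have hinner : ∀ x, A x = 0 → ∀ z, inner ℂ x (adjoint A z) = 0 := by
    intro x hx z
    rw [ContinuousLinearMap.adjoint_inner_right, hx, inner_zero_left]
  have hres : (1 : ℂ) ∈ resolventSet ℂ T := by
    refine (hTc.hasEigenvalue_or_mem_resolventSet one_ne_zero).resolve_left fun hev => ?_
    obtain ⟨x, hx⟩ := hev.exists_hasEigenvector
    have hTx : T x = x := by simpa using hx.apply_eq_smul
    have h0 : adjoint A (A x) + P x = 0 := by rw [← hTS, hTx, sub_self]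
    have h1 : inner ℂ x (adjoint A (A x)) + inner ℂ x (P x) = 0 := by
      rw [← inner_add_right, h0, inner_zero_right]
    have h2 : inner ℂ x (P x) = ((‖P x‖ ^ 2 : ℝ) : ℂ) := by
      have : inner ℂ (x - P x) (P x) = 0 :=
        Submodule.starProjection_inner_eq_zero x (P x) (hPN x)
      rw [inner_sub_left, sub_eq_zero] at this
      rw [this, inner_self_eq_norm_sq_to_K]
      push_cast; rfl
    have h3 : inner ℂ x (adjoint A (A x)) = ((‖A x‖ ^ 2 : ℝ) : ℂ) := by
      rw [ContinuousLinearMap.adjoint_inner_right, inner_self_eq_norm_sq_to_K]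
      push_cast; rfl
    rw [h2, h3, ← Complex.ofReal_add] at h1
    have h4 : ‖A x‖ ^ 2 + ‖P x‖ ^ 2 = 0 := by exact_mod_cast h1
    have h5 : A x = 0 := by
      have : ‖A x‖ ^ 2 = 0 := by nlinarith [sq_nonneg (‖A x‖), sq_nonneg (‖P x‖)]
      simpa using this
    have h6 : P x = 0 := by
      have : ‖P x‖ ^ 2 = 0 := by nlinarith [sq_nonneg (‖A x‖), sq_nonneg (‖P x‖)]
      simpa using this
    have h7 : P x = x := Submodule.starProjection_eq_self_iff.mpr h5
    exact hx.2 (h7 ▸ h6)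
  rw [spectrum.mem_resolventSet_iff, map_one] at hres
  have hbij := (ContinuousLinearMap.isUnit_iff_bijective).mp hres
  obtain ⟨x, hx⟩ := hbij.2 (adjoint A y)
  have hx' : adjoint A (A x) + P x = adjoint A y := by rw [← hTS]; exact hx
  -- Pairing with Px, which lies in ker A and so is orthogonal to the range of A†.
  have hPx : P x = 0 := by
    have h1 : inner ℂ (P x) (adjoint A (A x)) + inner ℂ (P x) (P x)
        = inner ℂ (P x) (adjoint A y) := by rw [← inner_add_right, hx']
    rw [hinner _ (hPN x), hinner _ (hPN x), zero_add] at h1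
    exact inner_self_eq_zero.mp h1
  rw [hPx, add_zero] at hx'
  -- Ax − y lies in ker A†. There it is orthogonal to y by hypothesis and to Ax automatically, hence
  -- to itself.
  have hd : adjoint A (A x - y) = 0 := by rw [map_sub, hx', sub_self]
  refine ⟨x, ?_⟩
  rw [← hAapp, ← sub_eq_zero]
  have h1 : inner ℂ (A x - y) y = 0 := by
    refine hy _ ?_
    rw [hAadj, sub_eq_zero] at hd
    exact hd.symm
  have h2 : inner ℂ (A x - y) (A x) = 0 := by
    rw [← ContinuousLinearMap.adjoint_inner_left, hd, inner_zero_left]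
  rw [← inner_self_eq_zero (𝕜 := ℂ), inner_sub_right, h1, h2, sub_zero]

/-- Solvability of `f - gVGf = Vφ` for real `g`. -/
lemma exists_sub_smul_eq_of_real {V G : H →L[ℂ] H}
    (hV : ∀ a b, inner ℂ (V a) b = inner ℂ a (V b)) (hVc : IsCompactOperator V)
    {c : ℝ} (hc : c ≠ 0) {φ : H}
    (hG : ∀ f, inner ℂ f (G f) - inner ℂ (G f) f = -2 * Complex.I * c * ‖(inner ℂ φ f : ℂ)‖ ^ 2)
    {g : ℂ} (hg : g.im = 0) : ∃ f, f - g • V (G f) = V φ := by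
  have hgc : (starRingEnd ℂ) g = g := Complex.conj_eq_iff_im.mpr hg
  have hVadj : adjoint V = V := ((ContinuousLinearMap.eq_adjoint_iff V V).mpr hV).symm
  have hKadj : adjoint (g • (V ∘L G)) = g • (adjoint G ∘L V) := by
    rw [map_smulₛₗ, ContinuousLinearMap.adjoint_comp, hVadj, hgc]
  have hK : IsCompactOperator (g • (V ∘L G)) := (hVc.comp_clm G).smul g
  have hK' : IsCompactOperator (adjoint (g • (V ∘L G))) := by
    rw [hKadj]; exact (hVc.clm_comp (adjoint G)).smul g
  refine exists_sub_eq_of_forall_adjoint hK hK' fun ψ hψ => ?_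
  rw [hKadj] at hψ
  have hψ' : ψ = g • adjoint G (V ψ) := hψ.symm
  -- A solution ψ of the adjoint equation gives Vψ as a homogeneous solution for G†, whose rank-one
  -- constant is −c. So Vψ ⟂ φ, that is ψ ⟂ Vφ, as the Fredholm alternative requires.
  have hhom : V ψ = g • V (adjoint G (V ψ)) := by
    conv_lhs => rw [hψ', map_smul]
  have h := inner_eq_zero_of_homogeneous (G := adjoint G) (c := -c) (φ := φ) hV (neg_ne_zero.mpr hc)
    (fun f => by
      rw [ContinuousLinearMap.adjoint_inner_right, ContinuousLinearMap.adjoint_inner_left,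
        ← neg_sub, hG]
      push_cast; ring) hg hhom
  rw [← hV, ← inner_conj_symm, h, map_zero]

end Hilbert

/-! ### Hilbert-Schmidt integral operators -/

section HilbertSchmidt

variable {X : Type*} [MeasurableSpace X] {μ : Measure X}

lemma eLpNorm_two_sq {E : Type*} [NormedAddCommGroup E] (f : X → E) :
    eLpNorm f 2 μ ^ 2 = ∫⁻ x, ‖f x‖ₑ ^ 2 ∂μ := by
  have := eLpNorm_nnreal_pow_eq_lintegral (μ := μ) (f := f) (p := 2) two_ne_zero
  norm_num at this
  exact this

lemma memLp_two_iff {E : Type*} [NormedAddCommGroup E] {f : X → E}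
    (hf : AEStronglyMeasurable f μ) : MemLp f 2 μ ↔ ∫⁻ x, ‖f x‖ₑ ^ 2 ∂μ < ∞ := by
  rw [← eLpNorm_two_sq, MemLp]
  simp [hf]

lemma sq_lintegral_mul_le {f g : X → ℝ≥0∞} (hf : AEMeasurable f μ) (hg : AEMeasurable g μ) :
    (∫⁻ x, f x * g x ∂μ) ^ 2 ≤ (∫⁻ x, f x ^ 2 ∂μ) * ∫⁻ x, g x ^ 2 ∂μ := by
  have h := ENNReal.lintegral_mul_le_Lp_mul_Lq μ Real.HolderConjugate.two_two hf hg
  have h2 := ENNReal.pow_le_pow_left (n := 2) h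
  simp only [Pi.mul_apply, ENNReal.rpow_two] at h2
  refine h2.trans (le_of_eq ?_)
  rw [mul_pow, ← ENNReal.rpow_natCast, ← ENNReal.rpow_natCast, ← ENNReal.rpow_mul,
    ← ENNReal.rpow_mul]
  norm_num

lemma enorm_integral_mul_sq_le {a f : X → ℂ} (ha : MemLp a 2 μ) (hf : MemLp f 2 μ) :
    ‖∫ y, a y * f y ∂μ‖ₑ ^ 2 ≤ (∫⁻ y, ‖a y‖ₑ ^ 2 ∂μ) * ∫⁻ y, ‖f y‖ₑ ^ 2 ∂μ := by
  refine (ENNReal.pow_le_pow_left (enorm_integral_le_lintegral_enorm _)).trans ?_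
  simp_rw [enorm_mul]
  exact sq_lintegral_mul_le ha.1.enorm hf.1.enorm

lemma memLp_uncurry_conj {k : X → X → ℂ} (hk : MemLp (Function.uncurry k) 2 (μ.prod μ)) :
    MemLp (Function.uncurry fun x y => (starRingEnd ℂ) (k x y)) 2 (μ.prod μ) :=
  hk.star

variable [SigmaFinite μ]

lemma memLp_two_prod_right {k : X → X → ℂ} (hk : MemLp (Function.uncurry k) 2 (μ.prod μ)) :
    ∀ᵐ x ∂μ, MemLp (k x) 2 μ := by
  have h2 : ∫⁻ x, ∫⁻ y, ‖k x y‖ₑ ^ 2 ∂μ ∂μ < ∞ := by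
    have := (memLp_two_iff hk.1).mp hk
    rwa [lintegral_prod _ (hk.1.enorm.pow_const 2)] at this
  have h3 := ae_lt_top' (hk.1.enorm.pow_const 2).lintegral_prod_right' h2.ne
  filter_upwards [hk.1.prodMk_left, h3] with x hx hx3
  exact (memLp_two_iff hx).mpr hx3

lemma aestronglyMeasurable_integral_mul {k : X → X → ℂ}
    (hk : AEStronglyMeasurable (Function.uncurry k) (μ.prod μ)) {f : X → ℂ}
    (hf : AEStronglyMeasurable f μ) : AEStronglyMeasurable (fun x => ∫ y, k x y * f y ∂μ) μ :=
  (hk.mul hf.comp_snd).integral_prod_right'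

lemma lintegral_enorm_integral_mul_sq_le {k : X → X → ℂ}
    (hk : MemLp (Function.uncurry k) 2 (μ.prod μ)) {f : X → ℂ} (hf : MemLp f 2 μ) :
    ∫⁻ x, ‖∫ y, k x y * f y ∂μ‖ₑ ^ 2 ∂μ
      ≤ (∫⁻ p, ‖Function.uncurry k p‖ₑ ^ 2 ∂μ.prod μ) * ∫⁻ y, ‖f y‖ₑ ^ 2 ∂μ := by
  rw [lintegral_prod _ (hk.1.enorm.pow_const 2),
    ← lintegral_mul_const'' _ (hk.1.enorm.pow_const 2).lintegral_prod_right']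
  refine lintegral_mono_ae ?_
  filter_upwards [memLp_two_prod_right hk] with x hx
  exact enorm_integral_mul_sq_le hx hf

lemma memLp_integral_mul {k : X → X → ℂ} (hk : MemLp (Function.uncurry k) 2 (μ.prod μ))
    {f : X → ℂ} (hf : MemLp f 2 μ) : MemLp (fun x => ∫ y, k x y * f y ∂μ) 2 μ := by
  rw [memLp_two_iff (aestronglyMeasurable_integral_mul hk.1 hf.1)]
  exact (lintegral_enorm_integral_mul_sq_le hk hf).trans_lt
    (ENNReal.mul_lt_top ((memLp_two_iff hk.1).mp hk) ((memLp_two_iff hf.1).mp hf))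

/-- The integral operator on `L²` with a square integrable kernel. -/
def hsOp (k : X → X → ℂ) (hk : MemLp (Function.uncurry k) 2 (μ.prod μ)) :
    Lp ℂ 2 μ →L[ℂ] Lp ℂ 2 μ :=
  LinearMap.mkContinuous
    { toFun := fun f => (memLp_integral_mul hk (Lp.memLp f)).toLp _
      map_add' := fun f g => by
        rw [← MemLp.toLp_add]
        refine (MemLp.toLp_eq_toLp_iff _ _).mpr ?_
        filter_upwards [memLp_two_prod_right hk] with x hx
        refine Eq.trans ?_ (integral_add (hx.integrable_mul (Lp.memLp f))
          (hx.integrable_mul (Lp.memLp g)))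
        refine integral_congr_ae ?_
        filter_upwards [Lp.coeFn_add f g] with y hy
        rw [hy, Pi.add_apply, mul_add]
      map_smul' := fun c f => by
        rw [RingHom.id_apply, ← MemLp.toLp_const_smul]
        refine (MemLp.toLp_eq_toLp_iff _ _).mpr (Eventually.of_forall fun x => ?_)
        rw [Pi.smul_apply, ← integral_smul]
        refine integral_congr_ae ?_
        filter_upwards [Lp.coeFn_smul c f] with y hy
        rw [hy, Pi.smul_apply, smul_eq_mul, smul_eq_mul, mul_left_comm] }
    (eLpNorm (Function.uncurry k) 2 (μ.prod μ)).toReal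
    (fun f => by
      have h := lintegral_enorm_integral_mul_sq_le hk (Lp.memLp f)
      rw [← eLpNorm_two_sq, ← eLpNorm_two_sq, ← eLpNorm_two_sq, ← mul_pow] at h
      have h' := (ENNReal.pow_le_pow_left_iff two_ne_zero).mp h
      rw [LinearMap.coe_mk, AddHom.coe_mk, Lp.norm_toLp, Lp.norm_def, ← ENNReal.toReal_mul]
      exact ENNReal.toReal_mono (ENNReal.mul_ne_top hk.2.ne (Lp.memLp f).2.ne) h')

lemma coeFn_hsOp {k : X → X → ℂ} (hk : MemLp (Function.uncurry k) 2 (μ.prod μ))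
    (f : Lp ℂ 2 μ) : hsOp k hk f =ᵐ[μ] fun x => ∫ y, k x y * f y ∂μ :=
  MemLp.coeFn_toLp (memLp_integral_mul hk (Lp.memLp f))

lemma norm_hsOp_le {k : X → X → ℂ} (hk : MemLp (Function.uncurry k) 2 (μ.prod μ)) :
    ‖hsOp k hk‖ ≤ (eLpNorm (Function.uncurry k) 2 (μ.prod μ)).toReal :=
  LinearMap.mkContinuous_norm_le _ ENNReal.toReal_nonneg _

/-- Absolute convergence of the double integrals `∬ a(x) k(x,y) b(y)`. -/
lemma integrable_mul_kernel_mul {k : X → X → ℂ} (hk : MemLp (Function.uncurry k) 2 (μ.prod μ))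
    {a b : X → ℂ} (ha : MemLp a 2 μ) (hb : MemLp b 2 μ) :
    Integrable (fun p : X × X => a p.1 * k p.1 p.2 * b p.2) (μ.prod μ) := by
  have hab : MemLp (fun p : X × X => a p.1 * b p.2) 2 (μ.prod μ) := by
    refine (memLp_two_iff (ha.1.comp_fst.mul hb.1.comp_snd)).mpr ?_
    have e : ∀ p : X × X, ‖a p.1 * b p.2‖ₑ ^ 2 = ‖a p.1‖ₑ ^ 2 * ‖b p.2‖ₑ ^ 2 := fun p => by
      rw [enorm_mul, mul_pow]
    refine (lintegral_congr e).trans_lt ?_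
    rw [lintegral_prod_mul (ha.1.enorm.pow_const 2) (hb.1.enorm.pow_const 2)]
    exact ENNReal.mul_lt_top ((memLp_two_iff ha.1).mp ha) ((memLp_two_iff hb.1).mp hb)
  refine (hab.integrable_mul hk).congr (Eventually.of_forall fun p => ?_)
  change a p.1 * b p.2 * k p.1 p.2 = _
  ring

/-- The adjoint of an integral operator, the kernel being symmetric. -/
lemma inner_hsOp_conj_left {k : X → X → ℂ} (hk : MemLp (Function.uncurry k) 2 (μ.prod μ))
    (hsymm : ∀ᵐ x ∂μ, ∀ᵐ y ∂μ, k x y = k y x) (f h : Lp ℂ 2 μ) :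
    inner ℂ (hsOp _ (memLp_uncurry_conj hk) f) h = inner ℂ f (hsOp k hk h) := by
  rw [L2.inner_def, L2.inner_def]
  have e1 : ∫ x, inner ℂ (hsOp _ (memLp_uncurry_conj hk) f x) (h x) ∂μ
      = ∫ x, ∫ y, h x * k x y * (starRingEnd ℂ) (f y) ∂μ ∂μ := by
    refine integral_congr_ae ?_
    filter_upwards [coeFn_hsOp (memLp_uncurry_conj hk) f] with x hx
    rw [hx, RCLike.inner_apply, ← integral_conj, ← integral_const_mul]
    congr 1; ext y
    simp; ring
  have e2 : ∫ x, inner ℂ (f x) (hsOp k hk h x) ∂μ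
      = ∫ y, ∫ x, h x * k x y * (starRingEnd ℂ) (f y) ∂μ ∂μ := by
    refine integral_congr_ae ?_
    filter_upwards [coeFn_hsOp hk h, hsymm] with y hy hs
    rw [hy, RCLike.inner_apply, ← integral_mul_const]
    refine integral_congr_ae ?_
    filter_upwards [hs] with x hx
    rw [hx]; ring
  rw [e1, e2]
  exact integral_integral_swap (integrable_mul_kernel_mul hk (Lp.memLp h) (Lp.memLp f).star)

/-- For almost every x, the numbers ∫k(x,y)b_i(y)dy are the conjugate coefficients of the function y
↦ conj k(x,y); Bessel's inequality, integrated in x, bounds every finite sum of ‖T b_i‖² by ∬|k|².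
-/
lemma isCompactOperator_hsOp {k : X → X → ℂ} (hk : MemLp (Function.uncurry k) 2 (μ.prod μ)) :
    IsCompactOperator (hsOp k hk) := by
  obtain ⟨w, b, -⟩ := exists_hilbertBasis ℂ (Lp ℂ 2 μ)
  refine isCompactOperator_of_summable_norm_sq b _ ?_
  have hfin := (memLp_two_iff hk.1).mp hk
  refine summable_of_sum_le (c := (∫⁻ p, ‖Function.uncurry k p‖ₑ ^ 2 ∂μ.prod μ).toReal)
    (fun _ => by positivity) fun s => ?_
  have hn : ∀ i, ENNReal.ofReal (‖hsOp k hk (b i)‖ ^ 2) = ∫⁻ x, ‖∫ y, k x y * b i y ∂μ‖ₑ ^ 2 ∂μ :=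
      by
    intro i
    rw [ENNReal.ofReal_pow (norm_nonneg _), ofReal_norm, ← eLpNorm_two_sq,
      ← Lp.enorm_toLp (memLp_integral_mul hk (Lp.memLp (b i)))]
    rfl
  rw [← ENNReal.ofReal_le_iff_le_toReal hfin.ne, ENNReal.ofReal_sum_of_nonneg
    (fun _ _ => by positivity)]
  simp_rw [hn]
  rw [← lintegral_finsetSum' _ fun i _ =>
    (aestronglyMeasurable_integral_mul hk.1 (Lp.memLp (b i)).1).enorm.pow_const 2,
    lintegral_prod _ (hk.1.enorm.pow_const 2)]
  refine lintegral_mono_ae ?_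
  filter_upwards [memLp_two_prod_right hk] with x hx
  set κ : Lp ℂ 2 μ := hx.star.toLp _ with hκ
  have e : ∀ i, ∫ y, k x y * b i y ∂μ = inner ℂ κ (b i) := by
    intro i
    rw [L2.inner_def]
    refine integral_congr_ae ?_
    filter_upwards [MemLp.coeFn_toLp hx.star] with y hy
    rw [RCLike.inner_apply, hκ, hy]
    simp [mul_comm]
  have hB := b.orthonormal.sum_inner_products_le (s := s) κ
  have hκn : ENNReal.ofReal (‖κ‖ ^ 2) = ∫⁻ y, ‖k x y‖ₑ ^ 2 ∂μ := by
    rw [ENNReal.ofReal_pow (norm_nonneg _), ofReal_norm, hκ, Lp.enorm_toLp, eLpNorm_two_sq]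
    simp
  calc ∑ i ∈ s, ‖∫ y, k x y * b i y ∂μ‖ₑ ^ 2
      = ENNReal.ofReal (∑ i ∈ s, ‖inner ℂ (b i) κ‖ ^ 2) := by
        rw [ENNReal.ofReal_sum_of_nonneg (fun _ _ => by positivity)]
        refine Finset.sum_congr rfl fun i _ => ?_
        rw [ENNReal.ofReal_pow (norm_nonneg _), ofReal_norm, e, ← inner_conj_symm,
          RCLike.enorm_conj]
    _ ≤ ENNReal.ofReal (‖κ‖ ^ 2) := ENNReal.ofReal_le_ofReal hB
    _ = _ := hκn

end HilbertSchmidt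

/-! ### Spherical coordinates -/

lemma lintegral_comp_sq_add_sq {f : ℝ → ℝ≥0∞} (hf : Measurable f) :
    ∫⁻ p : ℝ × ℝ, f (p.1 ^ 2 + p.2 ^ 2)
      = ENNReal.ofReal (2 * Real.pi) * ∫⁻ ρ in Ioi (0 : ℝ), ENNReal.ofReal ρ * f (ρ ^ 2) := by
  rw [← lintegral_comp_polarCoord_symm]
  simp only [polarCoord_target, polarCoord_symm_apply, smul_eq_mul]
  have e : ∀ p : ℝ × ℝ, (p.1 * Real.cos p.2) ^ 2 + (p.1 * Real.sin p.2) ^ 2 = p.1 ^ 2 := fun p => by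
    rw [mul_pow, mul_pow, ← mul_add, Real.cos_sq_add_sin_sq, mul_one]
  simp_rw [e]
  rw [Measure.volume_eq_prod, ← Measure.prod_restrict, lintegral_prod _ (by fun_prop)]
  simp only [lintegral_const, Measure.restrict_apply, MeasurableSet.univ, univ_inter,
    Real.volume_Ioo, sub_neg_eq_add, ← two_mul]
  rw [lintegral_mul_const _ (by fun_prop), mul_comm]

lemma lintegral_sin_mul_comp_cos (f : ℝ → ℝ≥0∞) :
    ∫⁻ θ in Ioo (0 : ℝ) Real.pi, ENNReal.ofReal (Real.sin θ) * f (Real.cos θ)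
      = ∫⁻ t in Ioc (-1 : ℝ) 1, f t := by
  rw [restrict_Ioo_eq_restrict_Icc, restrict_Ioc_eq_restrict_Icc, ← Real.bijOn_cos.image_eq,
    lintegral_image_eq_lintegral_abs_deriv_mul measurableSet_Icc
      (fun x _ => (Real.hasDerivAt_cos x).hasDerivWithinAt) Real.bijOn_cos.injOn]
  refine setLIntegral_congr_fun measurableSet_Icc fun θ hθ => ?_
  rw [abs_neg, abs_of_nonneg (Real.sin_nonneg_of_mem_Icc hθ)]

/-- Planar polar coordinates in the half plane ρ > 0: ρ dz dρ = R² sin θ dR dθ, followed by t = cos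
θ. -/
lemma lintegral_half_plane {Φ : ℝ × ℝ → ℝ≥0∞} (hΦ : Measurable Φ) :
    ∫⁻ z : ℝ, ∫⁻ ρ in Ioi (0 : ℝ), ENNReal.ofReal ρ
        * Φ (√(z ^ 2 + ρ ^ 2), z / √(z ^ 2 + ρ ^ 2))
      = ∫⁻ R in Ioi (0 : ℝ), ENNReal.ofReal (R ^ 2) * ∫⁻ t in Ioc (-1 : ℝ) 1, Φ (R, t) := by
  -- Extension by zero to the whole plane, where the polar-coordinate formula applies; the indicator
  -- then restricts θ to (0, π).
  set F : ℝ × ℝ → ℝ≥0∞ := fun p => (Ioi (0 : ℝ)).indicator (fun ρ => ENNReal.ofReal ρ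
        * Φ (√(p.1 ^ 2 + ρ ^ 2), p.1 / √(p.1 ^ 2 + ρ ^ 2))) p.2 with hF
  have hFm : Measurable F := by
    have : F = (Prod.snd ⁻¹' Ioi (0 : ℝ)).indicator (fun p : ℝ × ℝ => ENNReal.ofReal p.2
        * Φ (√(p.1 ^ 2 + p.2 ^ 2), p.1 / √(p.1 ^ 2 + p.2 ^ 2))) := by
      ext p; simp [hF, indicator]
    rw [this]
    refine Measurable.indicator ?_ (measurable_snd measurableSet_Ioi)
    fun_prop
  have h1 : ∫⁻ z : ℝ, ∫⁻ ρ in Ioi (0 : ℝ), ENNReal.ofReal ρ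
        * Φ (√(z ^ 2 + ρ ^ 2), z / √(z ^ 2 + ρ ^ 2)) = ∫⁻ p, F p := by
    rw [Measure.volume_eq_prod, lintegral_prod _ hFm.aemeasurable]
    refine lintegral_congr fun z => ?_
    rw [← lintegral_indicator measurableSet_Ioi]
  rw [h1, ← lintegral_comp_polarCoord_symm]
  simp only [polarCoord_target, polarCoord_symm_apply, smul_eq_mul]
  rw [Measure.volume_eq_prod, ← Measure.prod_restrict, lintegral_prod _ (by fun_prop)]
  refine setLIntegral_congr_fun measurableSet_Ioi fun R hR => ?_
  have hR : (0 : ℝ) < R := hR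
  simp only
  have hp := Real.pi_pos
  have e1 : ∀ θ ∈ Ioo (-Real.pi) Real.pi,
      ENNReal.ofReal R * F (R * Real.cos θ, R * Real.sin θ)
      = (Ioo (0 : ℝ) Real.pi).indicator (fun θ => ENNReal.ofReal (R ^ 2)
        * (ENNReal.ofReal (Real.sin θ) * Φ (R, Real.cos θ))) θ := by
    intro θ hθ
    have hsq : (R * Real.cos θ) ^ 2 + (R * Real.sin θ) ^ 2 = R ^ 2 := by
      rw [mul_pow, mul_pow, ← mul_add, Real.cos_sq_add_sin_sq, mul_one]
    by_cases h0 : 0 < θ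
    · have hs : 0 < Real.sin θ := Real.sin_pos_of_pos_of_lt_pi h0 hθ.2
      rw [indicator_of_mem (show θ ∈ Ioo 0 Real.pi from ⟨h0, hθ.2⟩)]
      simp only [hF]
      rw [indicator_of_mem (show R * Real.sin θ ∈ Ioi (0 : ℝ) from mul_pos hR hs), hsq,
        Real.sqrt_sq hR.le, mul_div_cancel_left₀ _ hR.ne', ENNReal.ofReal_mul hR.le, sq,
        ENNReal.ofReal_mul hR.le]
      ring
    · rw [indicator_of_notMem (fun h => h0 h.1)]
      simp only [hF]
      rw [indicator_of_notMem, mul_zero]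
      have : Real.sin θ ≤ 0 := Real.sin_nonpos_of_nonpos_of_neg_pi_le (not_lt.mp h0) hθ.1.le
      simp only [mem_Ioi, not_lt]
      nlinarith
  rw [setLIntegral_congr_fun measurableSet_Ioo e1, ← lintegral_indicator measurableSet_Ioo,
    indicator_indicator, inter_eq_right.mpr (Ioo_subset_Ioo (by linarith) le_rfl),
    lintegral_indicator measurableSet_Ioo, lintegral_const_mul _ (by fun_prop),
    lintegral_sin_mul_comp_cos fun t => Φ (R, t)]

/-- Splitting off the first coordinate. -/
def splitE3 : E3 → ℝ × ℝ × ℝ := fun y => (y 0, y 1, y 2)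

lemma measurePreserving_splitE3 : MeasurePreserving splitE3 := by
  have h := ((MeasurePreserving.id (volume : Measure ℝ)).prod
      (volume_preserving_finTwoArrow ℝ)).comp
    ((volume_preserving_piFinSuccAbove (fun _ : Fin 3 => ℝ) 0).comp
      (PiLp.volume_preserving_ofLp (Fin 3)))
  exact h

lemma norm_E3_eq (y : E3) : ‖y‖ = √(y 0 ^ 2 + (y 1 ^ 2 + y 2 ^ 2)) := by
  rw [EuclideanSpace.norm_eq, Fin.sum_univ_three]
  simp [add_assoc]

/-- Cylindrical coordinates about the first axis, then polar coordinates in the half plane. -/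
lemma lintegral_norm_coord {Φ : ℝ × ℝ → ℝ≥0∞} (hΦ : Measurable Φ) :
    ∫⁻ y : E3, Φ (‖y‖, y 0 / ‖y‖)
      = ENNReal.ofReal (2 * Real.pi)
        * ∫⁻ R in Ioi (0 : ℝ), ENNReal.ofReal (R ^ 2) * ∫⁻ t in Ioc (-1 : ℝ) 1, Φ (R, t) := by
  rw [← lintegral_half_plane hΦ]
  have h := measurePreserving_splitE3.lintegral_comp
    (f := fun p : ℝ × ℝ × ℝ => Φ (√(p.1 ^ 2 + (p.2.1 ^ 2 + p.2.2 ^ 2)),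
      p.1 / √(p.1 ^ 2 + (p.2.1 ^ 2 + p.2.2 ^ 2)))) (by fun_prop)
  simp only [splitE3, ← norm_E3_eq] at h
  rw [h, Measure.volume_eq_prod, lintegral_prod _ (by fun_prop), ← lintegral_const_mul]
  · refine lintegral_congr fun z => ?_
    rw [lintegral_comp_sq_add_sq (f := fun s => Φ (√(z ^ 2 + s), z / √(z ^ 2 + s))) (by fun_prop)]
  · refine Measurable.lintegral_prod_right' (f := fun p : ℝ × ℝ => ENNReal.ofReal p.2
        * Φ (√(p.1 ^ 2 + p.2 ^ 2), p.1 / √(p.1 ^ 2 + p.2 ^ 2))) ?_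
    fun_prop

/-- A reflection carrying the first axis to the direction of x preserves volume and norms, and turns
the cosine of the angle into `y 0 / ‖y‖`. -/
lemma lintegral_norm_angle {Φ : ℝ × ℝ → ℝ≥0∞} (hΦ : Measurable Φ) {x : E3} (hx : x ≠ 0) :
    ∫⁻ y : E3, Φ (‖y‖, inner ℝ x y / (‖x‖ * ‖y‖))
      = ENNReal.ofReal (2 * Real.pi)
        * ∫⁻ R in Ioi (0 : ℝ), ENNReal.ofReal (R ^ 2) * ∫⁻ t in Ioc (-1 : ℝ) 1, Φ (R, t) := by
  rw [← lintegral_norm_coord hΦ]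
  set e : E3 := ‖x‖ • EuclideanSpace.single 0 (1 : ℝ) with he
  have hn : ‖e‖ = ‖x‖ := by simp [he, norm_smul]
  set L := Submodule.reflection (ℝ ∙ (e - x))ᗮ with hL
  have hLe : L e = x := Submodule.reflection_sub hn
  have hmp : MeasurePreserving L := L.measurePreserving
  rw [← hmp.lintegral_comp_emb L.toHomeomorph.measurableEmbedding]
  refine lintegral_congr fun y => ?_
  have hxn : ‖x‖ ≠ 0 := norm_ne_zero_iff.mpr hx
  have hin : inner ℝ x (L y) = ‖x‖ * y 0 := by
    rw [← hLe, LinearIsometryEquiv.inner_map_map, he, real_inner_smul_left,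
      LinearIsometryEquiv.norm_map, ← he, hn]
    simp [EuclideanSpace.inner_single_left]
  rw [LinearIsometryEquiv.norm_map, hin, mul_div_mul_left _ _ hxn]

lemma lintegral_norm {f : ℝ → ℝ≥0∞} (hf : Measurable f) :
    ∫⁻ x : E3, f ‖x‖
      = ENNReal.ofReal (4 * Real.pi) * ∫⁻ R in Ioi (0 : ℝ), ENNReal.ofReal (R ^ 2) * f R := by
  rw [lintegral_norm_coord (Φ := fun p => f p.1) (by fun_prop)]
  simp only [lintegral_const, Measure.restrict_apply, MeasurableSet.univ, univ_inter,
    Real.volume_Ioc, sub_neg_eq_add, ← mul_assoc]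
  rw [lintegral_mul_const _ (by fun_prop), mul_comm _ (ENNReal.ofReal (1 + 1)), ← mul_assoc,
    ← ENNReal.ofReal_mul (by positivity)]
  congr 2
  ring

/-! ### The potential norm in radial variables and the Legendre coefficients -/

lemma measurable_weight (ε : ℝ) : Measurable (weight ε) := by unfold weight; fun_prop

lemma weight_pos (ε : ℝ) {R : ℝ} (hR : 0 < R) : 0 < weight ε R := by
  unfold weight; positivity

/-- For x ≠ 0 the inner integral depends on ‖x‖ alone, so 8π² is 2π from the angle about x times 4π
from the direction of x. -/
lemma potentialNorm_sq {w : ℝ → ℝ} (hw : Measurable w) {α : ℝ} {V : ℝ → ℝ → ℝ → ℝ}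
    (hV : Measurable fun p : ℝ × ℝ × ℝ => V p.1 p.2.1 p.2.2) :
    potentialNorm w α V ^ 2 = ENNReal.ofReal (8 * Real.pi ^ 2)
      * ∫⁻ R in Ioi (0 : ℝ), ENNReal.ofReal (R ^ 2) * (ENNReal.ofReal (w R * Real.exp (2 * α * R))
        * ∫⁻ R' in Ioi (0 : ℝ), ENNReal.ofReal (R' ^ 2)
          * (ENNReal.ofReal (w R' * Real.exp (2 * α * R'))
            * ∫⁻ t in Ioc (-1 : ℝ) 1, ENNReal.ofReal (V R R' t ^ 2))) := by
  have hin : ∀ x : E3, x ≠ 0 → ∫⁻ y : E3, ENNReal.ofReal (w ‖y‖ * Real.exp (2 * α * ‖y‖)) *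
      ENNReal.ofReal (potentialKernel V x y ^ 2) = ENNReal.ofReal (2 * Real.pi)
        * ∫⁻ R' in Ioi (0 : ℝ), ENNReal.ofReal (R' ^ 2)
          * (ENNReal.ofReal (w R' * Real.exp (2 * α * R'))
            * ∫⁻ t in Ioc (-1 : ℝ) 1, ENNReal.ofReal (V ‖x‖ R' t ^ 2)) := by
    intro x hx
    have hVx : Measurable fun p : ℝ × ℝ => V ‖x‖ p.1 p.2 :=
      hV.comp (measurable_const.prodMk measurable_id)
    rw [show (∫⁻ y : E3, ENNReal.ofReal (w ‖y‖ * Real.exp (2 * α * ‖y‖)) *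
      ENNReal.ofReal (potentialKernel V x y ^ 2)) = _ from
        lintegral_norm_angle (Φ := fun p => ENNReal.ofReal (w p.1 * Real.exp (2 * α * p.1))
        * ENNReal.ofReal (V ‖x‖ p.1 p.2 ^ 2)) (by fun_prop) hx]
    congr 1
    refine lintegral_congr fun R' => ?_
    simp only
    rw [lintegral_const_mul]
    have : Measurable fun t => V ‖x‖ R' t :=
      hV.comp (measurable_const.prodMk (measurable_const.prodMk measurable_id))
    fun_prop
  have hne : ∀ᵐ x : E3, x ≠ 0 := by
    simp [ae_iff]
  have hmeas : Measurable fun R : ℝ => ∫⁻ R' in Ioi (0 : ℝ), ENNReal.ofReal (R' ^ 2)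
          * (ENNReal.ofReal (w R' * Real.exp (2 * α * R'))
            * ∫⁻ t in Ioc (-1 : ℝ) 1, ENNReal.ofReal (V R R' t ^ 2)) := by
    have h1 : Measurable fun q : ℝ × ℝ => ∫⁻ t in Ioc (-1 : ℝ) 1,
        ENNReal.ofReal (V q.1 q.2 t ^ 2) := by
      refine Measurable.lintegral_prod_right' (f := fun q : (ℝ × ℝ) × ℝ =>
        ENNReal.ofReal (V q.1.1 q.1.2 q.2 ^ 2)) ?_
      have : Measurable fun q : (ℝ × ℝ) × ℝ => V q.1.1 q.1.2 q.2 :=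
        hV.comp (f := fun q : (ℝ × ℝ) × ℝ => (q.1.1, q.1.2, q.2)) (by fun_prop)
      fun_prop
    refine Measurable.lintegral_prod_right' (f := fun q : ℝ × ℝ => ENNReal.ofReal (q.2 ^ 2)
          * (ENNReal.ofReal (w q.2 * Real.exp (2 * α * q.2))
            * ∫⁻ t in Ioc (-1 : ℝ) 1, ENNReal.ofReal (V q.1 q.2 t ^ 2))) ?_
    fun_prop
  rw [potentialNorm, ← ENNReal.rpow_natCast, ← ENNReal.rpow_mul]
  rw [show (1 / 2 : ℝ) * ((2 : ℕ) : ℝ) = 1 by norm_num, ENNReal.rpow_one]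
  rw [lintegral_congr_ae (g := fun x : E3 => (fun R => ENNReal.ofReal (2 * Real.pi)
    * (ENNReal.ofReal (w R * Real.exp (2 * α * R)) * ∫⁻ R' in Ioi (0 : ℝ), ENNReal.ofReal (R' ^ 2)
          * (ENNReal.ofReal (w R' * Real.exp (2 * α * R'))
            * ∫⁻ t in Ioc (-1 : ℝ) 1, ENNReal.ofReal (V R R' t ^ 2)))) ‖x‖)]
  · rw [lintegral_norm (f := fun R => ENNReal.ofReal (2 * Real.pi)
      * (ENNReal.ofReal (w R * Real.exp (2 * α * R)) * ∫⁻ R' in Ioi (0 : ℝ), ENNReal.ofReal (R' ^ 2)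
          * (ENNReal.ofReal (w R' * Real.exp (2 * α * R'))
            * ∫⁻ t in Ioc (-1 : ℝ) 1, ENNReal.ofReal (V R R' t ^ 2)))) (by fun_prop)]
    rw [← lintegral_const_mul _ (by fun_prop), ← lintegral_const_mul _ (by fun_prop)]
    refine lintegral_congr fun R => ?_
    rw [show 8 * Real.pi ^ 2 = (4 * Real.pi) * (2 * Real.pi) by ring,
      ENNReal.ofReal_mul (p := 4 * Real.pi) (by positivity)]
    ring
  · filter_upwards [hne] with x hx
    rw [hin x hx]
    ring

lemma measurable_partialPotential {V : ℝ → ℝ → ℝ → ℝ}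
    (hV : Measurable fun p : ℝ × ℝ × ℝ => V p.1 p.2.1 p.2.2) (l : ℕ) :
    Measurable fun p : ℝ × ℝ => partialPotential V l p.1 p.2 := by
  unfold partialPotential
  simp_rw [intervalIntegral.integral_of_le (show (-1 : ℝ) ≤ 1 by norm_num)]
  have : Measurable fun q : (ℝ × ℝ) × ℝ => V q.1.1 q.1.2 q.2 :=
    hV.comp (f := fun q : (ℝ × ℝ) × ℝ => (q.1.1, q.1.2, q.2)) (by fun_prop)
  have hl := (legendre l).continuous.measurable
  have h1 : StronglyMeasurable fun q : (ℝ × ℝ) × ℝ => V q.1.1 q.1.2 q.2 * (legendre l).eval q.2 :=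
    (this.mul (hl.comp measurable_snd)).stronglyMeasurable
  have h2 := (h1.integral_prod_right' (ν := volume.restrict (Ioc (-1 : ℝ) 1))).measurable
  exact ((measurable_const.mul measurable_fst).mul measurable_snd).mul h2

lemma lintegral_legendre_sq (l : ℕ) :
    ∫⁻ t in Ioc (-1 : ℝ) 1, ‖(legendre l).eval t‖ₑ ^ 2 = ENNReal.ofReal (2 / (2 * l + 1)) := by
  rw [← integral_legendre_sq, intervalIntegral.integral_of_le (by norm_num),
    ofReal_integral_eq_lintegral_ofReal]
  · refine lintegral_congr fun t => ?_
    rw [← ofReal_norm, ← ENNReal.ofReal_pow (norm_nonneg _), Real.norm_eq_abs, sq_abs]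
  · exact ((legendre l).continuous.pow 2).integrableOn_Ioc
  · exact Eventually.of_forall fun t => sq_nonneg _

/-- Cauchy-Schwarz in t against P_l; the constant is (2π)² · 2/(2l+1). -/
lemma enorm_partialPotential_sq_le {V : ℝ → ℝ → ℝ → ℝ}
    (hV : Measurable fun p : ℝ × ℝ × ℝ => V p.1 p.2.1 p.2.2) (l : ℕ) (R R' : ℝ) :
    ‖partialPotential V l R R'‖ₑ ^ 2 ≤ ENNReal.ofReal (8 * Real.pi ^ 2 / (2 * l + 1))
      * (ENNReal.ofReal (R ^ 2) * (ENNReal.ofReal (R' ^ 2)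
        * ∫⁻ t in Ioc (-1 : ℝ) 1, ENNReal.ofReal (V R R' t ^ 2))) := by
  have hsq : ∀ a : ℝ, ‖a‖ₑ ^ 2 = ENNReal.ofReal (a ^ 2) := fun a => by
    rw [← ofReal_norm, ← ENNReal.ofReal_pow (norm_nonneg _), Real.norm_eq_abs, sq_abs]
  have hVm : Measurable fun t => V R R' t :=
    hV.comp (measurable_const.prodMk (measurable_const.prodMk measurable_id))
  rw [partialPotential, enorm_mul, enorm_mul, enorm_mul, mul_pow, mul_pow, mul_pow, hsq, hsq R,
    hsq R', intervalIntegral.integral_of_le (by norm_num)]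
  have h1 : ‖∫ t in Ioc (-1 : ℝ) 1, V R R' t * (legendre l).eval t‖ₑ ^ 2
      ≤ (∫⁻ t in Ioc (-1 : ℝ) 1, ENNReal.ofReal (V R R' t ^ 2))
          * ENNReal.ofReal (2 / (2 * l + 1)) := by
    refine (ENNReal.pow_le_pow_left (enorm_integral_le_lintegral_enorm _)).trans ?_
    simp_rw [enorm_mul]
    refine (sq_lintegral_mul_le hVm.enorm.aemeasurable
      (legendre l).continuous.measurable.enorm.aemeasurable).trans (le_of_eq ?_)
    rw [lintegral_legendre_sq]
    simp_rw [hsq]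
  refine (mul_le_mul_right h1 _).trans (le_of_eq ?_)
  rw [show 8 * Real.pi ^ 2 / (2 * (l : ℝ) + 1) = (2 * Real.pi) ^ 2 * (2 / (2 * l + 1)) by ring,
    ENNReal.ofReal_mul (p := (2 * Real.pi) ^ 2) (by positivity)]
  ring

/-! ### The Lippmann-Schwinger equation in `L²(0, ∞)` -/

/-- Lebesgue measure on the half line. -/
abbrev halfLine : Measure ℝ := volume.restrict (Ioi (0 : ℝ))

lemma ae_halfLine_pos : ∀ᵐ R ∂halfLine, 0 < R := ae_restrict_mem measurableSet_Ioi

/-- The density `w(R) e^{2αR}`. -/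
def density (ε α R : ℝ) : ℝ := weight ε R * Real.exp (2 * α * R)

/-- The square root of the density. -/
def rootDensity (ε α R : ℝ) : ℝ := √(density ε α R)

lemma measurable_density (ε α : ℝ) : Measurable (density ε α) := by
  have := measurable_weight ε
  unfold density; fun_prop

lemma measurable_rootDensity (ε α : ℝ) : Measurable (rootDensity ε α) :=
  (measurable_density ε α).sqrt

lemma density_pos (ε α : ℝ) {R : ℝ} (hR : 0 < R) : 0 < density ε α R :=
  mul_pos (weight_pos ε hR) (Real.exp_pos _)

lemma rootDensity_pos (ε α : ℝ) {R : ℝ} (hR : 0 < R) : 0 < rootDensity ε α R :=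
  Real.sqrt_pos.mpr (density_pos ε α hR)

lemma rootDensity_sq (ε α : ℝ) {R : ℝ} (hR : 0 < R) : rootDensity ε α R ^ 2 = density ε α R :=
  Real.sq_sqrt (density_pos ε α hR).le

/-- Of the shape of the weight, the bounds on the Green kernel and on the free wave need only this
inequality besides positivity. -/
lemma le_weight {ε : ℝ} (hε : 0 < ε) {R : ℝ} (hR : 0 < R) : R ≤ weight ε R := by
  have h1 : R ^ ε ≤ (1 + R) ^ (1 + 2 * ε) := by
    calc R ^ ε ≤ (1 + R) ^ ε := Real.rpow_le_rpow hR.le (by linarith) hε.le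
      _ ≤ (1 + R) ^ (1 + 2 * ε) := Real.rpow_le_rpow_of_exponent_le (by linarith) (by linarith)
  calc R = R ^ (1 - ε) * R ^ ε := by rw [← Real.rpow_add hR]; simp
    _ ≤ weight ε R := mul_le_mul_of_nonneg_left h1 (by positivity)

lemma div_density_le {ε : ℝ} (hε : 0 < ε) (α : ℝ) {R : ℝ} (hR : 0 < R) :
    R / density ε α R ≤ Real.exp (-(2 * α) * R) := by
  rw [div_le_iff₀ (density_pos ε α hR), density]
  have : Real.exp (-(2 * α) * R) * (weight ε R * Real.exp (2 * α * R)) = weight ε R := by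
    rw [mul_left_comm, ← Real.exp_add]; simp
  rw [this]
  exact le_weight hε hR

lemma enorm_sq_eq_ofReal {E : Type*} [NormedAddCommGroup E] (a : E) :
    ‖a‖ₑ ^ 2 = ENNReal.ofReal (‖a‖ ^ 2) := by
  rw [← ofReal_norm, ← ENNReal.ofReal_pow (norm_nonneg _)]

/-- Multiplication by √ρ identifies X with L²(0,∞). As ρ > 0 on the half line, the two measures have
the same null sets, so measurability passes both ways. -/
lemma memX_iff (ε α : ℝ) (v : ℝ → ℂ) :
    MemX (weight ε) α v ↔ MemLp (fun R => (rootDensity ε α R : ℂ) * v R) 2 halfLine := by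
  have hdm : Measurable fun R => ENNReal.ofReal (density ε α R) :=
    (measurable_density ε α).ennreal_ofReal
  have hdef : weightedMeasure (weight ε) α
      = halfLine.withDensity fun R => ENNReal.ofReal (density ε α R) := rfl
  have hac : halfLine.withDensity (fun R => ENNReal.ofReal (density ε α R)) ≪ halfLine :=
    withDensity_absolutelyContinuous _ _
  have hac' : halfLine ≪ halfLine.withDensity fun R => ENNReal.ofReal (density ε α R) := by
    refine withDensity_absolutelyContinuous' hdm.aemeasurable ?_
    filter_upwards [ae_halfLine_pos] with R hR
    simpa using density_pos ε α hR
  have hpm : AEStronglyMeasurable (fun R => (rootDensity ε α R : ℂ)) halfLine :=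
    (Complex.measurable_ofReal.comp (measurable_rootDensity ε α)).aestronglyMeasurable
  have hmeas : AEStronglyMeasurable v (weightedMeasure (weight ε) α)
      ↔ AEStronglyMeasurable (fun R => (rootDensity ε α R : ℂ) * v R) halfLine := by
    rw [hdef]
    constructor
    · intro h
      exact hpm.mul (h.mono_ac hac')
    · intro h
      refine AEStronglyMeasurable.mono_ac hac ?_
      refine ((((Complex.measurable_ofReal.comp
        (measurable_rootDensity ε α)).inv).aestronglyMeasurable).mul h).congr ?_
      filter_upwards [ae_halfLine_pos] with R hR
      have : (rootDensity ε α R : ℂ) ≠ 0 := by exact_mod_cast (rootDensity_pos ε α hR).ne'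
      simp [this]
  have hint : ∫⁻ R, ‖v R‖ₑ ^ 2 ∂weightedMeasure (weight ε) α
      = ∫⁻ R, ‖(rootDensity ε α R : ℂ) * v R‖ₑ ^ 2 ∂halfLine := by
    rw [hdef, lintegral_withDensity_eq_lintegral_mul_non_measurable _ hdm
      (Eventually.of_forall fun _ => ENNReal.ofReal_lt_top)]
    refine lintegral_congr_ae ?_
    filter_upwards [ae_halfLine_pos] with R hR
    rw [Pi.mul_apply, enorm_mul, mul_pow, enorm_sq_eq_ofReal (rootDensity ε α R : ℂ),
      Complex.norm_real, Real.norm_eq_abs, sq_abs, rootDensity_sq ε α hR]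
  rw [MemX]
  constructor
  · intro h
    have hm := hmeas.mp h.1
    rw [memLp_two_iff hm, ← hint]
    exact (memLp_two_iff h.1).mp h
  · intro h
    have hm := hmeas.mpr h.1
    rw [memLp_two_iff hm, hint]
    exact (memLp_two_iff h.1).mp h

/-- The symmetrised potential kernel. -/
def vKernel (ε α : ℝ) (V : ℝ → ℝ → ℝ → ℝ) (l : ℕ) (R R' : ℝ) : ℂ :=
  ((rootDensity ε α R * partialPotential V l R R' * rootDensity ε α R' : ℝ) : ℂ)

/-- The symmetrised Green kernel. -/
def gKernel (ε α : ℝ) (l : ℕ) (k R R' : ℝ) : ℂ :=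
  green l k R R' / (rootDensity ε α R * rootDensity ε α R')

/-- The symmetrised free solution. -/
def freeWave (ε α : ℝ) (l : ℕ) (k R : ℝ) : ℝ := riccatiJ l (k * R) / rootDensity ε α R

/-! ### Hilbert-Schmidt bounds for the symmetrised kernels -/

section Bounds

variable {ε α : ℝ} {V : ℝ → ℝ → ℝ → ℝ}

lemma measurable_vKernel (hV : Measurable fun p : ℝ × ℝ × ℝ => V p.1 p.2.1 p.2.2) (l : ℕ) :
    Measurable (Function.uncurry (vKernel ε α V l)) := by
  have h1 := measurable_rootDensity ε α
  have h2 := measurable_partialPotential hV l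
  exact Complex.measurable_ofReal.comp
    (((h1.comp measurable_fst).mul h2).mul (h1.comp measurable_snd))

lemma measurable_gKernel (l : ℕ) (k : ℝ) : Measurable (Function.uncurry (gKernel ε α l k)) := by
  have h1 := measurable_rootDensity ε α
  have h2 := measurable_green l k
  exact h2.div ((Complex.measurable_ofReal.comp (h1.comp measurable_fst)).mul
    (Complex.measurable_ofReal.comp (h1.comp measurable_snd)))

/-- The factor (RR')² from V_l² supplies exactly the two radial Jacobians, and the constants 8π²
match, leaving C(V)²/(2l+1). -/
lemma lintegral_vKernel_sq_le (hV : Measurable fun p : ℝ × ℝ × ℝ => V p.1 p.2.1 p.2.2) (l : ℕ) :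
    ∫⁻ p, ‖Function.uncurry (vKernel ε α V l) p‖ₑ ^ 2 ∂halfLine.prod halfLine
      ≤ ENNReal.ofReal (1 / (2 * l + 1)) * potentialNorm (weight ε) α V ^ 2 := by
  rw [lintegral_prod _ ((measurable_vKernel hV l).enorm.pow_const 2).aemeasurable,
    potentialNorm_sq (measurable_weight ε) hV, ← mul_assoc,
    ← ENNReal.ofReal_mul (by positivity), ← lintegral_const_mul' _ _ ENNReal.ofReal_ne_top]
  refine lintegral_mono_ae ?_
  filter_upwards [ae_halfLine_pos] with R hR
  rw [← mul_assoc, ← mul_assoc, ← lintegral_const_mul' _ _ (by finiteness)]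
  refine lintegral_mono_ae ?_
  filter_upwards [ae_halfLine_pos] with R' hR'
  have e : ‖Function.uncurry (vKernel ε α V l) (R, R')‖ₑ ^ 2
      = ENNReal.ofReal (density ε α R) * ENNReal.ofReal (density ε α R')
        * ‖partialPotential V l R R'‖ₑ ^ 2 := by
    simp only [Function.uncurry_apply_pair, vKernel]
    rw [enorm_sq_eq_ofReal, Complex.norm_real, norm_mul, norm_mul, mul_pow, mul_pow,
      ENNReal.ofReal_mul (by positivity), ENNReal.ofReal_mul (by positivity),
      Real.norm_eq_abs (rootDensity ε α R), Real.norm_eq_abs (rootDensity ε α R'), sq_abs, sq_abs,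
      rootDensity_sq ε α hR, rootDensity_sq ε α hR', enorm_sq_eq_ofReal]
    ring
  rw [e]
  refine (mul_le_mul_right (enorm_partialPotential_sq_le hV l R R') _).trans (le_of_eq ?_)
  rw [show 1 / (2 * (l : ℝ) + 1) * (8 * Real.pi ^ 2) = 8 * Real.pi ^ 2 / (2 * l + 1) by ring]
  simp only [density]
  ring

lemma memLp_vKernel (hV : IsNonlocalPotential (weight ε) α V) (l : ℕ) :
    MemLp (Function.uncurry (vKernel ε α V l)) 2 (halfLine.prod halfLine) := by
  rw [memLp_two_iff (measurable_vKernel hV.measurable l).aestronglyMeasurable]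
  refine (lintegral_vKernel_sq_le hV.measurable l).trans_lt ?_
  have := hV.norm_lt_top
  finiteness

lemma eLpNorm_vKernel_le (hV : IsNonlocalPotential (weight ε) α V) (l : ℕ) :
    (eLpNorm (Function.uncurry (vKernel ε α V l)) 2 (halfLine.prod halfLine)).toReal
      ≤ (potentialNorm (weight ε) α V).toReal / √(2 * l + 1) := by
  have h := lintegral_vKernel_sq_le (ε := ε) (α := α) hV.measurable l
  have hfin := hV.norm_lt_top.ne
  rw [← eLpNorm_two_sq] at h
  have h2 := ENNReal.toReal_mono (by finiteness) h
  rw [ENNReal.toReal_mul, ENNReal.toReal_pow, ENNReal.toReal_pow,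
    ENNReal.toReal_ofReal (by positivity)] at h2
  refine (Real.le_sqrt_of_sq_le h2).trans (le_of_eq ?_)
  rw [mul_comm, mul_one_div, Real.sqrt_div (by positivity), Real.sqrt_sq ENNReal.toReal_nonneg]

lemma integrable_exp_neg {a : ℝ} (ha : 0 < a) : Integrable (fun R : ℝ => Real.exp (-a
    * R)) halfLine :=
  integrableOn_exp_mul_Ioi (by linarith) 0

lemma lintegral_exp_neg {a : ℝ} (ha : 0 < a) :
    ∫⁻ R, ENNReal.ofReal (Real.exp (-a * R)) ∂halfLine = ENNReal.ofReal (1 / a) := by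
  rw [← ofReal_integral_eq_lintegral_ofReal (integrable_exp_neg ha)
    (Eventually.of_forall fun _ => (Real.exp_pos _).le), integral_exp_mul_Ioi (by linarith)]
  congr 1
  simp

/-- min(R,R')² ≤ RR' separates the variables, and each factor R/ρ(R) ≤ e^{−2αR} has integral at most
1/(2α). -/
lemma lintegral_gKernel_sq_le (hε : 0 < ε) (hα : 0 < α) (l : ℕ) {k : ℝ} (hk : 0 < k) :
    ∫⁻ p, ‖Function.uncurry (gKernel ε α l k) p‖ₑ ^ 2 ∂halfLine.prod halfLine
      ≤ ENNReal.ofReal (1 / (2 * α)) ^ 2 := by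
  rw [lintegral_prod _ ((measurable_gKernel l k).enorm.pow_const 2).aemeasurable,
      sq (ENNReal.ofReal _),
    ← lintegral_exp_neg (by positivity), ← lintegral_mul_const _ (by fun_prop)]
  refine lintegral_mono_ae ?_
  filter_upwards [ae_halfLine_pos] with R hR
  rw [← lintegral_const_mul _ (by fun_prop)]
  refine lintegral_mono_ae ?_
  filter_upwards [ae_halfLine_pos] with R' hR'
  have hm : 0 < min R R' := lt_min hR hR'
  rw [enorm_sq_eq_ofReal, ← ENNReal.ofReal_mul (Real.exp_pos _).le]
  refine ENNReal.ofReal_le_ofReal ?_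
  simp only [Function.uncurry_apply_pair, gKernel]
  rw [norm_div, norm_mul, Complex.norm_real, Complex.norm_real, div_pow, mul_pow, Real.norm_eq_abs,
    Real.norm_eq_abs, sq_abs, sq_abs, rootDensity_sq ε α hR, rootDensity_sq ε α hR']
  have h1 : ‖green l k R R'‖ ^ 2 ≤ R * R' := by
    calc ‖green l k R R'‖ ^ 2 ≤ min R R' ^ 2 := by
          gcongr; exact norm_green_le l hk hR hR'
      _ = min R R' * min R R' := sq _
      _ ≤ R * R' := mul_le_mul (min_le_left _ _) (min_le_right _ _) hm.le hR.le
  have d1 := density_pos ε α hR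
  have d2 := density_pos ε α hR'
  calc ‖green l k R R'‖ ^ 2 / (density ε α R * density ε α R')
      ≤ R * R' / (density ε α R * density ε α R') := by gcongr
    _ = R / density ε α R * (R' / density ε α R') := by field_simp
    _ ≤ _ := mul_le_mul (div_density_le hε α hR) (div_density_le hε α hR') (by positivity)
        (Real.exp_pos _).le

lemma memLp_gKernel (hε : 0 < ε) (hα : 0 < α) (l : ℕ) {k : ℝ} (hk : 0 < k) :
    MemLp (Function.uncurry (gKernel ε α l k)) 2 (halfLine.prod halfLine) := by
  rw [memLp_two_iff (measurable_gKernel l k).aestronglyMeasurable]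
  exact (lintegral_gKernel_sq_le hε hα l hk).trans_lt (by finiteness)

lemma eLpNorm_gKernel_le (hε : 0 < ε) (hα : 0 < α) (l : ℕ) {k : ℝ} (hk : 0 < k) :
    (eLpNorm (Function.uncurry (gKernel ε α l k)) 2 (halfLine.prod halfLine)).toReal
      ≤ 1 / (2 * α) := by
  have h := lintegral_gKernel_sq_le hε hα l hk
  rw [← eLpNorm_two_sq] at h
  have h' := (ENNReal.pow_le_pow_left_iff two_ne_zero).mp h
  exact ENNReal.toReal_le_of_le_ofReal (by positivity) h'

lemma freeWave_sq_le (hε : 0 < ε) (l : ℕ) (k : ℝ) {R : ℝ} (hR : 0 < R) :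
    freeWave ε α l k R ^ 2
      ≤ k ^ 2 * (Real.exp (-(2 * α) * R) * R * sphBesselJ l (k * R) ^ 2) := by
  have d1 := density_pos ε α hR
  rw [freeWave, div_pow, rootDensity_sq ε α hR, riccatiJ]
  calc (k * R * sphBesselJ l (k * R)) ^ 2 / density ε α R
      = k ^ 2 * (R / density ε α R * R * sphBesselJ l (k * R) ^ 2) := by ring
    _ ≤ _ := by gcongr; exact div_density_le hε α hR

lemma measurable_freeWave (l : ℕ) (k : ℝ) : Measurable (freeWave ε α l k) :=
  ((measurable_riccatiJ l).comp (measurable_const.mul measurable_id)).div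
    (measurable_rootDensity ε α)

lemma integrable_exp_mul_sphBesselJ_sq (hα : 0 < α) (l : ℕ) {k : ℝ} (hk : 0 < k) :
    Integrable (fun R => Real.exp (-(2 * α) * R) * R * sphBesselJ l (k * R) ^ 2) halfLine := by
  have hm := (measurable_sphBesselJ l).comp (measurable_const.mul (measurable_id (α :=
      ℝ)) : Measurable fun R => k * R)
  have h0 : Integrable (fun R => Real.exp (-(2 * α) * R) * R) halfLine :=
    integrableOn_exp_neg_mul_self (by positivity)
  refine h0.mono
    ((Measurable.mul (by fun_prop) (hm.pow_const 2)).aestronglyMeasurable) ?_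
  filter_upwards [ae_halfLine_pos] with R hR
  rw [norm_mul]
  refine mul_le_of_le_one_right (norm_nonneg _) ?_
  rw [norm_pow, Real.norm_eq_abs]
  exact pow_le_one₀ (abs_nonneg _) (abs_sphBesselJ_le_one l (mul_pos hk hR))

lemma integrable_freeWave_sq (hε : 0 < ε) (hα : 0 < α) (l : ℕ) {k : ℝ} (hk : 0 < k) :
    Integrable (fun R => freeWave ε α l k R ^ 2) halfLine := by
  refine ((integrable_exp_mul_sphBesselJ_sq hα l hk).const_mul (k ^ 2)).mono
    ((measurable_freeWave l k).pow_const 2).aestronglyMeasurable ?_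
  filter_upwards [ae_halfLine_pos] with R hR
  rw [Real.norm_of_nonneg (sq_nonneg _)]
  exact (freeWave_sq_le hε l k hR).trans (le_abs_self _)

lemma memLp_freeWave (hε : 0 < ε) (hα : 0 < α) (l : ℕ) {k : ℝ} (hk : 0 < k) :
    MemLp (fun R => (freeWave ε α l k R : ℂ)) 2 halfLine :=
  ((memLp_two_iff_integrable_sq (measurable_freeWave l k).aestronglyMeasurable).mpr
    (integrable_freeWave_sq hε hα l hk)).ofReal

end Bounds

/-! ### Equivalence of the integral equation with an operator equation -/

section Correspondence

variable {ε α k : ℝ} {V : ℝ → ℝ → ℝ → ℝ}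

/-- The operator on `L²(0, ∞)` given by the symmetrised potential kernel. -/
def potentialOp (hV : IsNonlocalPotential (weight ε) α V) (l : ℕ) :
    Lp ℂ 2 halfLine →L[ℂ] Lp ℂ 2 halfLine :=
  hsOp _ (memLp_vKernel hV l)

/-- The operator on `L²(0, ∞)` given by the symmetrised Green kernel. -/
def greenOp (hε : 0 < ε) (hα : 0 < α) (l : ℕ) (hk : 0 < k) :
    Lp ℂ 2 halfLine →L[ℂ] Lp ℂ 2 halfLine :=
  hsOp _ (memLp_gKernel hε hα l hk)

/-- The symmetrised free solution, as an element of `L²(0, ∞)`. -/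
def freeVec (hε : 0 < ε) (hα : 0 < α) (l : ℕ) (hk : 0 < k) : Lp ℂ 2 halfLine :=
  (memLp_freeWave hε hα l hk).toLp _

lemma ofReal_rootDensity_ne_zero (ε α : ℝ) {R : ℝ} (hR : 0 < R) : (rootDensity ε α R : ℂ) ≠ 0 :=
  Complex.ofReal_ne_zero.mpr (rootDensity_pos ε α hR).ne'

/-- The square roots at the intermediate variable cancel, and Fubini collects V_l and G_l into the
kernel L_l. -/
lemma potentialOp_greenOp_ae (hV : IsNonlocalPotential (weight ε) α V) (hε : 0 < ε) (hα : 0 < α)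
    (l : ℕ) (hk : 0 < k) {F : Lp ℂ 2 halfLine} {v : ℝ → ℂ}
    (hF : F =ᵐ[halfLine] fun R => (rootDensity ε α R : ℂ) * v R) :
    potentialOp hV l (greenOp hε hα l hk F) =ᵐ[halfLine]
      fun R => (rootDensity ε α R : ℂ) * ∫ R' in Ioi (0 : ℝ), kernelL V l k R R' * v R' := by
  filter_upwards [coeFn_hsOp (memLp_vKernel hV l) (greenOp hε hα l hk F),
    memLp_two_prod_right (memLp_vKernel hV l)] with R h1 h2
  rw [potentialOp, h1]
  have e1 : ∫ R'', vKernel ε α V l R R'' * greenOp hε hα l hk F R'' ∂halfLine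
      = ∫ R'', ∫ R', vKernel ε α V l R R'' * gKernel ε α l k R'' R' * F R' ∂halfLine ∂halfLine := by
    refine integral_congr_ae ?_
    filter_upwards [coeFn_hsOp (memLp_gKernel hε hα l hk) F] with R'' h
    rw [greenOp, h, ← integral_const_mul]
    simp only [mul_assoc]
  -- Fubini at fixed R, for almost every R: there the row of the potential kernel is in L².
  rw [e1, integral_integral_swap
    (integrable_mul_kernel_mul (memLp_gKernel hε hα l hk) h2 (Lp.memLp F)), ← integral_const_mul]
  refine integral_congr_ae ?_
  filter_upwards [hF, ae_halfLine_pos] with R' hR' hpos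
  rw [integral_mul_const, hR', kernelL, ← mul_assoc, ← mul_assoc]
  congr 1
  rw [← integral_const_mul, ← integral_mul_const]
  refine integral_congr_ae ?_
  filter_upwards [ae_halfLine_pos] with R'' hpos''
  have n1 := ofReal_rootDensity_ne_zero ε α hpos
  have n2 := ofReal_rootDensity_ne_zero ε α hpos''
  simp only [vKernel, gKernel]
  push_cast
  field_simp

lemma potentialOp_freeVec_ae (hV : IsNonlocalPotential (weight ε) α V) (hε : 0 < ε) (hα : 0 < α)
    (l : ℕ) (hk : 0 < k) :
    potentialOp hV l (freeVec hε hα l hk) =ᵐ[halfLine]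
      fun R => (rootDensity ε α R : ℂ) * (freeTerm V l k R : ℂ) := by
  filter_upwards [coeFn_hsOp (memLp_vKernel hV l) (freeVec hε hα l hk)] with R h1
  rw [potentialOp, h1, freeTerm, ← integral_complex_ofReal, ← integral_const_mul]
  refine integral_congr_ae ?_
  filter_upwards [MemLp.coeFn_toLp (memLp_freeWave hε hα l hk), ae_halfLine_pos] with R' h2 hpos
  have n1 := ofReal_rootDensity_ne_zero ε α hpos
  rw [freeVec, h2]
  simp only [vKernel, freeWave, riccatiJ]
  push_cast
  field_simp

/-- φ carries 1/√ρ and F carries √ρ, so the pairing is unweighted; the factor k is why T has the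
prefactor −g/k below. -/
lemma inner_freeVec (hε : 0 < ε) (hα : 0 < α) (l : ℕ) (hk : 0 < k) {F : Lp ℂ 2 halfLine} {v : ℝ → ℂ}
    (hF : F =ᵐ[halfLine] fun R => (rootDensity ε α R : ℂ) * v R) :
    inner ℂ (freeVec hε hα l hk) F
      = k * ∫ R in Ioi (0 : ℝ), ((R * sphBesselJ l (k * R) : ℝ) : ℂ) * v R := by
  rw [L2.inner_def, ← integral_const_mul]
  refine integral_congr_ae ?_
  filter_upwards [MemLp.coeFn_toLp (memLp_freeWave hε hα l hk), hF, ae_halfLine_pos]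
    with R h2 h3 hpos
  have n1 := ofReal_rootDensity_ne_zero ε α hpos
  rw [freeVec, h2, h3, RCLike.inner_apply, Complex.conj_ofReal]
  simp only [freeWave, riccatiJ]
  push_cast
  field_simp

/-- The integral equation as an equation in `L²(0, ∞)`. -/
lemma isLSSolution_iff (hV : IsNonlocalPotential (weight ε) α V) (hε : 0 < ε) (hα : 0 < α)
    (l : ℕ) (hk : 0 < k) (g : ℂ) {F : Lp ℂ 2 halfLine} {v : ℝ → ℂ}
    (hF : F =ᵐ[halfLine] fun R => (rootDensity ε α R : ℂ) * v R) :
    IsLSSolution (weight ε) α V l k g v ↔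
      F - g • potentialOp hV l (greenOp hε hα l hk F)
        = potentialOp hV l (freeVec hε hα l hk) := by
  have hX : MemX (weight ε) α v := (memX_iff ε α v).mpr ((memLp_congr_ae hF).mp (Lp.memLp F))
  have h1 := potentialOp_greenOp_ae hV hε hα l hk hF
  have h2 := potentialOp_freeVec_ae hV hε hα l hk
  rw [IsLSSolution, and_iff_right hX, sub_eq_iff_eq_add, Lp.ext_iff]
  constructor
  · intro h
    filter_upwards [h, h1, h2, hF, Lp.coeFn_add (potentialOp hV l (freeVec hε hα l hk))
      (g • potentialOp hV l (greenOp hε hα l hk F)),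
      Lp.coeFn_smul g (potentialOp hV l (greenOp hε hα l hk F))] with R a1 a2 a3 a4 a5 a6
    rw [a4, a5, Pi.add_apply, a6, Pi.smul_apply, a2, a3, a1, smul_eq_mul]
    ring
  · intro h
    filter_upwards [h, h1, h2, hF, Lp.coeFn_add (potentialOp hV l (freeVec hε hα l hk))
      (g • potentialOp hV l (greenOp hε hα l hk F)),
      Lp.coeFn_smul g (potentialOp hV l (greenOp hε hα l hk F)), ae_halfLine_pos]
      with R a1 a2 a3 a4 a5 a6 hpos
    rw [a4, a5, Pi.add_apply, a6, Pi.smul_apply, a2, a3, smul_eq_mul] at a1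
    refine mul_left_cancel₀ (ofReal_rootDensity_ne_zero ε α hpos) ?_
    rw [a1]
    ring

lemma exists_Lp_of_memX {v : ℝ → ℂ} (hv : MemX (weight ε) α v) :
    ∃ F : Lp ℂ 2 halfLine, F =ᵐ[halfLine] fun R => (rootDensity ε α R : ℂ) * v R :=
  ⟨((memX_iff ε α v).mp hv).toLp _, MemLp.coeFn_toLp _⟩

lemma ae_eq_mul_div_rootDensity (ε α : ℝ) (F : Lp ℂ 2 halfLine) :
    F =ᵐ[halfLine] fun R => (rootDensity ε α R : ℂ) * (F R / rootDensity ε α R) := by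
  filter_upwards [ae_halfLine_pos] with R hpos
  rw [mul_div_cancel₀ _ (ofReal_rootDensity_ne_zero ε α hpos)]

lemma isPartialAmplitude_iff (hV : IsNonlocalPotential (weight ε) α V) (hε : 0 < ε) (hα : 0 < α)
    (l : ℕ) (hk : 0 < k) (g T : ℂ) :
    IsPartialAmplitude (weight ε) α V l k g T ↔
      ∃ F : Lp ℂ 2 halfLine, F - g • potentialOp hV l (greenOp hε hα l hk F)
        = potentialOp hV l (freeVec hε hα l hk) ∧ T = -g / k * inner ℂ (freeVec hε hα l hk) F := by
  have hk0 : (k : ℂ) ≠ 0 := Complex.ofReal_ne_zero.mpr hk.ne'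
  constructor
  · rintro ⟨v, hv, rfl⟩
    obtain ⟨F, hF⟩ := exists_Lp_of_memX hv.1
    refine ⟨F, (isLSSolution_iff hV hε hα l hk g hF).mp hv, ?_⟩
    rw [inner_freeVec hε hα l hk hF, ← mul_assoc, div_mul_cancel₀ _ hk0]
  · rintro ⟨F, hF, rfl⟩
    have hF' := ae_eq_mul_div_rootDensity ε α F
    refine ⟨_, (isLSSolution_iff hV hε hα l hk g hF').mpr hF, ?_⟩
    rw [inner_freeVec hε hα l hk hF', ← mul_assoc, div_mul_cancel₀ _ hk0]

lemma uniquelySolvable_of_existsUnique (hV : IsNonlocalPotential (weight ε) α V) (hε : 0 < ε)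
    (hα : 0 < α) (l : ℕ) (hk : 0 < k) (g : ℂ)
    (h : ∃! F : Lp ℂ 2 halfLine, F - g • potentialOp hV l (greenOp hε hα l hk F)
      = potentialOp hV l (freeVec hε hα l hk)) :
    UniquelySolvable (weight ε) α V l k g := by
  obtain ⟨F, hF, huniq⟩ := h
  have hF' := ae_eq_mul_div_rootDensity ε α F
  refine ⟨_, (isLSSolution_iff hV hε hα l hk g hF').mpr hF, fun v' hv' => ?_⟩
  obtain ⟨F₁, hF₁⟩ := exists_Lp_of_memX hv'.1
  have := huniq F₁ ((isLSSolution_iff hV hε hα l hk g hF₁).mp hv')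
  subst this
  filter_upwards [hF₁, ae_halfLine_pos] with R h1 hpos
  rw [h1, mul_div_cancel_left₀ _ (ofReal_rootDensity_ne_zero ε α hpos)]

lemma amplitudeDefined_of_uniquelySolvable {w : ℝ → ℝ} {l : ℕ} {g : ℂ}
    (h : UniquelySolvable w α V l k g) : AmplitudeDefined w α V l k g := by
  obtain ⟨v, hv, huniq⟩ := h
  refine ⟨_, ⟨v, hv, rfl⟩, ?_⟩
  rintro T ⟨v', hv', rfl⟩
  congr 1
  refine integral_congr_ae ?_
  filter_upwards [huniq v' hv'] with R hR
  rw [hR]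

end Correspondence

/-! ### Self-adjointness, norm bounds and solvability -/

section Operators

variable {ε α k : ℝ} {V : ℝ → ℝ → ℝ → ℝ}

lemma partialPotential_comm (hV : IsNonlocalPotential (weight ε) α V) (l : ℕ) {R R' : ℝ}
    (hR : 0 < R) (hR' : 0 < R') : partialPotential V l R R' = partialPotential V l R' R := by
  have : ∫ t in (-1 : ℝ)..1, V R R' t * (legendre l).eval t
      = ∫ t in (-1 : ℝ)..1, V R' R t * (legendre l).eval t := by
    refine intervalIntegral.integral_congr fun t ht => ?_
    rw [uIcc_of_le (by norm_num)] at ht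
    simp only [hV.symm R R' t hR hR' ht]
  rw [partialPotential, partialPotential, this]
  ring

lemma inner_potentialOp_left (hV : IsNonlocalPotential (weight ε) α V) (l : ℕ)
    (f h : Lp ℂ 2 halfLine) :
    inner ℂ (potentialOp hV l f) h = inner ℂ f (potentialOp hV l h) := by
  rw [potentialOp, ← inner_hsOp_conj_left (memLp_vKernel hV l)]
  · congr 1
    refine Lp.ext ?_
    filter_upwards [coeFn_hsOp (memLp_vKernel hV l) f,
      coeFn_hsOp (memLp_uncurry_conj (memLp_vKernel hV l)) f] with R h1 h2
    rw [h1, h2]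
    simp only [vKernel, Complex.conj_ofReal]
  · filter_upwards [ae_halfLine_pos] with R hR
    filter_upwards [ae_halfLine_pos] with R' hR'
    rw [vKernel, vKernel, partialPotential_comm hV l hR hR']
    congr 1
    ring

/-- The kernel is symmetric, so the adjoint has the conjugate kernel, and the difference has kernel
2i Im G_l/(√ρ√ρ), a product of free waves by `green_im`. -/
lemma inner_greenOp_sub (hε : 0 < ε) (hα : 0 < α) (l : ℕ) (hk : 0 < k) (f : Lp ℂ 2 halfLine) :
    inner ℂ f (greenOp hε hα l hk f) - inner ℂ (greenOp hε hα l hk f) f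
      = -2 * Complex.I * (1 / k : ℝ) * ‖(inner ℂ (freeVec hε hα l hk) f : ℂ)‖ ^ 2 := by
  have hg := memLp_gKernel hε hα l hk
  have hadj : inner ℂ (greenOp hε hα l hk f) f = inner ℂ f (hsOp _ (memLp_uncurry_conj hg) f) := by
    rw [← inner_conj_symm f, inner_hsOp_conj_left hg, inner_conj_symm]
    · rfl
    · refine Eventually.of_forall fun R => Eventually.of_forall fun R' => ?_
      rw [gKernel, gKernel, green_comm, mul_comm (rootDensity ε α R : ℂ)]
  have hop : greenOp hε hα l hk f - hsOp _ (memLp_uncurry_conj hg) f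
      = (-2 * Complex.I * (1 / k : ℝ) * inner ℂ (freeVec hε hα l hk) f) • freeVec hε hα l hk := by
    refine Lp.ext ?_
    filter_upwards [Lp.coeFn_sub (greenOp hε hα l hk f) (hsOp _ (memLp_uncurry_conj hg) f),
      coeFn_hsOp hg f, coeFn_hsOp (memLp_uncurry_conj hg) f, memLp_two_prod_right hg,
      memLp_two_prod_right (memLp_uncurry_conj hg),
      Lp.coeFn_smul (-2 * Complex.I * (1 / k : ℝ) * inner ℂ (freeVec hε hα l hk) f)
        (freeVec hε hα l hk),
      MemLp.coeFn_toLp (memLp_freeWave hε hα l hk), ae_halfLine_pos]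
      with R a1 a2 a3 a4 a5 a6 a7 hR
    rw [a1, Pi.sub_apply, greenOp, a2, a3, a6, Pi.smul_apply, freeVec, a7]
    refine (integral_sub (a4.integrable_mul (Lp.memLp f))
      (a5.integrable_mul (Lp.memLp f))).symm.trans ?_
    rw [L2.inner_def, smul_eq_mul, mul_right_comm, ← integral_const_mul]
    refine integral_congr_ae ?_
    filter_upwards [MemLp.coeFn_toLp (memLp_freeWave hε hα l hk), ae_halfLine_pos] with R' b1 hR'
    have n1 := ofReal_rootDensity_ne_zero ε α hR
    have n2 := ofReal_rootDensity_ne_zero ε α hR'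
    have hk0 : (k : ℂ) ≠ 0 := Complex.ofReal_ne_zero.mpr hk.ne'
    have him := Complex.sub_conj (green l k R R')
    rw [green_im l hk hR] at him
    rw [b1, RCLike.inner_apply, Complex.conj_ofReal, Pi.mul_apply, Pi.mul_apply, ← sub_mul]
    simp only [gKernel, freeWave, map_div₀, map_mul, Complex.conj_ofReal]
    rw [← sub_div, him]
    push_cast
    field_simp
  rw [hadj, ← inner_sub_right, hop, inner_smul_right, ← inner_conj_symm f, mul_assoc,
    Complex.mul_conj, Complex.normSq_eq_norm_sq]
  push_cast
  ring

lemma norm_potentialOp_le (hV : IsNonlocalPotential (weight ε) α V) (l : ℕ) :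
    ‖potentialOp hV l‖ ≤ (potentialNorm (weight ε) α V).toReal / √(2 * l + 1) :=
  (norm_hsOp_le _).trans (eLpNorm_vKernel_le hV l)

lemma norm_greenOp_le (hε : 0 < ε) (hα : 0 < α) (l : ℕ) (hk : 0 < k) :
    ‖greenOp hε hα l hk‖ ≤ 1 / (2 * α) :=
  (norm_hsOp_le _).trans (eLpNorm_gKernel_le hε hα l hk)

lemma norm_freeVec_sq_le (hε : 0 < ε) (hα : 0 < α) (l : ℕ) (hk : 0 < k) :
    ‖freeVec hε hα l hk‖ ^ 2
      ≤ k ^ 2 * ∫ R in Ioi (0 : ℝ), Real.exp (-(2 * α) * R) * R * sphBesselJ l (k * R) ^ 2 := by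
  have h : ((‖freeVec hε hα l hk‖ ^ 2 : ℝ) : ℂ)
      = ((∫ R, freeWave ε α l k R ^ 2 ∂halfLine : ℝ) : ℂ) := by
    have h1 := inner_self_eq_norm_sq_to_K (𝕜 := ℂ) (freeVec hε hα l hk)
    push_cast
    refine h1.symm.trans ?_
    rw [L2.inner_def, ← integral_complex_ofReal]
    refine integral_congr_ae ?_
    filter_upwards [MemLp.coeFn_toLp (memLp_freeWave hε hα l hk)] with R hR
    rw [freeVec, hR, RCLike.inner_apply, Complex.conj_ofReal]
    push_cast
    ring
  rw [Complex.ofReal_inj.mp h, ← integral_const_mul]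
  refine integral_mono_ae (integrable_freeWave_sq hε hα l hk)
    ((integrable_exp_mul_sphBesselJ_sq hα l hk).const_mul _) ?_
  filter_upwards [ae_halfLine_pos] with R hR
  exact freeWave_sq_le hε l k hR

/-- For real coupling constants all amplitudes are well defined. -/
lemma amplitudeDefined_of_real (hV : IsNonlocalPotential (weight ε) α V) (hε : 0 < ε) (hα : 0 < α)
    (l : ℕ) (hk : 0 < k) {g : ℂ} (hg : g.im = 0) : AmplitudeDefined (weight ε) α V l k g := by
  have hc : (1 / k : ℝ) ≠ 0 := by positivity
  have hG := inner_greenOp_sub hε hα l hk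
  have hs := inner_potentialOp_left hV l
  obtain ⟨F, hF⟩ := exists_sub_smul_eq_of_real hs (isCompactOperator_hsOp _) hc hG hg
  refine ⟨_, (isPartialAmplitude_iff hV hε hα l hk g _).mpr ⟨F, hF, rfl⟩, ?_⟩
  intro T hT
  obtain ⟨F', hF', rfl⟩ := (isPartialAmplitude_iff hV hε hα l hk g T).mp hT
  -- Two solutions differ by a homogeneous one, which is orthogonal to φ and so does not affect the
  -- amplitude.
  have h0 : F' - F = g • potentialOp hV l (greenOp hε hα l hk (F' - F)) := by
    rw [map_sub, map_sub, smul_sub, sub_eq_sub_iff_sub_eq_sub]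
    rw [hF', hF]
  have := inner_eq_zero_of_homogeneous hs hc hG hg h0
  rw [inner_sub_right, sub_eq_zero] at this
  simp only [this]

/-- A small perturbation of the identity is invertible, with a bound on the inverse. -/
lemma existsUnique_sub_eq_of_norm_le_half {H : Type*} [NormedAddCommGroup H] [NormedSpace ℂ H]
    [CompleteSpace H] {A : H →L[ℂ] H} (hA : ‖A‖ ≤ 1 / 2) (y : H) :
    (∃! x, x - A x = y) ∧ ∀ x, x - A x = y → ‖x‖ ≤ 2 * ‖y‖ := by
  have hb : ∀ x z, x - A x = z → ‖x‖ ≤ 2 * ‖z‖ := by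
    intro x z h
    have h1 : ‖A x‖ ≤ 1 / 2 * ‖x‖ := A.le_of_opNorm_le hA x
    have h2 : ‖x‖ ≤ ‖z‖ + ‖A x‖ := by
      rw [← h]
      simpa using norm_add_le (x - A x) (A x)
    linarith
  refine ⟨?_, fun x hx => hb x y hx⟩
  have hu := (ContinuousLinearMap.isUnit_iff_bijective).mp
    (isUnit_one_sub_of_norm_lt_one (x := A) (by linarith))
  obtain ⟨x, hx⟩ := hu.2 y
  refine ⟨x, hx, fun x' hx' => hu.1 ?_⟩
  rw [hx]
  exact hx'

/-- The bound |g| C(V)/(2α√(2l+1)) is free of k, hence so is the threshold. -/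
lemma exists_forall_norm_smul_le_half (hV : IsNonlocalPotential (weight ε) α V) (hε : 0 < ε)
    (hα : 0 < α) (g : ℂ) : ∃ l₀ : ℕ, ∀ (k : ℝ) (hk : 0 < k) (l : ℕ), l₀ ≤ l →
      ‖g • (potentialOp hV l ∘L greenOp hε hα l hk)‖ ≤ 1 / 2 := by
  set N := (potentialNorm (weight ε) α V).toReal
  have hN : 0 ≤ N := ENNReal.toReal_nonneg
  have ht : Tendsto (fun l : ℕ => ‖g‖ * (N / √(2 * l + 1) * (1 / (2 * α)))) atTop (𝓝 0) := by
    have h1 : Tendsto (fun l : ℕ => √(2 * (l : ℝ) + 1)) atTop atTop :=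
      Real.tendsto_sqrt_atTop.comp (tendsto_atTop_add_const_right _ _
        (tendsto_natCast_atTop_atTop.const_mul_atTop two_pos))
    have h2 := ((h1.const_div_atTop N).mul_const (1 / (2 * α))).const_mul ‖g‖
    simpa using h2
  obtain ⟨l₀, h⟩ := eventually_atTop.mp (ht.eventually_le_const (by norm_num : (0 : ℝ) < 1 / 2))
  refine ⟨l₀, fun k hk l hl => le_trans ?_ (h l hl)⟩
  rw [norm_smul]
  refine mul_le_mul_of_nonneg_left ?_ (norm_nonneg g)
  exact (ContinuousLinearMap.opNorm_comp_le _ _).trans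
    (mul_le_mul (norm_potentialOp_le hV l) (norm_greenOp_le hε hα l hk) (norm_nonneg _)
      (by positivity))

/-- For large `l` the equation is uniquely solvable, uniformly in `k`, and the amplitudes decay. -/
lemma exists_forall_uniquelySolvable (hV : IsNonlocalPotential (weight ε) α V) (hε : 0 < ε)
    (hα : 0 < α) (g : ℂ) : ∃ l₀ : ℕ, ∀ k : ℝ, 0 < k →
      (∀ l, l₀ ≤ l → UniquelySolvable (weight ε) α V l k g) ∧
      ∃ C : ℝ, 0 ≤ C ∧ ∀ l, l₀ ≤ l → 1 ≤ l → ∀ T, IsPartialAmplitude (weight ε) α V l k g T →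
        ‖T‖ ≤ C * (Real.exp (-beta α k * l) / (√(2 * l + 1) * √l)) := by
  obtain ⟨l₀, h⟩ := exists_forall_norm_smul_le_half hV hε hα g
  refine ⟨l₀, fun k hk => ⟨fun l hl => ?_, ?_⟩⟩
  · exact uniquelySolvable_of_existsUnique hV hε hα l hk g
      (existsUnique_sub_eq_of_norm_le_half (h k hk l hl) _).1
  · obtain ⟨C, hC, hCl⟩ := exists_integral_sphBesselJ_sq_le hα hk
    set N := (potentialNorm (weight ε) α V).toReal
    have hN : 0 ≤ N := ENNReal.toReal_nonneg
    refine ⟨‖g‖ / k * (2 * N * (k ^ 2 * C)), by positivity, fun l hl h1 T hT => ?_⟩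
    obtain ⟨F, hF, rfl⟩ := (isPartialAmplitude_iff hV hε hα l hk g T).mp hT
    have hb := (existsUnique_sub_eq_of_norm_le_half (h k hk l hl) _).2 F hF
    set φ := freeVec hε hα l hk
    have hφ : ‖φ‖ ^ 2 ≤ k ^ 2 * (C * (Real.exp (-beta α k * l) / √l)) :=
      (norm_freeVec_sq_le hε hα l hk).trans
        (mul_le_mul_of_nonneg_left (hCl l h1) (by positivity))
    have hVφ : ‖potentialOp hV l φ‖ ≤ N / √(2 * l + 1) * ‖φ‖ :=
      (potentialOp hV l).le_of_opNorm_le (norm_potentialOp_le hV l) φ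
    rw [norm_mul, norm_div, norm_neg, Complex.norm_real, Real.norm_of_nonneg hk.le]
    -- φ enters twice, once in the pairing and once through ‖F‖ ≤ 2‖𝒱φ‖, so the amplitude gets the
    -- full rate e^{−βl}/√l of ‖φ‖², besides the 1/√(2l+1) of the potential.
    calc ‖g‖ / k * ‖(inner ℂ φ F : ℂ)‖
        ≤ ‖g‖ / k * (‖φ‖ * (2 * (N / √(2 * l + 1) * ‖φ‖))) := by
          gcongr
          refine (norm_inner_le_norm _ _).trans ?_
          gcongr
          linarith
      _ = ‖g‖ / k * (2 * N / √(2 * l + 1)) * ‖φ‖ ^ 2 := by ring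
      _ ≤ ‖g‖ / k * (2 * N / √(2 * l + 1)) * (k ^ 2 * (C * (Real.exp (-beta α k * l) / √l))) := by
          gcongr
      _ = _ := by
          have : (0 : ℝ) < √(2 * l + 1) := by positivity
          have : (0 : ℝ) < √l := by positivity
          field_simp

end Operators

/-! ### The majorant -/

/-- Log-convexity of Γ at the midpoint of x and x + 1. -/
lemma Gamma_add_half_le {x : ℝ} (hx : 0 < x) :
    Real.Gamma (x + 1 / 2) ≤ Real.Gamma x * √x := by
  have h := Real.Gamma_mul_add_mul_le_rpow_Gamma_mul_rpow_Gamma hx (add_pos hx one_pos)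
    (one_half_pos (α := ℝ)) one_half_pos (add_halves 1)
  have hG := Real.Gamma_pos_of_pos hx
  rw [Real.Gamma_add_one hx.ne', ← Real.sqrt_eq_rpow, ← Real.sqrt_eq_rpow,
    Real.sqrt_mul hx.le, mul_left_comm, Real.mul_self_sqrt hG.le] at h
  rw [mul_comm]
  convert h using 2
  ring

lemma inv_sqrt_le_Gamma_div (l : ℕ) :
    1 / √((l : ℝ) + 1) ≤ Real.Gamma ((l : ℝ) + 1) / Real.Gamma ((l : ℝ) + 3 / 2) := by
  have h := Gamma_add_half_le (x := (l : ℝ) + 1) (by positivity)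
  rw [show (l : ℝ) + 1 + 1 / 2 = l + 3 / 2 by ring] at h
  have hG : 0 < Real.Gamma ((l : ℝ) + 3 / 2) := Real.Gamma_pos_of_pos (by positivity)
  rw [div_le_div_iff₀ (by positivity) hG, one_mul]
  exact h

/-- The same midpoint inequality half a unit lower, combined with Γ(l + 3/2) = (l + 1/2)Γ(l + 1/2).
-/
lemma Gamma_div_le_inv_sqrt (l : ℕ) :
    Real.Gamma ((l : ℝ) + 1) / Real.Gamma ((l : ℝ) + 3 / 2) ≤ 1 / √((l : ℝ) + 1 / 2) := by
  have hx : (0 : ℝ) < (l : ℝ) + 1 / 2 := by positivity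
  have h := Gamma_add_half_le hx
  have h2 := Real.Gamma_add_one hx.ne'
  rw [show (l : ℝ) + 1 / 2 + 1 / 2 = l + 1 by ring] at h
  rw [show (l : ℝ) + 1 / 2 + 1 = l + 3 / 2 by ring] at h2
  have hG : 0 < Real.Gamma ((l : ℝ) + 3 / 2) := Real.Gamma_pos_of_pos (by positivity)
  rw [div_le_div_iff₀ hG (by positivity), one_mul, h2]
  calc Real.Gamma ((l : ℝ) + 1) * √((l : ℝ) + 1 / 2)
      ≤ Real.Gamma ((l : ℝ) + 1 / 2) * √((l : ℝ) + 1 / 2) * √((l : ℝ) + 1 / 2) := by gcongr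
    _ = _ := by rw [mul_assoc, Real.mul_self_sqrt hx.le, mul_comm]

lemma rpow_neg_half_eq (l : ℕ) : (2 * (l : ℝ) + 1) ^ (-(1 / 2) : ℝ) = 1 / √(2 * (l : ℝ) + 1) := by
  rw [Real.rpow_neg (by positivity), ← Real.sqrt_eq_rpow, one_div]

lemma majorant_pos (β : ℝ) (l : ℕ) : 0 < majorant β l := by
  have h1 : 0 < Real.Gamma ((l : ℝ) + 1) := Real.Gamma_pos_of_pos (by positivity)
  have h2 : 0 < Real.Gamma ((l : ℝ) + 3 / 2) := Real.Gamma_pos_of_pos (by positivity)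
  unfold majorant
  positivity

lemma majorant_le_mul_exp (β : ℝ) (l : ℕ) :
    majorant β l ≤ 1 / (√(2 * (l : ℝ) + 1) * √((l : ℝ) + 1 / 2)) * Real.exp (-β * l) := by
  rw [majorant, rpow_neg_half_eq, ← one_div_mul_one_div]
  have := Gamma_div_le_inv_sqrt l
  gcongr

lemma majorant_le_inv_mul_exp (β : ℝ) {l : ℕ} (hl : 1 ≤ l) :
    majorant β l ≤ (l : ℝ)⁻¹ * Real.exp (-β * l) := by
  refine (majorant_le_mul_exp β l).trans ?_
  have h0 : (0 : ℝ) < l := by exact_mod_cast hl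
  have h : (l : ℝ) ≤ √(2 * (l : ℝ) + 1) * √((l : ℝ) + 1 / 2) := by
    calc (l : ℝ) = √l * √l := (Real.mul_self_sqrt h0.le).symm
      _ ≤ _ := mul_le_mul (Real.sqrt_le_sqrt (by linarith)) (Real.sqrt_le_sqrt (by linarith))
        (Real.sqrt_nonneg _) (Real.sqrt_nonneg _)
  rw [← one_div]
  gcongr

lemma majorant_le_two_mul_exp (β : ℝ) (l : ℕ) : majorant β l ≤ 2 * Real.exp (-β * l) := by
  refine (majorant_le_mul_exp β l).trans ?_
  have h0 : (0 : ℝ) ≤ l := l.cast_nonneg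
  have h1 : 1 ≤ √(2 * (l : ℝ) + 1) := Real.one_le_sqrt.mpr (by linarith)
  have h2 : 1 / 2 ≤ √((l : ℝ) + 1 / 2) := Real.le_sqrt_of_sq_le (by linarith)
  have h3 : 1 / 2 ≤ √(2 * (l : ℝ) + 1) * √((l : ℝ) + 1 / 2) := by nlinarith
  refine mul_le_mul_of_nonneg_right ?_ (Real.exp_pos _).le
  rw [div_le_iff₀ (by linarith)]
  linarith

/-- Converts the rate of Laplace's method into the Gamma quotient; the factor 2 comes from √(l+1) ≤
2√l, valid for l ≥ 1. -/
lemma div_sqrt_mul_sqrt_le_majorant (β : ℝ) {l : ℕ} (hl : 1 ≤ l) :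
    Real.exp (-β * l) / (√(2 * l + 1) * √l) ≤ 2 * majorant β l := by
  have h0 : (1 : ℝ) ≤ l := by exact_mod_cast hl
  have h1 : √((l : ℝ) + 1) ≤ 2 * √l := by
    rw [Real.sqrt_le_left (by positivity), mul_pow, Real.sq_sqrt (by linarith)]
    linarith
  have h2 : 1 / √(l : ℝ) ≤ 2 * (1 / √((l : ℝ) + 1)) := by
    rw [mul_one_div, div_le_div_iff₀ (by positivity) (by positivity)]
    linarith
  have h3 := inv_sqrt_le_Gamma_div l
  rw [majorant, rpow_neg_half_eq]
  calc Real.exp (-β * l) / (√(2 * l + 1) * √l)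
      = 1 / √(2 * (l : ℝ) + 1) * (1 / √l) * Real.exp (-β * l) := by field_simp
    _ ≤ 1 / √(2 * (l : ℝ) + 1)
        * (2 * (Real.Gamma ((l : ℝ) + 1) / Real.Gamma ((l : ℝ) + 3 / 2))) * Real.exp (-β * l) := by
        gcongr
        linarith
    _ = _ := by ring

lemma majorant_isBigO (β : ℝ) :
    majorant β =O[atTop] fun l : ℕ => (l : ℝ)⁻¹ * Real.exp (-β * l) := by
  refine Asymptotics.IsBigO.of_bound 1 ?_
  filter_upwards [eventually_ge_atTop 1] with l hl
  rw [one_mul, Real.norm_of_nonneg (majorant_pos β l).le, Real.norm_of_nonneg (by positivity)]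
  exact majorant_le_inv_mul_exp β hl

/-! ### Decay of the amplitudes and convergence of the partial-wave expansion -/

lemma isPartialAmplitude_partialAmplitude {w : ℝ → ℝ} {α : ℝ} {V : ℝ → ℝ → ℝ → ℝ} {l : ℕ} {k : ℝ}
    {g : ℂ} (h : AmplitudeDefined w α V l k g) :
    IsPartialAmplitude w α V l k g (partialAmplitude w α V l k g) :=
  Classical.epsilon_spec h.exists

/-- The finitely many indices below L are absorbed into the constant, as b is strictly positive. -/
lemma exists_forall_norm_le_mul {E : Type*} [NormedAddCommGroup E] (a : ℕ → E) {b : ℕ → ℝ}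
    (hb : ∀ l, 0 < b l) {C : ℝ} (hC : 0 ≤ C) {L : ℕ} (h : ∀ l, L ≤ l → ‖a l‖ ≤ C * b l) :
    ∃ D, 0 ≤ D ∧ ∀ l, ‖a l‖ ≤ D * b l := by
  have hs : ∀ l, 0 ≤ ‖a l‖ / b l := fun l => div_nonneg (norm_nonneg _) (hb l).le
  have hS : 0 ≤ ∑ l ∈ Finset.range L, ‖a l‖ / b l := Finset.sum_nonneg fun l _ => hs l
  refine ⟨C + ∑ l ∈ Finset.range L, ‖a l‖ / b l, add_nonneg hC hS, fun l => ?_⟩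
  rcases le_or_gt L l with hl | hl
  · exact (h l hl).trans (mul_le_mul_of_nonneg_right (by linarith) (hb l).le)
  · have := Finset.single_le_sum (fun i _ => hs i) (Finset.mem_range.mpr hl)
    rw [← div_le_iff₀ (hb l)]
    linarith

/-- Comparison with a polynomial times a geometric series of ratio Me^{−β} < 1. -/
lemma summable_mul_majorant_mul_pow (β C k : ℝ) (hC : 0 ≤ C) (hk : 0 < k) {M : ℝ} (hM : 1 < M)
    (hMβ : M < Real.exp β) :
    Summable fun l : ℕ => (2 * (l : ℝ) + 1) * (C * majorant β l / k) * M ^ l := by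
  have hr : ‖Real.exp (-β) * M‖ < 1 := by
    rw [Real.norm_of_nonneg (by positivity), Real.exp_neg, inv_mul_lt_iff₀ (Real.exp_pos _),
        mul_one]
    exact hMβ
  have h1 := summable_pow_mul_geometric_of_norm_lt_one 1 hr
  have h0 := summable_pow_mul_geometric_of_norm_lt_one 0 hr
  have hs := ((h1.mul_left 2).add h0).mul_left (2 * C / k)
  refine Summable.of_nonneg_of_le (fun l => ?_) (fun l => ?_) hs
  · have := majorant_pos β l
    positivity
  · have he : Real.exp (-β * l) = Real.exp (-β) ^ l := by rw [← Real.exp_nat_mul, mul_comm]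
    calc (2 * (l : ℝ) + 1) * (C * majorant β l / k) * M ^ l
        ≤ (2 * (l : ℝ) + 1) * (C * (2 * Real.exp (-β * l)) / k) * M ^ l := by
          gcongr
          exact majorant_le_two_mul_exp β l
      _ = _ := by
          rw [he, mul_pow]
          simp only [pow_one, pow_zero]
          ring

/-- The open region bounded by the ellipse with foci `±1` and half major axis `(M + M⁻¹)/2`. -/
def subEllipse (M : ℝ) : Set ℂ := {z | ‖z - 1‖ + ‖z + 1‖ < M + M⁻¹}

lemma isOpen_subEllipse (M : ℝ) : IsOpen (subEllipse M) :=
  isOpen_lt (by fun_prop) continuous_const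

/-- The ellipse corresponds to M = e^β, and its defining inequality is strict, so a slightly smaller
M still encloses z. -/
lemma exists_mem_subEllipse {β : ℝ} (hβ : 0 < β) {z : ℂ} (hz : z ∈ ellipse β) :
    ∃ M, 1 < M ∧ M < Real.exp β ∧ z ∈ subEllipse M := by
  have h1 : 1 < Real.exp β := Real.one_lt_exp_iff.mpr hβ
  have hc : Tendsto (fun M : ℝ => M + M⁻¹) (𝓝[<] Real.exp β)
      (𝓝 (Real.exp β + (Real.exp β)⁻¹)) :=
    (tendsto_id.add (tendsto_inv₀ (Real.exp_ne_zero β))).mono_left nhdsWithin_le_nhds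
  have hz' : ‖z - 1‖ + ‖z + 1‖ < Real.exp β + (Real.exp β)⁻¹ := by
    have : ‖z - 1‖ + ‖z + 1‖ < 2 * Real.cosh β := hz
    rwa [Real.cosh_eq, mul_div_cancel₀ _ two_ne_zero, Real.exp_neg] at this
  obtain ⟨M, ⟨hM1, hM2⟩, hM3⟩ :=
    ((show ∀ᶠ M in 𝓝[<] Real.exp β, M ∈ Ioo 1 (Real.exp β) from Ioo_mem_nhdsLT h1).and
      (hc.eventually_const_lt hz')).exists
  exact ⟨M, hM1, hM2, hM3⟩

lemma norm_partialWaveTerm_le {w : ℝ → ℝ} {α : ℝ} {V : ℝ → ℝ → ℝ → ℝ} {k : ℝ} (hk : 0 < k) {g : ℂ}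
    {C β : ℝ} (h : ∀ l, ‖partialAmplitude w α V l k g‖ ≤ C * majorant β l) {M : ℝ} (hM : 1 < M)
    {z : ℂ} (hz : z ∈ subEllipse M) (l : ℕ) :
    ‖partialWaveTerm w α V k g z l‖ ≤ (2 * (l : ℝ) + 1) * (C * majorant β l / k) * M ^ l := by
  have h1 : ‖(2 * (l : ℂ) + 1)‖ = 2 * (l : ℝ) + 1 := by
    have : (2 * (l : ℂ) + 1) = ((2 * (l : ℝ) + 1 : ℝ) : ℂ) := by push_cast; rfl
    rw [this, Complex.norm_real, Real.norm_of_nonneg (by positivity)]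
  rw [partialWaveTerm, norm_mul, norm_mul, norm_div, h1, Complex.norm_real,
    Real.norm_of_nonneg hk.le]
  have h2 := h l
  have h3 := norm_aeval_legendre_le hM (le_of_lt hz) l
  have h4 : 0 ≤ C * majorant β l := (norm_nonneg _).trans h2
  have h5 : 0 ≤ (2 * (l : ℝ) + 1) * (C * majorant β l / k) := by positivity
  gcongr

/-- The Weierstrass test is uniform on each smaller ellipse with M < e^β, and these open sets
exhaust the full one. -/
lemma summable_and_differentiableOn {w : ℝ → ℝ} {α : ℝ} {V : ℝ → ℝ → ℝ → ℝ} {k : ℝ} (hk : 0 < k)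
    {g : ℂ} {C β : ℝ} (hβ : 0 < β) (hC : 0 ≤ C)
    (h : ∀ l, ‖partialAmplitude w α V l k g‖ ≤ C * majorant β l) :
    (∀ z ∈ ellipse β, Summable (partialWaveTerm w α V k g z)) ∧
      DifferentiableOn ℂ (totalAmplitude w α V k g) (ellipse β) := by
  refine ⟨fun z hz => ?_, fun z hz => ?_⟩ <;>
    obtain ⟨M, hM, hMβ, hzM⟩ := exists_mem_subEllipse hβ hz <;>
    have hs := summable_mul_majorant_mul_pow β C k hC hk hM hMβ
  · exact Summable.of_norm_bounded hs (norm_partialWaveTerm_le hk h hM hzM)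
  · have hd := Complex.differentiableOn_tsum_of_summable_norm
      (F := fun l z => partialWaveTerm w α V k g z l) hs
      (fun l => ((Polynomial.differentiable_aeval (legendre l)).const_mul _).differentiableOn)
      (isOpen_subEllipse M) (fun l z hz => norm_partialWaveTerm_le hk h hM hz l)
    exact (hd.differentiableAt ((isOpen_subEllipse M).mem_nhds hzM)).differentiableWithinAt

end NonlocalScattering

end

theorem mainTheorem10 (α ε : ℝ) (hα : 0 < α) (hε : 0 < ε) (V : ℝ → ℝ → ℝ → ℝ)
    (hV : NonlocalScattering.IsNonlocalPotential (NonlocalScattering.weight ε) α V) (g : ℂ) :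
    -- for large `l`, uniformly in `k > 0`, the equation defining `T_l(k;g)` is uniquely solvable
    (∃ l₀ : ℕ, ∀ k : ℝ, 0 < k → ∀ l : ℕ, l₀ ≤ l →
      NonlocalScattering.UniquelySolvable (NonlocalScattering.weight ε) α V l k g) ∧
    -- for real `g`, all the amplitudes `T_l(k;g)`, `k > 0`, are well defined
    (g.im = 0 → ∀ k : ℝ, 0 < k → ∀ l : ℕ,
      NonlocalScattering.AmplitudeDefined (NonlocalScattering.weight ε) α V l k g) ∧
    ∀ k : ℝ, 0 < k →
      -- the bound on the partial amplitudes
      (∃ C : ℝ, 0 ≤ C ∧ ∀ l : ℕ,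
        NonlocalScattering.AmplitudeDefined (NonlocalScattering.weight ε) α V l k g →
        ‖NonlocalScattering.partialAmplitude (NonlocalScattering.weight ε) α V l k g‖ ≤
          C * NonlocalScattering.majorant (NonlocalScattering.beta α k) l) ∧
      (NonlocalScattering.majorant (NonlocalScattering.beta α k) =O[atTop]
        fun l : ℕ => (l : ℝ)⁻¹ * Real.exp (-NonlocalScattering.beta α k * l)) ∧
      ((fun l : ℕ =>
          NonlocalScattering.partialAmplitude (NonlocalScattering.weight ε) α V l k g) =O[atTop]
        fun l : ℕ => (l : ℝ)⁻¹ * Real.exp (-NonlocalScattering.beta α k * l)) ∧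
      -- the partial-wave expansion
      ((∀ l : ℕ,
          NonlocalScattering.AmplitudeDefined (NonlocalScattering.weight ε) α V l k g) →
        (∀ z ∈ NonlocalScattering.ellipse (NonlocalScattering.beta α k),
          Summable
            (NonlocalScattering.partialWaveTerm (NonlocalScattering.weight ε) α V k g z)) ∧
        DifferentiableOn ℂ
          (NonlocalScattering.totalAmplitude (NonlocalScattering.weight ε) α V k g)
          (NonlocalScattering.ellipse (NonlocalScattering.beta α k))) := by
  obtain ⟨l₀, h₀⟩ := NonlocalScattering.exists_forall_uniquelySolvable hV hε hα g
  refine ⟨⟨l₀, fun k hk => (h₀ k hk).1⟩,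
    fun hg k hk l => NonlocalScattering.amplitudeDefined_of_real hV hε hα l hk hg, fun k hk => ?_⟩
  obtain ⟨huniq, C, hC, hbound⟩ := h₀ k hk
  have hmaj := NonlocalScattering.majorant_isBigO (NonlocalScattering.beta α k)
  have hpos := NonlocalScattering.majorant_pos (NonlocalScattering.beta α k)
  -- The maximum with 1 excludes l = 0, where the estimate by 1/√l is not available.
  have hT : ∀ l, max l₀ 1 ≤ l →
      ‖NonlocalScattering.partialAmplitude (NonlocalScattering.weight ε) α V l k g‖ ≤
        2 * C * NonlocalScattering.majorant (NonlocalScattering.beta α k) l := by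
    intro l hl
    have h1 : 1 ≤ l := (le_max_right _ _).trans hl
    have h2 : l₀ ≤ l := (le_max_left _ _).trans hl
    refine (hbound l h2 h1 _ (NonlocalScattering.isPartialAmplitude_partialAmplitude
      (NonlocalScattering.amplitudeDefined_of_uniquelySolvable (huniq l h2)))).trans ?_
    refine (mul_le_mul_of_nonneg_left
      (NonlocalScattering.div_sqrt_mul_sqrt_le_majorant _ h1) hC).trans (le_of_eq ?_)
    ring
  obtain ⟨D, hD, hTD⟩ := NonlocalScattering.exists_forall_norm_le_mul _ hpos (by positivity) hT
  refine ⟨⟨D, hD, fun l _ => hTD l⟩, hmaj, ?_, fun _ => ?_⟩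
  · refine Asymptotics.IsBigO.trans (Asymptotics.IsBigO.of_bound D ?_) hmaj
    exact Eventually.of_forall fun l => by
      rw [Real.norm_of_nonneg (hpos l).le]; exact hTD l
  · exact NonlocalScattering.summable_and_differentiableOn hk
      (NonlocalScattering.beta_pos hα hk) hD hTD
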